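/- **Model.** Algorithms are programs for a uniform-cost random access machine: cells addressed by $\mathbb N$ hold natural numbers, and unit-cost instructions are loading a constant, addition, truncated subtraction, indirect loads and stores, tests against $0$, and an arbitrary further family of binary operations (the same for all algorithms below). Items, queries and answers are single words, and the memory is initially zero. A *dynamic problem* specifies which words are items, which are queries, and, for each finite set $S$ of items and each query, which answers are correct; so correctness depends only on the current set $S$, not on the order of insertions. An algorithm starts from $S=\emptyset$ and processes online a sequence of updates, interleaved with arbitrarily many queries, each of which it must answer correctly for the current set $S$. An *incremental* algorithm supports only insertions of items not in $S$; it may use a size parameter $n$ given with each call. A *fully dynamic algorithm with predictions* supports insertions of items not in $S$, each accompanied by an arbitrary natural number predicting when the item will be deleted, and deletions of items in $S$; the numbers $n$ and $T$ (an upper bound on the number of updates) are given with each call. When the $i$-th inserted element is deleted, its error $\eta_i$ is the number of other elements of the current set that are predicted to be deleted no later than it, i.e. the number of current elements predicted to be deleted earlier than the $i$-th one (ties counted) that are actually deleted later or never. **Theorem 1.5.** There is an absolute constant $C$ such that the following holds. For every incremental algorithm $P$ there is a fully dynamic algorithm with predictions $D$ such that, for every dynamic problem and all natural numbers $n$, $T\ge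 2$, $\Gamma$, $Q$: if $P$ with parameter $n$ solves the problem on all sequences with at most $T$ insertions, with worst-case time at most $\Gamma$ for each insertion and at most $Q$ for each query, then $D$ with parameters $n,T$ solves the problem on all sequences with at most $T$ updates, and in the worst case * each insertion takes at most $C\cdot\Gamma\log^2 T$ steps; * the deletion of the $i$-th inserted element takes at most $C\cdot(1+\eta_i)\,\Gamma\log^2 T$ steps; * each query takes at most $C\cdot Q$ steps. -/

import Mathlib

/-!  A uniform-cost random access machine, and dynamic algorithms running on it. -/

/-- The memory of the machine: every cell, addressed by a natural number, holds a natural number. -/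
abbrev Memory : Type := ℕ → ℕ

/-- Programs of the random access machine, in structured form.  `i`, `j`, `k` are fixed addresses
written in the program; `load` and `store` are the indirect accesses.  Besides addition and
truncated subtraction, the instruction set may hold further binary operations, named by `ι`
(multiplication, bit operations, reading the `k`-th word of the description of an item, ...). -/
inductive Program (ι : Type) : Type
  | const (i c : ℕ)             -- M[i] := c
  | add (i j k : ℕ)             -- M[i] := M[j] + M[k]
  | sub (i j k : ℕ)             -- M[i] := max (M[j] - M[k]) 0
  | prim (f : ι) (i j k : ℕ)    -- M[i] := f (M[j], M[k])
  | load (i j : ℕ)              -- M[i] := M[M[j]]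
  | store (i j : ℕ)             -- M[M[i]] := M[j]
  | seq (p q : Program ι)       -- p; q
  | ite (i : ℕ) (p q : Program ι)    -- if M[i] ≠ 0 then p else q
  | loop (i : ℕ) (p : Program ι)     -- while M[i] ≠ 0 do p

/-- `Exec prim p m t m'`: started on memory `m`, the program `p` halts after exactly `t` steps with
memory `m'`.  Each instruction and each evaluation of a test is one step. -/
inductive Exec {ι : Type} (prim : ι → ℕ → ℕ → ℕ) : Program ι → Memory → ℕ → Memory → Prop
  | const (i c : ℕ) (m : Memory) :
      Exec prim (.const i c) m 1 (Function.update m i c)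
  | add (i j k : ℕ) (m : Memory) :
      Exec prim (.add i j k) m 1 (Function.update m i (m j + m k))
  | sub (i j k : ℕ) (m : Memory) :
      Exec prim (.sub i j k) m 1 (Function.update m i (m j - m k))
  | prim (f : ι) (i j k : ℕ) (m : Memory) :
      Exec prim (.prim f i j k) m 1 (Function.update m i (prim f (m j) (m k)))
  | load (i j : ℕ) (m : Memory) :
      Exec prim (.load i j) m 1 (Function.update m i (m (m j)))
  | store (i j : ℕ) (m : Memory) :
      Exec prim (.store i j) m 1 (Function.update m (m i) (m j))
  | seq {p q : Program ι} {m m' m'' : Memory} {s t : ℕ} :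
      Exec prim p m s m' → Exec prim q m' t m'' → Exec prim (.seq p q) m (s + t) m''
  | ite_true {i : ℕ} {p q : Program ι} {m m' : Memory} {t : ℕ} :
      m i ≠ 0 → Exec prim p m t m' → Exec prim (.ite i p q) m (t + 1) m'
  | ite_false {i : ℕ} {p q : Program ι} {m m' : Memory} {t : ℕ} :
      m i = 0 → Exec prim q m t m' → Exec prim (.ite i p q) m (t + 1) m'
  | loop_true {i : ℕ} {p : Program ι} {m m' m'' : Memory} {s t : ℕ} :
      m i ≠ 0 → Exec prim p m s m' → Exec prim (.loop i p) m' t m'' →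
      Exec prim (.loop i p) m (s + t + 1) m''
  | loop_false {i : ℕ} {p : Program ι} {m : Memory} :
      m i = 0 → Exec prim (.loop i p) m 1 m

/-- An operation is called by placing its arguments in the cells `0, 1, 2, ...`; the rest of the
memory is what the preceding operations left behind. -/
def enter (args : List ℕ) (m : Memory) : Memory :=
  fun a => if a < args.length then args.getD a 0 else m a

/-- A data structure problem about a set of items.  Which answers to a query are correct depends on
the current set of items only, not on the order in which the items were inserted. -/
structure DynProblem : Type where
  /-- the items that may be inserted -/
  items : Set ℕ
  /-- the queries that may be asked -/
  queries : Set ℕ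
  /-- `correct S q a`: `a` is a correct answer to the query `q` when the current set is `S` -/
  correct : Finset ℕ → ℕ → ℕ → Prop

/-- An incremental (insertion-only) algorithm: one program per kind of operation. -/
structure IncrementalAlg (ι : Type) : Type where
  onInsert : Program ι
  onQuery : Program ι

/-- `IncrementalAlg.Reach prim P Pr n T S m`: from the empty set and the all-zero memory, some
sequence of at most `T` insertions of new items, interleaved with queries, leads `P` to the current
set `S` and the memory `m`.  The number `n` is a size parameter given to `P` with each call. -/
inductive IncrementalAlg.Reach {ι : Type} (prim : ι → ℕ → ℕ → ℕ) (P : IncrementalAlg ι)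
    (Pr : DynProblem) (n T : ℕ) : Finset ℕ → Memory → Prop
  | start : Reach prim P Pr n T ∅ (fun _ => 0)
  | ins {S : Finset ℕ} {m m' : Memory} {x t : ℕ} :
      Reach prim P Pr n T S m → S.card < T → x ∈ Pr.items → x ∉ S →
      Exec prim P.onInsert (enter [x, n] m) t m' → Reach prim P Pr n T (insert x S) m'
  | ask {S : Finset ℕ} {m m' : Memory} {q t : ℕ} :
      Reach prim P Pr n T S m → q ∈ Pr.queries →
      Exec prim P.onQuery (enter [q, n] m) t m' → Reach prim P Pr n T S m'

/-- On all sequences with at most `T` insertions, the incremental algorithm performs each insertion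
in at most `Γ` steps and answers each query correctly (the answer is left in cell `0`) in at
most `Q` steps, in the worst case. -/
def IncrementalAlg.Solves {ι : Type} (prim : ι → ℕ → ℕ → ℕ) (P : IncrementalAlg ι)
    (Pr : DynProblem) (n T Γ Q : ℕ) : Prop :=
  ∀ (S : Finset ℕ) (m : Memory), P.Reach prim Pr n T S m →
    (∀ x ∈ Pr.items, x ∉ S → S.card < T →
      ∃ (t : ℕ) (m' : Memory), Exec prim P.onInsert (enter [x, n] m) t m' ∧ t ≤ Γ) ∧
    (∀ q ∈ Pr.queries,
      ∃ (t : ℕ) (m' : Memory), Exec prim P.onQuery (enter [q, n] m) t m' ∧ t ≤ Q ∧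
        Pr.correct S q (m' 0))

/-- A fully dynamic algorithm with predictions: one program per kind of operation. -/
structure FullyDynamicAlg (ι : Type) : Type where
  onInsert : Program ι
  onDelete : Program ι
  onQuery : Program ι

/-- `FullyDynamicAlg.Reach prim D Pr n T k S pred m`: from the empty set and the all-zero memory,
some sequence of `k ≤ T` updates (insertions of items that are not in the current set, each with an
arbitrary number `d` predicting when the item will be deleted, and deletions of current items),
interleaved with queries, leads `D` to the current set `S` and the memory `m`; `pred x` is the
prediction that came with the last insertion of `x`. -/
inductive FullyDynamicAlg.Reach {ι : Type} (prim : ι → ℕ → ℕ → ℕ) (D : FullyDynamicAlg ι)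
    (Pr : DynProblem) (n T : ℕ) : ℕ → Finset ℕ → (ℕ → ℕ) → Memory → Prop
  | start : Reach prim D Pr n T 0 ∅ (fun _ => 0) (fun _ => 0)
  | ins {k : ℕ} {S : Finset ℕ} {pred : ℕ → ℕ} {m m' : Memory} {x d t : ℕ} :
      Reach prim D Pr n T k S pred m → k < T → x ∈ Pr.items → x ∉ S →
      Exec prim D.onInsert (enter [x, d, n, T] m) t m' →
      Reach prim D Pr n T (k + 1) (insert x S) (Function.update pred x d) m'
  | del {k : ℕ} {S : Finset ℕ} {pred : ℕ → ℕ} {m m' : Memory} {x t : ℕ} :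
      Reach prim D Pr n T k S pred m → k < T → x ∈ S →
      Exec prim D.onDelete (enter [x, n, T] m) t m' →
      Reach prim D Pr n T (k + 1) (S.erase x) pred m'
  | ask {k : ℕ} {S : Finset ℕ} {pred : ℕ → ℕ} {m m' : Memory} {q t : ℕ} :
      Reach prim D Pr n T k S pred m → q ∈ Pr.queries →
      Exec prim D.onQuery (enter [q, n, T] m) t m' → Reach prim D Pr n T k S pred m'

/-- The prediction error of an item `x` that is being deleted from the current set `S`: the number
of other items which were predicted to be deleted before `x`, but are still there, so that their
deletion comes after that of `x`.  An item with the same prediction as `x` counts as well. -/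
def predictionError (S : Finset ℕ) (pred : ℕ → ℕ) (x : ℕ) : ℕ :=
  {y ∈ S.erase x | pred y ≤ pred x}.card

/-- On all sequences with at most `T` updates, the fully dynamic algorithm performs each insertion
in at most `tIns` steps, each deletion of an item with prediction error `η` in at most `tDel η`
steps, and answers each query correctly (the answer is left in cell `0`) in at most `tQuery`
steps, in the worst case. -/
def FullyDynamicAlg.Solves {ι : Type} (prim : ι → ℕ → ℕ → ℕ) (D : FullyDynamicAlg ι)
    (Pr : DynProblem) (n T : ℕ) (tIns : ℝ) (tDel : ℕ → ℝ) (tQuery : ℝ) : Prop :=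
  ∀ (k : ℕ) (S : Finset ℕ) (pred : ℕ → ℕ) (m : Memory), D.Reach prim Pr n T k S pred m →
    (k < T → ∀ x ∈ Pr.items, x ∉ S → ∀ d : ℕ,
      ∃ (t : ℕ) (m' : Memory), Exec prim D.onInsert (enter [x, d, n, T] m) t m' ∧
        (t : ℝ) ≤ tIns) ∧
    (k < T → ∀ x ∈ S,
      ∃ (t : ℕ) (m' : Memory), Exec prim D.onDelete (enter [x, n, T] m) t m' ∧
        (t : ℝ) ≤ tDel (predictionError S pred x)) ∧
    (∀ q ∈ Pr.queries,
      ∃ (t : ℕ) (m' : Memory), Exec prim D.onQuery (enter [q, n, T] m) t m' ∧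
        (t : ℝ) ≤ tQuery ∧ Pr.correct S q (m' 0))

/-!
The dynamic algorithm keeps `N = O(log T)` copies of the incremental algorithm, with a log of all
writes, so that the last insertions on a copy can be taken back.  The items of a copy form a stack.
An item with few predecessors in the order of the predictions has to be near the top; to this
end the copies are reorganized in turns, at the level `i` after every `2 ^ i` updates, in the
background, and at any time some copy is idle and answers the queries.  For every level, the items
that are expected to be deleted next are maintained with tournament trees.
-/

namespace RamDyn

/-! ### Determinism of the machine -/

/-! Let `J` be the binary logarithm of `T`, rounded up. There are `N = J + 1` copies of the
incremental algorithm. Each copy keeps its items as a stack in the order in which they were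
inserted, and logs its writes, so that the last insertion can be undone in time `O(Γ + 1)`
(`spec_push`, `spec_pop`). Since correctness depends only on the set, a copy may hold the items in
any order. Deleting an item at depth `d` means undoing `d + 1` insertions and redoing `d` of them
(`spec_remove`). The theorem follows if on each of the `N` copies the depth is `O(N + η)`; this is
`CInv.depth`.

Level `i < J` has the period `B_i = N * 2 ^ i` and the capacity `K_i = 16 * B_i`, and `L i` is the
set of the `K_i` items with the earliest predictions. Time is divided at level `i` into blocks of `2
^ i` updates, given to the copies in turn. At the beginning of its block at level `i`, a copy that
is idle starts a job. It pops all entries with tags up to `i + 1` and pushes them back in passes: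
those outside `L i` with tag `i + 1`, then those outside `L (i - 1)` with tag `i`, and so on; what
is left gets tag `0`. Afterwards a tag above `l` certifies a rank of about `K_l` or more, and at
most about `K_l` entries have tags up to `l`. An update spoils both facts by at most one
(`Upd.age`), and within about two periods level `l` is rebuilt. So an item of rank below `11 * B_l`
has a tag up to `l` and is among the top `35 * B_l` entries. Choosing the smallest such `l` bounds
the depth by a multiple of `N` plus the rank.

A job at level `j` takes at most `216 * B_j + 3` elementary steps, plus at most two for every update
meanwhile. Each update performs `250 * N` steps on every copy, so the job ends before its block of
`2 ^ j` updates does (`CInv.advance`, `CInv.micro`). Hence every busy copy owns the current block of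
some level, and as there are more copies than levels, one copy is idle (`exists_idle`). Its stack is
exactly the current set. Queries run on such a copy and are rolled back (`spec_query`).

The sets `L i` change by one element per update and are maintained with two tournament trees per
level, in time `O(N)` each (`spec_levelIns`, `spec_levelDel`). An update thus costs `O(N ^ 2 * (Γ +
1))`, with a further factor `1 + η` for a deletion.

All programs are written in a small language with exact step counts and compiled to the machine by
`Cmd.Run.exec`. The correspondence `Repr` between memory and current set is preserved by every
operation (`repr_of_reach`). -/

theorem Exec.det {ι : Type} {prim : ι → ℕ → ℕ → ℕ} {p : Program ι} {m m₁ m₂ : Memory} {t₁ t₂ : ℕ}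
    (h₁ : Exec prim p m t₁ m₁) (h₂ : Exec prim p m t₂ m₂) : t₁ = t₂ ∧ m₁ = m₂ := by
  induction h₁ generalizing t₂ m₂ with
  | const | add | sub | prim | load | store => cases h₂; exact ⟨rfl, rfl⟩
  | seq _ _ ih₁ ih₂ =>
    cases h₂ with
    | seq a b =>
      obtain ⟨rfl, rfl⟩ := ih₁ a
      obtain ⟨rfl, rfl⟩ := ih₂ b
      exact ⟨rfl, rfl⟩
  | ite_true h _ ih =>
    cases h₂ with
    | ite_true _ a => obtain ⟨rfl, rfl⟩ := ih a; exact ⟨rfl, rfl⟩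
    | ite_false h' => exact absurd h' h
  | ite_false h _ ih =>
    cases h₂ with
    | ite_true h' => exact absurd h h'
    | ite_false _ a => obtain ⟨rfl, rfl⟩ := ih a; exact ⟨rfl, rfl⟩
  | loop_true h _ _ ih₁ ih₂ =>
    cases h₂ with
    | loop_true _ a b =>
      obtain ⟨rfl, rfl⟩ := ih₁ a
      obtain ⟨rfl, rfl⟩ := ih₂ b
      exact ⟨rfl, rfl⟩
    | loop_false h' => exact absurd h' h
  | loop_false h =>
    cases h₂ with
    | loop_true h' => exact absurd h h'
    | loop_false => exact ⟨rfl, rfl⟩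

/-- Absorbs additive constants: a bound `Γ` or `Q` for a call that really occurs is at least one, so
`Γ + 1` and the fixed overhead of a query are within a constant factor. -/
theorem Exec.one_le {ι : Type} {prim : ι → ℕ → ℕ → ℕ} {p : Program ι} {m m' : Memory} {t : ℕ}
    (h : Exec prim p m t m') : 1 ≤ t := by
  induction h <;> omega

/-! ### A small language with named registers and arrays -/

/-- Registers that the operations on a single copy or level leave alone. -/
inductive KReg | T | N | J | n | W | last | cur | X | D | c | i | s | hx | ans
  deriving DecidableEq

/-- Registers of loops around elementary stack and tree operations. -/
inductive MReg | tp | vv | hh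
  deriving DecidableEq

/-- Scratch registers. -/
inductive SReg | next | lp | wa | wv | p | h | tg | t1 | t2 | ra | rb | rc
  deriving DecidableEq

inductive Reg
  | k (x : KReg)
  | m (x : MReg)
  | s (x : SReg)
  deriving DecidableEq

/-- Arrays with one row for each copy of the simulated algorithm. -/
inductive CArr | LA | LV | LPA | STK | BND | SPA | TAG | QU | HD | MK | TL | PH | LVL
  deriving DecidableEq

/-- Arrays with one row for each level. -/
inductive LArr | LOW | MAXT | MINT | LSZ | ZC | CC
  deriving DecidableEq

/-- Tables of items. -/
inductive GArr | ITEM | PRED | ALIVE | HOF | PAR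
  deriving DecidableEq

/-- Scratch arrays. -/
inductive TArr | TMP | TMPT
  deriving DecidableEq

/-- Tables computed from `T`. -/
inductive BArr | P2 | CAP
  deriving DecidableEq

/-- The memory of the simulated copies. -/
inductive MArr | PTR | VAL
  deriving DecidableEq

inductive Arr
  | c (x : CArr)
  | l (x : LArr)
  | g (x : GArr)
  | t (x : TArr)
  | b (x : BArr)
  | m (x : MArr)
  deriving DecidableEq

/-- The residue modulo 3 separates the three kinds of registers. -/
def Reg.code : Reg → ℕ
  | .k x => 3 * x.ctorIdx
  | .m x => 3 * x.ctorIdx + 1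
  | .s x => 3 * x.ctorIdx + 2

def Arr.code : Arr → ℕ
  | .c x => x.ctorIdx
  | .l x => 16 + x.ctorIdx
  | .g x => 24 + x.ctorIdx
  | .t x => 32 + x.ctorIdx
  | .b x => 40 + x.ctorIdx
  | .m x => 48 + x.ctorIdx

theorem Reg.code_inj : Function.Injective Reg.code := by
  intro a b h
  rcases a with a | a | a <;> rcases b with b | b | b <;> simp only [Reg.code] at h <;>
    first
    | omega
    | (congr 1
       first
       | rw [← KReg.ofNat_ctorIdx a, ← KReg.ofNat_ctorIdx b]
       | rw [← MReg.ofNat_ctorIdx a, ← MReg.ofNat_ctorIdx b]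
       | rw [← SReg.ofNat_ctorIdx a, ← SReg.ofNat_ctorIdx b]
       congr 1 <;> omega)

theorem CArr.ctorIdx_lt (x : CArr) : x.ctorIdx < 16 := by cases x <;> decide
theorem LArr.ctorIdx_lt (x : LArr) : x.ctorIdx < 8 := by cases x <;> decide
theorem GArr.ctorIdx_lt (x : GArr) : x.ctorIdx < 8 := by cases x <;> decide
theorem TArr.ctorIdx_lt (x : TArr) : x.ctorIdx < 8 := by cases x <;> decide
theorem BArr.ctorIdx_lt (x : BArr) : x.ctorIdx < 8 := by cases x <;> decide
theorem MArr.ctorIdx_lt (x : MArr) : x.ctorIdx < 8 := by cases x <;> decide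

theorem Arr.code_lt (a : Arr) : a.code < 56 := by
  rcases a with x | x | x | x | x | x <;> simp only [Arr.code]
  · have := x.ctorIdx_lt; omega
  · have := x.ctorIdx_lt; omega
  · have := x.ctorIdx_lt; omega
  · have := x.ctorIdx_lt; omega
  · have := x.ctorIdx_lt; omega
  · have := x.ctorIdx_lt; omega

theorem Arr.code_inj : Function.Injective Arr.code := by
  intro a b h
  rcases a with a | a | a | a | a | a <;> rcases b with b | b | b | b | b | b <;>
    simp only [Arr.code] at h <;> have ha := a.ctorIdx_lt <;> have hb := b.ctorIdx_lt <;>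
    first
    | omega
    | (congr 1
       first
       | rw [← CArr.ofNat_ctorIdx a, ← CArr.ofNat_ctorIdx b]
       | rw [← LArr.ofNat_ctorIdx a, ← LArr.ofNat_ctorIdx b]
       | rw [← GArr.ofNat_ctorIdx a, ← GArr.ofNat_ctorIdx b]
       | rw [← TArr.ofNat_ctorIdx a, ← TArr.ofNat_ctorIdx b]
       | rw [← BArr.ofNat_ctorIdx a, ← BArr.ofNat_ctorIdx b]
       | rw [← MArr.ofNat_ctorIdx a, ← MArr.ofNat_ctorIdx b]
       congr 1 <;> omega)

/-- A state: the argument cells, the registers and the arrays. -/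
structure St where
  io : Fin 4 → ℕ
  r : Reg → ℕ
  a : Arr → ℕ → ℕ

namespace St

def setR (σ : St) (x : Reg) (v : ℕ) : St := { σ with r := fun y => if y = x then v else σ.r y }

def setA (σ : St) (k : Arr) (i v : ℕ) : St :=
  { σ with a := fun l => if l = k then Function.update (σ.a k) i v else σ.a l }

def setOut (σ : St) (v : ℕ) : St := { σ with io := fun j => if j = 0 then v else σ.io j }

@[simp] theorem setR_r (σ : St) (x : Reg) (v : ℕ) (y : Reg) :
    (σ.setR x v).r y = if y = x then v else σ.r y := rfl
@[simp] theorem setR_a (σ : St) (x : Reg) (v : ℕ) : (σ.setR x v).a = σ.a := rfl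
@[simp] theorem setR_io (σ : St) (x : Reg) (v : ℕ) : (σ.setR x v).io = σ.io := rfl
@[simp] theorem setA_r (σ : St) (k : Arr) (i v : ℕ) : (σ.setA k i v).r = σ.r := rfl
@[simp] theorem setA_io (σ : St) (k : Arr) (i v : ℕ) : (σ.setA k i v).io = σ.io := rfl
@[simp] theorem setA_a (σ : St) (k : Arr) (i v : ℕ) (l : Arr) :
    (σ.setA k i v).a l = if l = k then Function.update (σ.a k) i v else σ.a l := rfl
@[simp] theorem setOut_r (σ : St) (v : ℕ) : (σ.setOut v).r = σ.r := rfl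
@[simp] theorem setOut_a (σ : St) (v : ℕ) : (σ.setOut v).a = σ.a := rfl
@[simp] theorem setOut_io (σ : St) (v : ℕ) (j : Fin 4) :
    (σ.setOut v).io j = if j = 0 then v else σ.io j := rfl

end St

/-- Expressions. -/
inductive Ex
  | lit (n : ℕ)
  | arg (j : Fin 4)
  | reg (x : Reg)
  | add (a b : Ex)
  | sub (a b : Ex)
  | get (k : Arr) (i : Ex)

namespace Ex

def ev (σ : St) : Ex → ℕ
  | lit n => n
  | arg j => σ.io j
  | reg x => σ.r x
  | add a b => a.ev σ + b.ev σ
  | sub a b => a.ev σ - b.ev σ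
  | get k i => σ.a k (i.ev σ)

/-- The number of machine steps for the evaluation. -/
def cost : Ex → ℕ
  | lit _ => 1
  | arg _ => 2
  | reg _ => 2
  | add a b => a.cost + b.cost + 1
  | sub a b => a.cost + b.cost + 1
  | get _ i => i.cost + 9

end Ex

/-- Commands. -/
inductive Cmd (ι : Type)
  | skip
  | set (x : Reg) (e : Ex)
  | put (k : Arr) (i e : Ex)
  | out (e : Ex)
  | prim (f : ι) (x y z : Reg)
  | seq (p q : Cmd ι)
  | ite (e : Ex) (p q : Cmd ι)
  | while (e : Ex) (p : Cmd ι)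

namespace Cmd

variable {ι : Type}

/-- Big-step semantics, with the number of machine steps. -/
inductive Run (prim : ι → ℕ → ℕ → ℕ) : Cmd ι → St → ℕ → St → Prop
  | skip (σ) : Run prim .skip σ 1 σ
  | set (x e σ) : Run prim (.set x e) σ (e.cost + 2) (σ.setR x (e.ev σ))
  | put (k i e σ) : Run prim (.put k i e) σ (i.cost + e.cost + 9) (σ.setA k (i.ev σ) (e.ev σ))
  | out (e σ) : Run prim (.out e) σ (e.cost + 2) (σ.setOut (e.ev σ))
  | prim (f x y z σ) : Run prim (.prim f x y z) σ 1 (σ.setR x (prim f (σ.r y) (σ.r z)))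
  | seq {p q σ σ₁ σ₂ s t} : Run prim p σ s σ₁ → Run prim q σ₁ t σ₂ →
      Run prim (.seq p q) σ (s + t) σ₂
  | ite_true {e p q σ σ₁ t} : e.ev σ ≠ 0 → Run prim p σ t σ₁ →
      Run prim (.ite e p q) σ (e.cost + (t + 1)) σ₁
  | ite_false {e p q σ σ₁ t} : e.ev σ = 0 → Run prim q σ t σ₁ →
      Run prim (.ite e p q) σ (e.cost + (t + 1)) σ₁
  | while_true {e p σ σ₁ σ₂ s t} : e.ev σ ≠ 0 → Run prim p σ s σ₁ →
      Run prim (.while e p) σ₁ t σ₂ → Run prim (.while e p) σ (e.cost + (s + t + 1)) σ₂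
  | while_false {e p σ} : e.ev σ = 0 → Run prim (.while e p) σ (e.cost + 1) σ

end Cmd

/-! ### Compilation -/

/-- Cells below 4 hold arguments; elsewhere the residue modulo 64 separates registers (4),
temporaries (5) and arrays (8 and above). As 64 is a power of two, an index becomes an address by
six doublings, without multiplication. -/
abbrev regAddr (x : Reg) : ℕ := 64 * x.code + 4
abbrev arrAddr (k : Arr) (i : ℕ) : ℕ := 64 * i + (8 + k.code)
abbrev tmpAddr (d : ℕ) : ℕ := 64 * d + 5

/-- The memory `m` represents the state `σ`. -/
structure Rel (σ : St) (m : Memory) : Prop where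
  io : ∀ j : Fin 4, m j = σ.io j
  reg : ∀ x, m (regAddr x) = σ.r x
  arr : ∀ k i, m (arrAddr k i) = σ.a k i

theorem Rel.tmp {σ : St} {m : Memory} (h : Rel σ m) (d v : ℕ) :
    Rel σ (Function.update m (tmpAddr d) v) := by
  refine ⟨fun j => ?_, fun x => ?_, fun k i => ?_⟩
  · rw [Function.update_of_ne (by have := j.isLt; simp only [tmpAddr]; omega), h.io]
  · rw [Function.update_of_ne (by simp only [regAddr, tmpAddr]; omega), h.reg]
  · have := k.code_lt
    rw [Function.update_of_ne (by simp only [arrAddr, tmpAddr]; omega), h.arr]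

theorem Rel.setR {σ : St} {m : Memory} (h : Rel σ m) (x : Reg) (v : ℕ) :
    Rel (σ.setR x v) (Function.update m (regAddr x) v) := by
  refine ⟨fun j => ?_, fun y => ?_, fun k i => ?_⟩
  · rw [Function.update_of_ne (by have := j.isLt; simp only [regAddr]; omega), h.io]; rfl
  · by_cases hy : y = x
    · subst hy; simp
    · rw [Function.update_of_ne, h.reg]
      · simp [hy]
      · intro h'
        exact hy (Reg.code_inj (by simp only [regAddr] at h'; omega))
  · have := k.code_lt
    rw [Function.update_of_ne (by simp only [arrAddr, regAddr]; omega), h.arr]; rfl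

theorem Rel.setA {σ : St} {m : Memory} (h : Rel σ m) (k : Arr) (i v : ℕ) :
    Rel (σ.setA k i v) (Function.update m (arrAddr k i) v) := by
  have hk := k.code_lt
  refine ⟨fun j => ?_, fun y => ?_, fun l j => ?_⟩
  · rw [Function.update_of_ne (by have := j.isLt; simp only [arrAddr]; omega), h.io]; rfl
  · rw [Function.update_of_ne (by simp only [arrAddr, regAddr]; omega), h.reg]; rfl
  · have hl := l.code_lt
    by_cases hlk : l = k
    · subst hlk
      by_cases hij : j = i
      · subst hij; simp
      · rw [Function.update_of_ne (by simp only [arrAddr]; omega), h.arr]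
        simp [Function.update_of_ne hij]
    · rw [Function.update_of_ne, h.arr]
      · simp [hlk]
      · intro h'
        exact hlk (Arr.code_inj (by simp only [arrAddr] at h'; omega))

theorem Rel.setOut {σ : St} {m : Memory} (h : Rel σ m) (v : ℕ) :
    Rel (σ.setOut v) (Function.update m 0 v) := by
  refine ⟨fun j => ?_, fun x => ?_, fun k i => ?_⟩
  · by_cases hj : j = 0
    · subst hj; simp
    · have : (j : ℕ) ≠ 0 := fun h' => hj (Fin.ext h')
      rw [Function.update_of_ne this, h.io]; simp [hj]
  · rw [Function.update_of_ne (by simp only [regAddr]; omega), h.reg]; rfl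
  · rw [Function.update_of_ne (by simp only [arrAddr]; omega), h.arr]; rfl

/-- The state after a call with the given arguments. -/
def St.enter (args : List ℕ) (σ : St) : St :=
  { σ with io := fun j => if (j : ℕ) < args.length then args.getD j 0 else σ.io j }

theorem Rel.enter {σ : St} {m : Memory} (h : Rel σ m) {args : List ℕ} (hl : args.length ≤ 4) :
    Rel (σ.enter args) (_root_.enter args m) := by
  refine ⟨fun j => ?_, fun x => ?_, fun k i => ?_⟩
  · simp only [_root_.enter, St.enter, h.io]
  · simp only [_root_.enter, regAddr]
    rw [if_neg (by omega)]; exact h.reg x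
  · simp only [_root_.enter, arrAddr]
    rw [if_neg (by omega)]; exact h.arr k i

section Compile

variable {ι : Type} {prim : ι → ℕ → ℕ → ℕ}

/-- Turns the index in temporary cell `d` into an address of the array `k`. -/
def addrCode (k : Arr) (d : ℕ) : Program ι :=
  let t := tmpAddr d
  .seq (.add t t t) <| .seq (.add t t t) <| .seq (.add t t t) <| .seq (.add t t t) <|
  .seq (.add t t t) <| .seq (.add t t t) <| .seq (.const (tmpAddr (d + 1)) (8 + k.code)) <|
  .add t t (tmpAddr (d + 1))

/-- Code leaving the value of the expression in temporary cell `d`. -/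
def Ex.code : Ex → ℕ → Program ι
  | .lit n, d => .const (tmpAddr d) n
  | .arg j, d => .seq (.const (tmpAddr (d + 1)) 0) (.add (tmpAddr d) j (tmpAddr (d + 1)))
  | .reg x, d => .seq (.const (tmpAddr (d + 1)) 0) (.add (tmpAddr d) (regAddr x) (tmpAddr (d + 1)))
  | .add a b, d => .seq (.seq (a.code d) (b.code (d + 1)))
      (.add (tmpAddr d) (tmpAddr d) (tmpAddr (d + 1)))
  | .sub a b, d => .seq (.seq (a.code d) (b.code (d + 1)))
      (.sub (tmpAddr d) (tmpAddr d) (tmpAddr (d + 1)))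
  | .get k i, d => .seq (i.code d) (.seq (addrCode k d) (.load (tmpAddr d) (tmpAddr d)))

/-- The machine can only test a cell. The guard of a loop is therefore evaluated once before the
loop and again at the end of every round, which is the number of evaluations that `Run` charges. -/
def Cmd.code : Cmd ι → Program ι
  | .skip => .const (tmpAddr 0) 0
  | .set x e => .seq (e.code 0)
      (.seq (.const (tmpAddr 1) 0) (.add (regAddr x) (tmpAddr 0) (tmpAddr 1)))
  | .put k i e => .seq (.seq (i.code 0) (addrCode k 0))
      (.seq (e.code 1) (.store (tmpAddr 0) (tmpAddr 1)))
  | .out e => .seq (e.code 0) (.seq (.const (tmpAddr 1) 0) (.add 0 (tmpAddr 0) (tmpAddr 1)))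
  | .prim f x y z => .prim f (regAddr x) (regAddr y) (regAddr z)
  | .seq p q => .seq p.code q.code
  | .ite e p q => .seq (e.code 0) (.ite (tmpAddr 0) p.code q.code)
  | .while e p => .seq (e.code 0) (.loop (tmpAddr 0) (.seq p.code (e.code 0)))

theorem tmpAddr_ne {d d' : ℕ} (h : d ≠ d') : tmpAddr d ≠ tmpAddr d' := by
  simp only [tmpAddr]; omega

/-- Memories that agree on all temporary cells below `d`. -/
def SameTmp (d : ℕ) (m m' : Memory) : Prop := ∀ d' < d, m' (tmpAddr d') = m (tmpAddr d')

theorem exec_addrCode (k : Arr) (d i : ℕ) {σ : St} {m : Memory} (h : Rel σ m)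
    (hi : m (tmpAddr d) = i) :
    ∃ m', Exec prim (addrCode k d) m 8 m' ∧ Rel σ m' ∧ m' (tmpAddr d) = arrAddr k i ∧
      SameTmp d m m' := by
  have hne : tmpAddr d ≠ tmpAddr (d + 1) := tmpAddr_ne (by omega)
  refine ⟨_, .seq (t := 7) (.add ..) (.seq (t := 6) (.add ..) (.seq (t := 5) (.add ..)
    (.seq (t := 4) (.add ..) (.seq (t := 3) (.add ..) (.seq (t := 2) (.add ..)
    (.seq (t := 1) (.const ..) (.add ..))))))), ?_, ?_, ?_⟩
  · repeat first | exact h | apply Rel.tmp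
  · simp [hi, arrAddr]; ring
  · intro d' hd'
    have h1 : tmpAddr d' ≠ tmpAddr d := tmpAddr_ne (by omega)
    have h2 : tmpAddr d' ≠ tmpAddr (d + 1) := tmpAddr_ne (by omega)
    repeat first | rw [Function.update_of_ne h1] | rw [Function.update_of_ne h2]

/-- The temporary cells form an evaluation stack. The second operand is computed one cell higher and
must not disturb the first; this is why `SameTmp` is part of the induction. -/
theorem Ex.exec_code (e : Ex) (d : ℕ) {σ : St} {m : Memory} (h : Rel σ m) :
    ∃ m', Exec prim (e.code d) m e.cost m' ∧ Rel σ m' ∧ m' (tmpAddr d) = e.ev σ ∧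
      SameTmp d m m' := by
  induction e generalizing d m with
  | lit n =>
    refine ⟨_, .const .., h.tmp .., by simp [Ex.ev], fun d' hd' => ?_⟩
    rw [Function.update_of_ne (tmpAddr_ne (by omega))]
  | arg j =>
    refine ⟨_, .seq (s := 1) (t := 1) (.const ..) (.add ..), (h.tmp ..).tmp .., ?_,
      fun d' hd' => ?_⟩
    · have := j.isLt
      have h1 : (j : ℕ) ≠ tmpAddr (d + 1) := by simp only [tmpAddr]; omega
      simp [Ex.ev, h1, h.io]
    · rw [Function.update_of_ne (tmpAddr_ne (by omega)),
        Function.update_of_ne (tmpAddr_ne (by omega))]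
  | reg x =>
    refine ⟨_, .seq (s := 1) (t := 1) (.const ..) (.add ..), (h.tmp ..).tmp .., ?_,
      fun d' hd' => ?_⟩
    · have h1 : regAddr x ≠ tmpAddr (d + 1) := by simp only [regAddr, tmpAddr]; omega
      simp only [Ex.ev, Function.update_self, Function.update_of_ne h1, h.reg, add_zero]
    · rw [Function.update_of_ne (tmpAddr_ne (by omega)),
        Function.update_of_ne (tmpAddr_ne (by omega))]
  | add a b iha ihb =>
    obtain ⟨m₁, e₁, r₁, v₁, s₁⟩ := iha d h
    obtain ⟨m₂, e₂, r₂, v₂, s₂⟩ := ihb (d + 1) r₁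
    refine ⟨_, .seq (.seq e₁ e₂) (.add ..), r₂.tmp .., ?_, fun d' hd' => ?_⟩
    · rw [Function.update_self, s₂ d (by omega), v₁, v₂]; rfl
    · rw [Function.update_of_ne (tmpAddr_ne (by omega)), s₂ d' (by omega), s₁ d' hd']
  | sub a b iha ihb =>
    obtain ⟨m₁, e₁, r₁, v₁, s₁⟩ := iha d h
    obtain ⟨m₂, e₂, r₂, v₂, s₂⟩ := ihb (d + 1) r₁
    refine ⟨_, .seq (.seq e₁ e₂) (.sub ..), r₂.tmp .., ?_, fun d' hd' => ?_⟩
    · rw [Function.update_self, s₂ d (by omega), v₁, v₂]; rfl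
    · rw [Function.update_of_ne (tmpAddr_ne (by omega)), s₂ d' (by omega), s₁ d' hd']
  | get k i ih =>
    obtain ⟨m₁, e₁, r₁, v₁, s₁⟩ := ih d h
    obtain ⟨m₂, e₂, r₂, v₂, s₂⟩ := exec_addrCode (prim := prim) k d _ r₁ v₁
    refine ⟨_, .seq e₁ (.seq e₂ (.load ..)), r₂.tmp .., ?_, fun d' hd' => ?_⟩
    · rw [Function.update_self, v₂, r₂.arr]; rfl
    · rw [Function.update_of_ne (tmpAddr_ne (by omega)), s₂ d' hd', s₁ d' hd']

/-- The number of steps is the same on both sides, so a time bound proved for a command is literally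
a bound on machine steps. -/
theorem Cmd.Run.exec {c : Cmd ι} {σ σ' : St} {t : ℕ} (h : c.Run prim σ t σ') {m : Memory}
    (hm : Rel σ m) : ∃ m', Exec prim c.code m t m' ∧ Rel σ' m' := by
  induction h generalizing m with
  | skip σ => exact ⟨_, .const .., hm.tmp ..⟩
  | set x e σ =>
    obtain ⟨m₁, e₁, r₁, v₁, _⟩ := e.exec_code (prim := prim) 0 hm
    refine ⟨_, .seq e₁ (.seq (s := 1) (t := 1) (.const ..) (.add ..)), ?_⟩
    rw [Function.update_self, Function.update_of_ne (tmpAddr_ne (by omega)), v₁, add_zero]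
    exact (r₁.tmp ..).setR ..
  | put k i e σ =>
    obtain ⟨m₁, e₁, r₁, v₁, _⟩ := i.exec_code (prim := prim) 0 hm
    obtain ⟨m₂, e₂, r₂, v₂, _⟩ := exec_addrCode (prim := prim) k 0 _ r₁ v₁
    obtain ⟨m₃, e₃, r₃, v₃, s₃⟩ := e.exec_code (prim := prim) 1 r₂
    have := Exec.seq (Exec.seq e₁ e₂) (Exec.seq e₃ (.store (tmpAddr 0) (tmpAddr 1) m₃))
    rw [s₃ 0 (by omega), v₂, v₃] at this
    rw [show i.cost + e.cost + 9 = i.cost + 8 + (e.cost + 1) by omega]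
    exact ⟨_, this, r₃.setA ..⟩
  | out e σ =>
    obtain ⟨m₁, e₁, r₁, v₁, _⟩ := e.exec_code (prim := prim) 0 hm
    refine ⟨_, .seq e₁ (.seq (s := 1) (t := 1) (.const ..) (.add ..)), ?_⟩
    rw [Function.update_self, Function.update_of_ne (tmpAddr_ne (by omega)), v₁, add_zero]
    exact (r₁.tmp ..).setOut ..
  | prim f x y z σ =>
    refine ⟨_, .prim .., ?_⟩
    rw [hm.reg, hm.reg]
    exact hm.setR ..
  | seq _ _ ih₁ ih₂ =>
    obtain ⟨m₁, e₁, r₁⟩ := ih₁ hm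
    obtain ⟨m₂, e₂, r₂⟩ := ih₂ r₁
    exact ⟨_, .seq e₁ e₂, r₂⟩
  | @ite_true e _ _ _ _ _ hc _ ih =>
    obtain ⟨m₁, e₁, r₁, v₁, _⟩ := e.exec_code (prim := prim) 0 hm
    obtain ⟨m₂, e₂, r₂⟩ := ih r₁
    exact ⟨_, .seq e₁ (.ite_true (v₁ ▸ hc) e₂), r₂⟩
  | @ite_false e _ _ _ _ _ hc _ ih =>
    obtain ⟨m₁, e₁, r₁, v₁, _⟩ := e.exec_code (prim := prim) 0 hm
    obtain ⟨m₂, e₂, r₂⟩ := ih r₁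
    exact ⟨_, .seq e₁ (.ite_false (v₁ ▸ hc) e₂), r₂⟩
  | @while_true e p _ _ _ s t hc _ _ ih₁ ih₂ =>
    obtain ⟨m₁, e₁, r₁, v₁, _⟩ := e.exec_code (prim := prim) 0 hm
    obtain ⟨m₂, e₂, r₂⟩ := ih₁ r₁
    obtain ⟨m₃, e₃, r₃⟩ := ih₂ r₂
    -- The code of the remaining loop begins by evaluating the guard. On the machine this evaluation
    -- belongs to the round just finished, so it is cut off and moved there.
    cases e₃ with
    | @seq _ _ _ m₄ _ a b e₄ e₅ =>
      have := Exec.seq e₁ (.loop_true (v₁ ▸ hc) (.seq e₂ e₄) e₅)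
      rw [show s + a + b + 1 = s + (a + b) + 1 by omega] at this
      exact ⟨_, this, r₃⟩
  | @while_false e p _ hc =>
    obtain ⟨m₁, e₁, r₁, v₁, _⟩ := e.exec_code (prim := prim) 0 hm
    exact ⟨_, .seq e₁ (.loop_false (v₁ ▸ hc)), r₁⟩

end Compile

/-! ### Weakest preconditions -/

section WP

variable {ι : Type} {prim : ι → ℕ → ℕ → ℕ}

/-- Started in `σ` at time `t`, the command terminates, and `Q` holds of the final time and state. -/
def wp (prim : ι → ℕ → ℕ → ℕ) (c : Cmd ι) (σ : St) (t : ℕ) (Q : ℕ → St → Prop) : Prop :=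
  ∃ s σ', c.Run prim σ s σ' ∧ Q (t + s) σ'

/-- Total correctness with a time bound. -/
def Spec (prim : ι → ℕ → ℕ → ℕ) (c : Cmd ι) (σ : St) (b : ℕ) (P : St → Prop) : Prop :=
  ∃ s σ', c.Run prim σ s σ' ∧ s ≤ b ∧ P σ'

theorem Spec.of_wp {c : Cmd ι} {σ : St} {b : ℕ} {P : St → Prop}
    (h : wp prim c σ 0 fun t σ' => t ≤ b ∧ P σ') : Spec prim c σ b P := by
  obtain ⟨s, σ', hr, hb, hp⟩ := h
  exact ⟨s, σ', hr, by omega, hp⟩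

theorem Spec.wp {c : Cmd ι} {σ : St} {b t : ℕ} {P : St → Prop} {Q : ℕ → St → Prop}
    (h : Spec prim c σ b P) (hq : ∀ s σ', s ≤ t + b → P σ' → Q s σ') : wp prim c σ t Q := by
  obtain ⟨s, σ', hr, hb, hp⟩ := h
  exact ⟨s, σ', hr, hq _ _ (by omega) hp⟩

theorem Spec.mono {c : Cmd ι} {σ : St} {b b' : ℕ} {P P' : St → Prop}
    (h : Spec prim c σ b P) (hb : b ≤ b') (hp : ∀ σ', P σ' → P' σ') : Spec prim c σ b' P' := by
  obtain ⟨s, σ', hr, hs, hP⟩ := h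
  exact ⟨s, σ', hr, hs.trans hb, hp _ hP⟩

theorem wp_skip {σ : St} {t : ℕ} {Q : ℕ → St → Prop} : wp prim .skip σ t Q ↔ Q (t + 1) σ :=
  ⟨fun ⟨_, _, h, hq⟩ => by cases h; exact hq, fun h => ⟨_, _, .skip _, h⟩⟩

theorem wp_set {x : Reg} {e : Ex} {σ : St} {t : ℕ} {Q : ℕ → St → Prop} :
    wp prim (.set x e) σ t Q ↔ Q (t + (e.cost + 2)) (σ.setR x (e.ev σ)) :=
  ⟨fun ⟨_, _, h, hq⟩ => by cases h; exact hq, fun h => ⟨_, _, .set .., h⟩⟩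

theorem wp_put {k : Arr} {i e : Ex} {σ : St} {t : ℕ} {Q : ℕ → St → Prop} :
    wp prim (.put k i e) σ t Q ↔
      Q (t + (i.cost + e.cost + 9)) (σ.setA k (i.ev σ) (e.ev σ)) :=
  ⟨fun ⟨_, _, h, hq⟩ => by cases h; exact hq, fun h => ⟨_, _, .put .., h⟩⟩

theorem wp_out {e : Ex} {σ : St} {t : ℕ} {Q : ℕ → St → Prop} :
    wp prim (.out e) σ t Q ↔ Q (t + (e.cost + 2)) (σ.setOut (e.ev σ)) :=
  ⟨fun ⟨_, _, h, hq⟩ => by cases h; exact hq, fun h => ⟨_, _, .out .., h⟩⟩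

theorem wp_prim {f : ι} {x y z : Reg} {σ : St} {t : ℕ} {Q : ℕ → St → Prop} :
    wp prim (.prim f x y z) σ t Q ↔ Q (t + 1) (σ.setR x (prim f (σ.r y) (σ.r z))) :=
  ⟨fun ⟨_, _, h, hq⟩ => by cases h; exact hq, fun h => ⟨_, _, .prim .., h⟩⟩

theorem wp_seq {p q : Cmd ι} {σ : St} {t : ℕ} {Q : ℕ → St → Prop} :
    wp prim (.seq p q) σ t Q ↔ wp prim p σ t fun t' σ' => wp prim q σ' t' Q := by
  constructor
  · rintro ⟨_, _, h, hq⟩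
    cases h with
    | seq a b => exact ⟨_, _, a, _, _, b, by rwa [add_assoc]⟩
  · rintro ⟨_, _, a, _, _, b, hq⟩
    exact ⟨_, _, .seq a b, by rwa [← add_assoc]⟩

theorem wp_ite {e : Ex} {p q : Cmd ι} {σ : St} {t : ℕ} {Q : ℕ → St → Prop} :
    wp prim (.ite e p q) σ t Q ↔
      if e.ev σ ≠ 0 then wp prim p σ (t + (e.cost + 1)) Q
      else wp prim q σ (t + (e.cost + 1)) Q := by
  constructor
  · rintro ⟨_, _, h, hq⟩
    cases h with
    | ite_true hc a => rw [if_pos hc]; exact ⟨_, _, a, by convert hq using 1; omega⟩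
    | ite_false hc a => rw [if_neg (not_not.2 hc)]; exact ⟨_, _, a, by convert hq using 1; omega⟩
  · intro h
    split_ifs at h with hc
    · obtain ⟨_, _, a, hq⟩ := h
      exact ⟨_, _, .ite_true hc a, by convert hq using 1; omega⟩
    · obtain ⟨_, _, a, hq⟩ := h
      exact ⟨_, _, .ite_false (not_not.1 hc) a, by convert hq using 1; omega⟩

/-- A loop whose number of iterations is known in advance. -/
theorem wp_while {e : Ex} {p : Cmd ι} {σ : St} {t b : ℕ} {Q : ℕ → St → Prop}
    (I : ℕ → St → Prop) (k : ℕ) (h0 : I k σ)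
    (hstep : ∀ k σ, I (k + 1) σ → e.ev σ ≠ 0 ∧ Spec prim p σ b (I k))
    (hend : ∀ σ, I 0 σ → e.ev σ = 0)
    (hq : ∀ s σ', s ≤ t + (k * (b + e.cost + 1) + e.cost + 1) → I 0 σ' → Q s σ') :
    wp prim (.while e p) σ t Q := by
  have key : ∀ k σ, I k σ → ∃ s σ', Cmd.Run prim (.while e p) σ s σ' ∧
      s ≤ k * (b + e.cost + 1) + e.cost + 1 ∧ I 0 σ' := by
    intro k
    induction k with
    | zero => exact fun σ h => ⟨_, _, .while_false (hend σ h), by omega, h⟩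
    | succ k ih =>
      intro σ h
      obtain ⟨hc, s, σ₁, hr, hs, hI⟩ := hstep k σ h
      obtain ⟨s', σ', hr', hs', hI'⟩ := ih σ₁ hI
      refine ⟨_, _, .while_true hc hr hr', ?_, hI'⟩
      rw [Nat.succ_mul]; omega
  obtain ⟨s, σ', hr, hs, hI⟩ := key k σ h0
  exact ⟨s, σ', hr, hq _ _ (by omega) hI⟩

end WP

infixr:60 " ;; " => Cmd.seq

/-! ### The copies of the incremental algorithm, abstractly -/

/-- The abstract state of a copy: the stack of inserted items with their tags (top first), the items
waiting to be examined in the current pass, the items kept for the next pass, the phase (idle,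
popping, pushing) and the level. -/
structure Cp where
  stk : List (ℕ × ℕ)
  U : List ℕ
  V : List ℕ
  ph : ℕ
  lv : ℕ

namespace Cp

/-- One elementary step of the reorganization of a copy. -/
def micro (S : Finset ℕ) (L : ℕ → Finset ℕ) (c : Cp) : Cp :=
  if c.ph = 0 then c
  else if c.ph = 1 then
    match c.stk with
    | [] => { c with ph := 2, U := c.U ++ c.V, V := [] }
    | e :: s =>
      if e.2 ≤ c.lv then { c with stk := s, V := c.V ++ [e.1] }
      else { c with ph := 2, U := c.U ++ c.V, V := [] }
  else
    match c.U with
    | h :: U =>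
      if h ∈ S then
        if c.lv ≠ 0 ∧ h ∈ L (c.lv - 1) then { c with U := U, V := c.V ++ [h] }
        else { c with U := U, stk := (h, c.lv) :: c.stk }
      else { c with U := U }
    | [] =>
      if c.lv ≠ 0 then { c with U := c.V, V := [], lv := c.lv - 1 }
      else if c.V ≠ [] then { c with U := c.V, V := [] }
      else { c with ph := 0 }

/-- The insertion of an item. -/
def ins (x : ℕ) (c : Cp) : Cp :=
  if c.ph = 0 then { c with stk := (x, 0) :: c.stk } else { c with V := c.V ++ [x] }

/-- The deletion of an item. -/
def del (x : ℕ) (c : Cp) : Cp := { c with stk := c.stk.filter (·.1 ≠ x) }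

/-- The slot of the copy number `k` at level `i` begins with update number `u`. -/
def Slot (N i u k : ℕ) : Prop := u % 2 ^ i = 0 ∧ u / 2 ^ i % N = k

instance (N i u k : ℕ) : Decidable (Slot N i u k) := inferInstanceAs (Decidable (_ ∧ _))

/-- Starts a job at level `i` if the copy is idle and its slot begins. -/
def start (N u k i : ℕ) (c : Cp) : Cp :=
  if Slot N i u k ∧ c.ph = 0 then { c with ph := 1, lv := i + 1 } else c

/-- Tries to start jobs at all levels below `i`, the highest first. -/
def starts (N u k : ℕ) : ℕ → Cp → Cp
  | 0, c => c
  | i + 1, c => starts N u k i (start N u k i c)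

end Cp

/-- The number of other items predicted to be deleted no later than `h`. -/
def rank (S : Finset ℕ) (pr : ℕ → ℕ) (h : ℕ) : ℕ := {y ∈ S.erase h | pr y ≤ pr h}.card

/-- Only `x` can disappear from the counted set. Since insertions never lower a rank, ranks fall by
at most one per update. -/
theorem rank_le_erase (S : Finset ℕ) (pr : ℕ → ℕ) (h x : ℕ) :
    rank S pr h ≤ rank (S.erase x) pr h + 1 := by
  unfold rank
  have : {y ∈ S.erase h | pr y ≤ pr h} ⊆ insert x {y ∈ (S.erase x).erase h | pr y ≤ pr h} := by
    intro y hy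
    simp only [Finset.mem_filter, Finset.mem_erase, Finset.mem_insert] at *
    tauto
  exact (Finset.card_le_card this).trans (Finset.card_insert_le _ _)

theorem rank_le_insert {S : Finset ℕ} {pr pr' : ℕ → ℕ} {h x : ℕ} (hh : h ∈ S)
    (hp : ∀ y ∈ S, pr' y = pr y) : rank S pr h ≤ rank (insert x S) pr' h := by
  unfold rank
  refine Finset.card_le_card fun y hy => ?_
  simp only [Finset.mem_filter, Finset.mem_erase, Finset.mem_insert] at *
  refine ⟨⟨hy.1.1, Or.inr hy.1.2⟩, ?_⟩
  rw [hp y hy.1.2, hp h hh]; exact hy.2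

/-- The period of level `i`. -/
def Bv (N i : ℕ) : ℕ := N * 2 ^ i

theorem Bv_succ (N i : ℕ) : Bv N (i + 1) = 2 * Bv N i := by simp only [Bv, pow_succ]; ring

theorem Bv_mono (N : ℕ) {i j : ℕ} (h : i ≤ j) : Bv N i ≤ Bv N j :=
  Nat.mul_le_mul_left _ (Nat.pow_le_pow_right (by norm_num) h)

theorem le_Bv (N i : ℕ) : N ≤ Bv N i := Nat.le_mul_of_pos_right _ (by positivity)

/-- The capacity of level `i`. -/
def Kv (N i : ℕ) : ℕ := 16 * Bv N i

/-- `Age N S pr c i a`: at level `i` the copy `c` is as good as it was `a` updates after the last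
reorganization at this level. -/
structure Age (N : ℕ) (S : Finset ℕ) (pr : ℕ → ℕ) (c : Cp) (i a : ℕ) : Prop where
  cnt : c.stk.countP (fun e => e.2 ≤ i) + c.U.length + c.V.length ≤ 2 * Kv N i + a
  rk : ∀ e ∈ c.stk, i < e.2 → Kv N i ≤ rank S pr e.1 + 2 * Bv N i + a

theorem Age.mono {N : ℕ} {S : Finset ℕ} {pr : ℕ → ℕ} {c : Cp} {i a b : ℕ} (h : Age N S pr c i a)
    (hab : a ≤ b) : Age N S pr c i b :=
  ⟨h.cnt.trans (by omega), fun e he hi => (h.rk e he hi).trans (by omega)⟩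

/-- The number of updates since the last slot of copy `k` at level `i`, between `1` and the
period. -/
def since (N k i u : ℕ) : ℕ := (u + (N - k) * 2 ^ i - 1) % Bv N i + 1

/-- A bound for the number of steps in the passes after the one at level `l`. -/
def Zv (N : ℕ) : ℕ → ℕ
  | 0 => 0
  | l + 1 => 5 * Kv N l

/-- A bound for the number of remaining steps of the job of a copy. -/
def mu (N : ℕ) (c : Cp) : ℕ :=
  if c.ph = 0 then 0
  else if c.ph = 1 then
    c.stk.countP (fun e => e.2 ≤ c.lv) + (2 * Kv N c.lv + 2 * Bv N c.lv + 3) + Zv N c.lv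
  else if c.lv = 0 then c.U.length + 2 * c.V.length + 1
  else c.U.length + 1 + Zv N c.lv

/-- The part of the invariant of a copy that does not depend on time; the sum of the lengths is at
most `M`. -/
structure WF (J M : ℕ) (S : Finset ℕ) (c : Cp) : Prop where
  nodup : (c.stk.map Prod.fst ++ (c.U ++ c.V)).Nodup
  sub : ∀ e ∈ c.stk, e.1 ∈ S
  cover : ∀ h ∈ S, h ∈ c.stk.map Prod.fst ∨ h ∈ c.U ++ c.V
  bound : ∀ h ∈ c.stk.map Prod.fst ++ (c.U ++ c.V), 1 ≤ h ∧ h ≤ M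
  tags : ∀ e ∈ c.stk, e.2 ≤ J
  sorted : c.stk.Pairwise (fun e f => e.2 ≤ f.2)
  idle : c.ph = 0 → c.U = [] ∧ c.V = []
  popping : c.ph = 1 → c.U = []
  ph_le : c.ph ≤ 2
  lv_le : c.ph ≠ 0 → c.lv ≤ J
  lv_le_tag : c.ph = 2 → ∀ e ∈ c.stk, c.lv ≤ e.2

/-- Handles are distinct numbers between `1` and `M`. -/
theorem WF.len {J M : ℕ} {S : Finset ℕ} {c : Cp} (h : WF J M S c) :
    c.stk.length + c.U.length + c.V.length ≤ M := by
  have h1 : (c.stk.map Prod.fst ++ (c.U ++ c.V)).toFinset ⊆ Finset.Icc 1 M := by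
    intro x hx
    rw [List.mem_toFinset] at hx
    exact Finset.mem_Icc.2 (h.bound x hx)
  have h2 := Finset.card_le_card h1
  rw [List.toFinset_card_of_nodup h.nodup] at h2
  simp at h2
  omega

/-- What the copies need to know about the set `L i` of the items that are deleted next. -/
structure Low (N J : ℕ) (S : Finset ℕ) (pr : ℕ → ℕ) (L : ℕ → Finset ℕ) : Prop where
  card : ∀ i < J, (L i).card ≤ Kv N i
  out : ∀ i < J, ∀ h ∈ S, h ∉ L i → Kv N i ≤ rank S pr h

/-- The invariant of copy number `k` after `u` updates, when `s` elementary steps are still to be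
made. -/
structure CInv (N J : ℕ) (S : Finset ℕ) (pr : ℕ → ℕ) (L : ℕ → Finset ℕ) (u k : ℕ) (c : Cp)
    (s : ℕ) : Prop where
  -- The extra period is for the age that a level may have when a job ends: by then up to `Bv N i +
  -- 1` updates may have passed since its pass.
  idle : c.ph = 0 → ∀ i < J, Age N S pr c i (since N k i u + Bv N i)
  -- Here `j` is the level at which the job began. Levels above `j` simply grow older. The
  -- inequality for `mu` is the budget of the job: at a net rate of `240 * N` steps per update it is
  -- done before its slot of `2 ^ j` updates is over. In the last clause, `a` counts the updates
  -- since level `i` was rebuilt, and every such update has used up `240 * N` steps of an allowance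
  -- of `Bv N i` updates.
  busy : c.ph ≠ 0 → ∃ j < J, c.lv ≤ j + 1 ∧ (c.ph = 1 → c.lv = j + 1) ∧
    (∀ i, j < i → i < J → Age N S pr c i (since N k i u + Bv N i)) ∧
    mu N c + 240 * N * since N k j u ≤ 240 * N * 2 ^ j + s ∧
    (c.ph = 2 → ∀ i, c.lv ≤ i → i ≤ j →
      ∃ a, Age N S pr c i a ∧ a * (240 * N) + mu N c ≤ 240 * N * Bv N i + s)
  -- In this phase the levels up to `j` are in pieces, so the depth itself is tracked. The surplus
  -- `s` vanishes because every pop lifts the remaining items by one.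
  popping : c.ph = 1 → ∀ (d : ℕ) (e : ℕ × ℕ), c.stk[d]? = some e →
    d ≤ 35 * (N + rank S pr e.1) + s
  -- In the pass at level `lv`, everything on the stack has rank about `K_(lv - 1)` or more. The
  -- kept items were in `L (lv - 1)` when examined; in the `a` updates since the pass began, at most
  -- two per update have come to lie outside it, one by leaving the set and one by being newly
  -- inserted.
  pass : c.ph = 2 → 0 < c.lv → ∃ a, (∀ e ∈ c.stk, Kv N (c.lv - 1) ≤ rank S pr e.1 + a) ∧
    (c.V.filter (· ∉ L (c.lv - 1))).length ≤ 2 * a ∧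
    a * (240 * N) + mu N c ≤ 240 * N * Bv N (c.lv - 1) + s

/-! ### Well-formedness of a copy under an elementary step -/

section Micro

variable {N J M u k s : ℕ} {S : Finset ℕ} {pr : ℕ → ℕ} {L : ℕ → Finset ℕ} {c : Cp}

/-- A pushed entry gets the tag `lv`, which is at most every tag on the stack, so the stack remains
sorted. Handles only move between the lists, except that the handle of a deleted item is dropped,
and `cover` asks only about members of `S`. -/
theorem WF.micro (h : WF J M S c) : WF J M S (c.micro S L) := by
  obtain ⟨hnd, hsub, hcov, hbd, htag, hsort, hid, hpop, hph, hlv, hlt⟩ := h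
  obtain ⟨stk, U, V, ph, lv⟩ := c
  simp only at hnd hsub hcov hbd htag hsort hid hpop hph hlv hlt
  unfold Cp.micro
  by_cases h0 : ph = 0
  · simp only [h0, if_true]
    exact ⟨hnd, hsub, hcov, hbd, htag, hsort, fun _ => hid h0, by simp, by simp, by simp, by simp⟩
  by_cases h1 : ph = 1
  · obtain rfl := hpop h1
    subst h1
    simp only [one_ne_zero, if_false, if_true]
    cases stk with
    | nil =>
      exact ⟨by simpa using hnd, by simp, by simpa using hcov, by simpa using hbd, by simp, by simp,
        by simp, by simp, by simp, fun _ => hlv (by simp), by simp⟩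
    | cons e t =>
      simp only
      split_ifs with he
      · refine ⟨?_, fun e' h' => hsub e' (by simp [h']), fun h hh => ?_, fun h hh => hbd h ?_,
          fun e' h' => htag e' (by simp [h']), (List.pairwise_cons.1 hsort).2, by simp, by simp,
          by simp, fun _ => hlv (by simp), by simp⟩
        · simp only [List.nil_append, List.map_cons, List.cons_append] at hnd ⊢
          rw [← List.append_assoc, ← List.concat_eq_append, List.nodup_concat]
          rw [List.nodup_cons] at hnd
          exact hnd
        · have := hcov h hh
          simp only [List.map_cons, List.mem_cons, List.nil_append, List.mem_append,
            List.not_mem_nil, or_false] at this ⊢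
          tauto
        · simp only [List.nil_append, List.map_cons, List.mem_append, List.mem_cons,
            List.not_mem_nil, or_false] at hh ⊢
          tauto
      · refine ⟨by simpa using hnd, hsub, by simpa using hcov, by simpa using hbd, htag, hsort,
          by simp, by simp, by simp, fun _ => hlv (by simp), fun _ e' he' => ?_⟩
        simp only at he' ⊢
        rcases List.mem_cons.1 he' with rfl | h'
        · omega
        · have := (List.pairwise_cons.1 hsort).1 e' h'; omega
  have h2 : ph = 2 := by omega
  subst h2
  simp only [OfNat.ofNat_ne_zero, OfNat.ofNat_ne_one, if_false]
  cases U with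
  | nil =>
    simp only
    split_ifs with h3 h4
    · refine ⟨by simpa using hnd, hsub, by simpa using hcov, by simpa using hbd, htag, hsort,
        by simp, by simp, by simp, fun _ => ?_, fun _ e he => ?_⟩
      · have := hlv (by simp); simp only; omega
      · have := hlt rfl e he; simp only; omega
    · exact ⟨by simpa using hnd, hsub, by simpa using hcov, by simpa using hbd, htag, hsort,
        by simp, by simp, by simp, fun _ => hlv (by simp), hlt⟩
    · rw [not_not] at h4
      subst h4
      exact ⟨hnd, hsub, hcov, hbd, htag, hsort, by simp, by simp, by simp, by simp, by simp⟩
  | cons h U =>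
    simp only
    have hp : (stk.map Prod.fst ++ (h :: U ++ V)).Perm (h :: (stk.map Prod.fst ++ (U ++ V))) := by
      simp
    have hnd' := hp.nodup_iff.1 hnd
    rw [List.nodup_cons] at hnd'
    split_ifs with h3 h4
    · refine ⟨?_, hsub, fun y hy => ?_, fun y hy => hbd y ?_, htag, hsort,
        by simp, by simp, by simp, fun _ => hlv (by simp), hlt⟩
      · simp only
        rw [← List.append_assoc, ← List.append_assoc, List.append_assoc _ U V,
          ← List.concat_eq_append, List.nodup_concat]
        exact ⟨hnd'.1, hnd'.2⟩
      · have := hcov y hy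
        simp only [List.cons_append, List.mem_cons, List.mem_append, List.not_mem_nil,
          or_false] at this ⊢
        tauto
      · simp only [List.cons_append, List.mem_cons, List.mem_append, List.not_mem_nil,
          or_false] at hy ⊢
        tauto
    · refine ⟨by simpa only [List.map_cons, List.cons_append, List.nodup_cons] using hnd',
        fun e he => ?_, fun y hy => ?_, fun y hy => hbd y ?_, fun e he => ?_, ?_,
        by simp, by simp, by simp, fun _ => hlv (by simp), fun _ e he => ?_⟩
      · simp only at he
        rcases List.mem_cons.1 he with rfl | he
        · exact h3
        · exact hsub e he
      · have := hcov y hy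
        simp only [List.cons_append, List.mem_cons, List.mem_append, List.map_cons] at this ⊢
        tauto
      · simp only [List.cons_append, List.mem_cons, List.mem_append, List.map_cons] at hy ⊢
        tauto
      · simp only at he
        rcases List.mem_cons.1 he with rfl | he
        · exact hlv (by simp)
        · exact htag e he
      · exact List.pairwise_cons.2 ⟨fun e he => hlt rfl e he, hsort⟩
      · simp only at he
        rcases List.mem_cons.1 he with rfl | he
        · exact le_rfl
        · exact hlt rfl e he
    · refine ⟨hnd'.2, hsub, fun y hy => ?_, fun y hy => hbd y (hp.mem_iff.2 (List.mem_cons_of_mem _ hy)), htag, hsort,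
        by simp, by simp, by simp, fun _ => hlv (by simp), hlt⟩
      have := hcov y hy
      have hne : y ≠ h := by rintro rfl; exact h3 hy
      simpa [hne] using this

end Micro

theorem since_le (hN : 0 < N) (k i u : ℕ) : since N k i u ≤ Bv N i := by
  have : 0 < Bv N i := Nat.mul_pos hN (by positivity)
  have := Nat.mod_lt (u + (N - k) * 2 ^ i - 1) this
  unfold since; omega

theorem since_pos (N k i u : ℕ) : 1 ≤ since N k i u := by unfold since; omega

/-- The topmost level needs no reorganization. -/
theorem Age.top {N J M : ℕ} {S : Finset ℕ} {pr : ℕ → ℕ} {c : Cp} (hc : WF J M S c) (hN : 0 < N)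
    (hM : M ≤ 2 ^ J) {i : ℕ} (hi : J ≤ i) (a : ℕ) : Age N S pr c i a := by
  constructor
  · have h1 := hc.len
    have h2 : c.stk.countP (fun e => e.2 ≤ i) ≤ c.stk.length := List.countP_le_length
    have h3 : 2 ^ J ≤ Bv N i :=
      (Nat.pow_le_pow_right (by norm_num) hi).trans (Nat.le_mul_of_pos_left _ hN)
    unfold Kv; omega
  · intro e he hie
    have := hc.tags e he; omega

/-- Bounds the items kept for the next pass: those still in the level's set number at most its
capacity, and the others are controlled by the number of updates during the pass. -/
theorem length_le_filter_notMem {V : List ℕ} (hV : V.Nodup) (F : Finset ℕ) :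
    V.length ≤ F.card + (V.filter (· ∉ F)).length := by
  have h1 : V.length = (V.filter (· ∈ F)).length + (V.filter (· ∉ F)).length := by
    rw [List.length_eq_length_filter_add (l := V) (fun x => decide (x ∈ F))]
    simp
  have h2 : (V.filter (· ∈ F)).length ≤ F.card := by
    rw [← List.toFinset_card_of_nodup (hV.filter _)]
    exact Finset.card_le_card fun x hx => by simpa using (List.mem_filter.1 (List.mem_toFinset.1 hx)).2
  omega

/-- If `a` were at least `B + 2`, the left side would exceed `240 * N * B` by `480 * N`, more than
the steps of one update. -/
theorem age_le {N B a m s : ℕ} (h : a * (240 * N) + m ≤ 240 * N * B + (s + 1))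
    (hs : s + 1 ≤ 250 * N) : a ≤ B + 1 := by
  by_contra hlt
  have h2 : (B + 2) * (240 * N) ≤ a * (240 * N) := Nat.mul_le_mul_right _ (by omega)
  have h3 : (B + 2) * (240 * N) = 240 * N * B + 480 * N := by ring
  omega

theorem Zv_le (N l : ℕ) : Zv N l ≤ 40 * Bv N l := by
  cases l with
  | zero => simp [Zv]
  | succ l => simp only [Zv, Kv, Bv_succ]; omega

/-- A step that pops or pushes nothing below level `i` keeps the age. -/
theorem Age.of_le {N : ℕ} {S : Finset ℕ} {pr : ℕ → ℕ} {c c' : Cp} {i a : ℕ} (h : Age N S pr c i a)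
    (h1 : c'.stk.countP (fun e => e.2 ≤ i) + c'.U.length + c'.V.length ≤
      c.stk.countP (fun e => e.2 ≤ i) + c.U.length + c.V.length)
    (h2 : ∀ e ∈ c'.stk, i < e.2 → e ∈ c.stk) : Age N S pr c' i a :=
  ⟨h1.trans h.cnt, fun e he hi => h.rk e (h2 e he hi) hi⟩

/-! ### Elementary steps and the timed invariant -/

section Micro

variable {N J M u k s : ℕ} {S : Finset ℕ} {pr : ℕ → ℕ} {L : ℕ → Finset ℕ} {c : Cp}

/-- The transition from popping to pushing. -/
theorem CInv.toPass (h : CInv N J S pr L u k c (s + 1)) (hc : WF J M S c) (hM : M ≤ 2 ^ J)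
    (hN : 2 ≤ N) (h1 : c.ph = 1) (hst : ∀ e ∈ c.stk, c.lv < e.2) :
    CInv N J S pr L u k { c with ph := 2, U := c.U ++ c.V, V := [] } s := by
  obtain ⟨j, hj, -, hlv, hage, hmu, -⟩ := h.busy (by omega)
  have hlv := hlv h1
  have hU := hc.popping h1
  -- Level `j + 1` is older than the job but at most two periods old; if it is the level `J`, its
  -- capacity exceeds the number of all items.
  have hA : Age N S pr c (j + 1) (2 * Bv N (j + 1)) := by
    by_cases hjJ : j + 1 < J
    · exact (hage _ (by omega) hjJ).mono (by have := since_le (by omega : 0 < N) k (j + 1) u; omega)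
    · exact Age.top hc (by omega) hM (by omega) _
  have hB := Bv_succ N j
  have hBN := le_Bv N j
  have hcnt := hA.cnt
  simp only [hU, List.length_nil, add_zero] at hcnt
  have e1 : 240 * Bv N j ≤ 240 * N * Bv N j := Nat.mul_le_mul_right _ (by omega)
  have hV : c.V.length ≤ 2 * Kv N (j + 1) + 2 * Bv N (j + 1) := by omega
  simp only [mu, h1, hlv, one_ne_zero, if_false, if_true] at hmu
  have hK : Kv N (j + 1) = 32 * Bv N j := by simp only [Kv, hB]; ring
  have hKj : Kv N j = 16 * Bv N j := rfl
  have hZ : Zv N (j + 1) = 80 * Bv N j := by simp only [Zv, Kv]; ring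
  refine ⟨by simp, fun _ => ⟨j, hj, by simp [hlv], by simp, fun i hi hiJ => ?_, ?_, ?_⟩, by simp,
    fun _ _ => ⟨0, ?_, ?_, ?_⟩⟩
  · refine (hage i hi hiJ).of_le (by simp [hU]) (fun _ h _ => h)
  · simp only [mu, hlv, hU]
    simp only [OfNat.ofNat_ne_zero, OfNat.ofNat_ne_one, Nat.add_eq_zero_iff, one_ne_zero, and_false,
      if_false, List.nil_append]
    omega
  · intro _ i h1 h2
    simp only [hlv] at h1; omega
  -- The entries that were not popped have tags above `j + 1`. By age their rank is at least
  -- `K_(j+1) - 4 * B_(j+1) = 24 * B_j`, more than `K_j = 16 * B_j`, so the first pass starts with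
  -- `a = 0`.
  · intro e he
    have h3 := hA.rk e he (hlv ▸ hst e he)
    simp only [hlv, Nat.add_sub_cancel]
    omega
  · simp
  · simp only [mu, hlv, hU]
    simp only [OfNat.ofNat_ne_zero, OfNat.ofNat_ne_one, Nat.add_eq_zero_iff, one_ne_zero, and_false,
      if_false, List.nil_append, Nat.add_sub_cancel]
    omega

/-- The transition from one pass to the next. -/
theorem CInv.nextPass (h : CInv N J S pr L u k c (s + 1)) (hs : s + 1 ≤ 250 * N) (hc : WF J M S c)
    (hL : Low N J S pr L) (hN : 2 ≤ N) (h2 : c.ph = 2) (hU : c.U = []) (hl : c.lv ≠ 0) :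
    CInv N J S pr L u k { c with U := c.V, V := [], lv := c.lv - 1 } s := by
  obtain ⟨j, hj, hlv, -, hage, hmu, hlev⟩ := h.busy (by omega)
  obtain ⟨a, ha1, ha2, ha3⟩ := h.pass h2 (by omega)
  obtain ⟨l, hl'⟩ : ∃ l, c.lv = l + 1 := ⟨c.lv - 1, by omega⟩
  have hlev := hlev h2
  have htag := hc.lv_le_tag h2
  simp only [hl', Nat.add_sub_cancel] at ha1 ha2 ha3 hlv hlev htag ⊢
  have ha := age_le ha3 hs
  have hnd : c.V.Nodup := by
    have := hc.nodup
    rw [hU, List.nil_append] at this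
    exact (List.nodup_append'.1 this).2.1
  have hV := length_le_filter_notMem hnd (L l)
  have hcard := hL.card l (by omega)
  have hmu0 : mu N c = 1 + 5 * Kv N l := by simp [mu, h2, hl', hU, Zv]
  have hBN := le_Bv N l
  have hZ := Zv_le N l
  have hK : Kv N l = 16 * Bv N l := rfl
  have e1 : 240 * Bv N l ≤ 240 * N * Bv N l := Nat.mul_le_mul_right _ (by omega)
  -- With `B = Bv N l`, at most `16 * B + 2 * (B + 1)` items were kept and the later passes need at
  -- most `40 * B`. The sum `58 * B + 3` is well within the `80 * B` steps reserved by `Zv`.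
  have hmu1 : mu N { c with U := c.V, V := [], lv := l } ≤ c.V.length + 1 + Zv N l := by
    simp only [mu, h2]
    simp only [OfNat.ofNat_ne_zero, OfNat.ofNat_ne_one, if_false, List.length_nil]
    split_ifs <;> omega
  have hmu2 : mu N { c with U := c.V, V := [], lv := l } ≤ 58 * Bv N l + 3 := by omega
  have hmu3 : mu N { c with U := c.V, V := [], lv := l } + 1 ≤ mu N c := by omega
  refine ⟨by simp [h2], fun _ => ⟨j, hj, by simp only; omega, by simp [h2], fun i hi hiJ => ?_, ?_,
    fun _ i hi1 hi2 => ?_⟩, by simp [h2], fun _ hl0 => ⟨0, fun e he => ?_, by simp, ?_⟩⟩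
  · exact (hage i hi hiJ).of_le (by simp [hU]) (fun _ h _ => h)
  · omega
  · rcases Nat.eq_or_lt_of_le hi1 with rfl | hlt
    · refine ⟨0, ⟨?_, fun e he _ => ?_⟩, by simp only at *; omega⟩
      · have : c.stk.countP (fun e => e.2 ≤ l) = 0 := by
          rw [List.countP_eq_zero]
          intro e he
          have := htag e he
          simp only [decide_eq_true_eq]; omega
        simp only [this, List.length_nil]
        omega
      · have := ha1 e he; simp only; omega
    · obtain ⟨a', hA, hm⟩ := hlev i hlt hi2
      exact ⟨a', hA.of_le (by simp [hU]) (fun _ h _ => h), by omega⟩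
  -- For the next lower level the bound `K_l - a` on the ranks is already larger than the capacity,
  -- which is half of `K_l`; so the new pass again starts with `a = 0`.
  · simp only at hl0 he ⊢
    obtain ⟨l, rfl⟩ : ∃ l', l = l' + 1 := ⟨l - 1, by omega⟩
    have := ha1 e he
    have := le_Bv N l
    simp only [Kv, Bv_succ, Nat.add_sub_cancel] at *
    omega
  · simp only at hl0 ⊢
    obtain ⟨l, rfl⟩ : ∃ l', l = l' + 1 := ⟨l - 1, by omega⟩
    have e2 : 240 * N * Bv N l = 480 * Bv N l + 240 * (N - 2) * Bv N l := by
      obtain ⟨n, rfl⟩ : ∃ n, N = n + 2 := ⟨N - 2, by omega⟩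
      simp only [Nat.add_sub_cancel]; ring
    have := le_Bv N l
    simp only [Bv_succ, Nat.add_sub_cancel] at *
    omega

/-- The elementary steps preserve the invariant. -/
theorem CInv.micro (h : CInv N J S pr L u k c (s + 1)) (hs : s + 1 ≤ 250 * N) (hc : WF J M S c)
    (hL : Low N J S pr L) (hM : M ≤ 2 ^ J) (hN : 2 ≤ N) :
    CInv N J S pr L u k (c.micro S L) s := by
  by_cases h0 : c.ph = 0
  · simp only [Cp.micro, h0, if_true]
    exact ⟨h.idle, fun h' => absurd h0 h', fun h' => by omega, fun h' => by omega⟩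
  by_cases h1 : c.ph = 1
  · have hsort := hc.sorted
    simp only [Cp.micro, h1, one_ne_zero, if_false, if_true]
    rcases hst : c.stk with _ | ⟨e, t⟩
    · simp only
      have := h.toPass hc hM hN h1 (by simp [hst])
      rwa [hst] at this
    · simp only
      rw [hst] at hsort
      split_ifs with he
      · obtain ⟨j, hj, hlv, hlv', hage, hmu, -⟩ := h.busy h0
        have hlv' := hlv' h1
        have hU := hc.popping h1
        refine ⟨by simp, fun _ => ⟨j, hj, hlv, fun _ => hlv', fun i hi hiJ => ?_, ?_,
          by simp⟩, fun _ d f hf => ?_, by simp⟩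
        · refine (hage i hi hiJ).of_le ?_ (by simp +contextual [hst])
          have : e.2 ≤ i := by omega
          simp only [hst, hU, List.length_append, List.length_singleton, List.length_nil]
          rw [List.countP_cons_of_pos (by simpa using this)]
          omega
        · simp only [mu, h1, one_ne_zero, if_false, if_true] at hmu ⊢
          rw [hst, List.countP_cons_of_pos (by simpa using he)] at hmu
          omega
        -- The pop moves every remaining entry up by one place, which pays for the step.
        · have := h.popping h1 (d + 1) f (by rw [hst]; simpa using hf)
          omega
      · have := h.toPass hc hM hN h1 (fun f hf => by
          rw [hst] at hf
          rcases List.mem_cons.1 hf with rfl | hf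
          · omega
          · have := (List.pairwise_cons.1 hsort).1 f hf; omega)
        rwa [hst] at this
  have h2 : c.ph = 2 := by have := hc.ph_le; omega
  simp only [Cp.micro, h2, OfNat.ofNat_ne_zero, OfNat.ofNat_ne_one, if_false]
  rcases hU : c.U with _ | ⟨x, U⟩
  · simp only
    split_ifs with h3 h4
    · have := h.nextPass hs hc hL hN h2 hU h3
      rwa [← h2]
    · obtain ⟨j, hj, hlv, -, hage, hmu, hlev⟩ := h.busy h0
      have hVl : 1 ≤ c.V.length := List.length_pos_iff.2 h4
      rw [not_not] at h3
      have hmu' : mu N ⟨c.stk, c.V, [], 2, c.lv⟩ + 1 ≤ mu N c := by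
        simp only [mu, h2, h3, hU, OfNat.ofNat_ne_zero, OfNat.ofNat_ne_one, if_false, if_true,
          List.length_nil]
        omega
      refine ⟨by simp, fun _ => ⟨j, hj, hlv, by simp, fun i hi hiJ => ?_, by omega,
        fun _ i hi1 hi2 => ?_⟩, by simp, fun _ h' => by simp only at h'; omega⟩
      · exact (hage i hi hiJ).of_le (by simp [hU]) (fun _ h _ => h)
      · obtain ⟨a, hA, ha⟩ := hlev h2 i hi1 hi2
        exact ⟨a, hA.of_le (by simp [hU]) (fun _ h _ => h), by omega⟩
    · obtain ⟨j, hj, hlv, -, hage, hmu, hlev⟩ := h.busy h0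
      rw [not_not] at h3
      refine ⟨fun _ i hi => ?_, by simp, by simp, by simp⟩
      -- The job is finished. Levels above `j` were not touched; at the others the budget gives `a ≤
      -- Bv N i + 1`, and `since` is at least one.
      by_cases hij : j < i
      · exact (hage i hij hi).of_le (by simp [hU]) (fun _ h _ => h)
      · obtain ⟨a, hA, ha⟩ := hlev h2 i (by omega) (by omega)
        have ha := age_le ha hs
        refine (hA.mono (b := since N k i u + Bv N i) ?_).of_le (by simp [hU]) (fun _ h _ => h)
        have := since_pos N k i u; omega
  · simp only
    obtain ⟨j, hj, hlv, -, hage, hmu, hlev⟩ := h.busy h0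
    have hlev := hlev h2
    have hpass := h.pass h2
    -- Common to all outcomes of examining a handle: the remaining work decreases, no count grows,
    -- and a newly pushed entry has the tag `lv` and, being outside `L (lv - 1)`, a large rank.
    have key : ∀ c' : Cp, c'.ph = 2 → c'.lv = c.lv → mu N c' + 1 ≤ mu N c →
        (∀ i, c.lv ≤ i → c'.stk.countP (fun e => e.2 ≤ i) + c'.U.length + c'.V.length ≤
          c.stk.countP (fun e => e.2 ≤ i) + c.U.length + c.V.length) →
        (∀ e ∈ c'.stk, e ∈ c.stk ∨ e.2 = c.lv ∧ (0 < c.lv → Kv N (c.lv - 1) ≤ rank S pr e.1)) →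
        (0 < c.lv → (c'.V.filter (· ∉ L (c.lv - 1))).length ≤
          (c.V.filter (· ∉ L (c.lv - 1))).length) →
        CInv N J S pr L u k c' s := by
      intro c' hph hlv' hmu' hcnt hmem hfil
      have hA : ∀ i a, c.lv ≤ i → Age N S pr c i a → Age N S pr c' i a := fun i a hi hA =>
        hA.of_le (hcnt i hi) fun e he hie => (hmem e he).resolve_right (by omega)
      refine ⟨by omega, fun _ => ⟨j, hj, by omega, by omega,
        fun i hi hiJ => hA _ _ (by omega) (hage i hi hiJ), by omega, fun _ i hi1 hi2 => ?_⟩,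
        by omega, fun _ hl => ?_⟩
      · obtain ⟨a, ha, hm⟩ := hlev i (by omega) hi2
        exact ⟨a, hA _ _ (by omega) ha, by omega⟩
      · rw [hlv'] at hl ⊢
        obtain ⟨a, ha1, ha2, ha3⟩ := hpass hl
        refine ⟨a, fun e he => ?_, (hfil hl).trans ha2, by omega⟩
        rcases hmem e he with h' | ⟨-, h'⟩
        · exact ha1 e h'
        · exact (h' hl).trans (by omega)
    split_ifs with h3 h4
    · refine key _ rfl rfl ?_ (fun i _ => ?_) (fun e he => .inl he) fun _ => ?_
      · simp only [mu, h2, hU, OfNat.ofNat_ne_zero, OfNat.ofNat_ne_one, if_false, h4.1,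
          List.length_cons]
        omega
      · simp only [hU, List.length_cons, List.length_append, List.length_nil]; omega
      · simp [List.filter_append, h4.2]
    · refine key _ rfl rfl ?_ (fun i hi => ?_) (fun e he => ?_) fun _ => le_rfl
      · simp only [mu, h2, hU, OfNat.ofNat_ne_zero, OfNat.ofNat_ne_one, if_false, List.length_cons]
        split_ifs <;> omega
      · simp only [hU, List.length_cons]
        rw [List.countP_cons_of_pos (by simpa using hi)]; omega
      · rcases List.mem_cons.1 he with rfl | he
        · refine .inr ⟨rfl, fun hl => hL.out _ (by omega) _ h3 fun h' => h4 ⟨by omega, h'⟩⟩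
        · exact .inl he
    · refine key _ rfl rfl ?_ (fun i hi => ?_) (fun e he => .inl he) fun _ => le_rfl
      · simp only [mu, h2, hU, OfNat.ofNat_ne_zero, OfNat.ofNat_ne_one, if_false, List.length_cons]
        split_ifs <;> omega
      · simp only [hU, List.length_cons]; omega

end Micro

/-! ### Slots -/

/-- Shifting the clock by `(N - k) * 2 ^ i` makes the period start with the slot of copy `k`. The
residue then has two digits: the position in the block and the number of blocks since that slot. -/
theorem add_mod_slot {N k i u : ℕ} :
    (u + (N - k) * 2 ^ i) % Bv N i = u % 2 ^ i + 2 ^ i * ((u / 2 ^ i + (N - k)) % N) := by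
  have h : 0 < 2 ^ i := by positivity
  rw [Bv, mul_comm N, Nat.mod_mul, Nat.add_mul_mod_self_right, Nat.add_mul_div_right _ _ h]

theorem add_sub_mod {N k a : ℕ} (hk : k < N) : (a + (N - k)) % N = 0 ↔ a % N = k := by
  have hN : 0 < N := by omega
  have h1 := Nat.mod_lt a hN
  rw [Nat.add_mod]
  rcases Nat.eq_zero_or_pos k with rfl | hk0
  · simp
  · rw [Nat.mod_eq_of_lt (show N - k < N by omega)]
    constructor
    · intro h
      obtain ⟨c, hc⟩ := Nat.dvd_of_mod_eq_zero h
      have : c = 1 := by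
        rcases c with _ | _ | c
        · simp at hc; omega
        · rfl
        · have : N * (c + 1 + 1) = N * c + 2 * N := by ring
          omega
      subst this; omega
    · intro h
      rw [show a % N + (N - k) = N by omega, Nat.mod_self]

theorem succ_mod_eq {B : ℕ} (hB : 0 < B) (x : ℕ) :
    (x + 1) % B = if x % B + 1 = B then 0 else x % B + 1 := by
  have h1 := Nat.mod_lt x hB
  rw [← Nat.mod_add_mod]
  split_ifs with h
  · rw [h, Nat.mod_self]
  · exact Nat.mod_eq_of_lt (by omega)

/-- The shift by one inside `since` turns the residue zero into a full period: when a slot begins, a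
whole period has elapsed since the last one. -/
theorem since_eq {N k i u : ℕ} (hk : k < N) :
    since N k i u = if (u + (N - k) * 2 ^ i) % Bv N i = 0 then Bv N i
      else (u + (N - k) * 2 ^ i) % Bv N i := by
  have hB : 0 < Bv N i := Nat.mul_pos (by omega) (by positivity)
  have hp : 0 < (N - k) * 2 ^ i := Nat.mul_pos (by omega) (by positivity)
  obtain ⟨x, hx⟩ : ∃ x, u + (N - k) * 2 ^ i = x + 1 := ⟨u + (N - k) * 2 ^ i - 1, by omega⟩
  rw [since, hx, Nat.add_sub_cancel]
  have h1 := Nat.mod_lt x hB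
  rw [succ_mod_eq hB]
  by_cases hh : x % Bv N i + 1 = Bv N i
  · simp [hh]
  · simp [hh]

theorem slot_iff {N k i u : ℕ} (hk : k < N) : Cp.Slot N i u k ↔ since N k i u = Bv N i := by
  have hB : 0 < Bv N i := Nat.mul_pos (by omega) (by positivity)
  rw [since_eq hk]
  have h1 := Nat.mod_lt (u + (N - k) * 2 ^ i) hB
  have h2 : (u + (N - k) * 2 ^ i) % Bv N i = 0 ↔ Cp.Slot N i u k := by
    rw [add_mod_slot, Nat.add_eq_zero_iff, Nat.mul_eq_zero, add_sub_mod hk, Cp.Slot]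
    simp
  rw [← h2]
  split_ifs with h
  · simp [h]
  · constructor <;> intro <;> omega

theorem since_succ {N k i u : ℕ} (hk : k < N) :
    since N k i (u + 1) = if Cp.Slot N i u k then 1 else since N k i u + 1 := by
  have hB : 0 < Bv N i := Nat.mul_pos (by omega) (by positivity)
  have hp : 0 < (N - k) * 2 ^ i := Nat.mul_pos (by omega) (by positivity)
  obtain ⟨x, hx⟩ : ∃ x, u + (N - k) * 2 ^ i = x + 1 := ⟨u + (N - k) * 2 ^ i - 1, by omega⟩
  have h1 : since N k i u = x % Bv N i + 1 := by rw [since, hx, Nat.add_sub_cancel]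
  have h2 : since N k i (u + 1) = (x + 1) % Bv N i + 1 := by
    rw [since, show u + 1 + (N - k) * 2 ^ i - 1 = x + 1 by omega]
  rw [h2, succ_mod_eq hB]
  simp only [slot_iff hk, h1]
  split_ifs <;> omega

/-- Fewer than `2 ^ j` updates after a slot of copy `k` began, the clock is strictly inside the same
block. So the block still belongs to `k`, and nothing starts at level `j` or above. Both the
termination of jobs in time and the existence of an idle copy rest on this. -/
theorem of_since_lt {N k j u : ℕ} (hk : k < N) (h : since N k j u < 2 ^ j) :
    u / 2 ^ j % N = k ∧ u % 2 ^ j ≠ 0 := by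
  have h0 : 2 ^ j ≤ Bv N j := Nat.le_mul_of_pos_left _ (by omega)
  rw [since_eq hk] at h
  split_ifs at h with h1
  · omega
  · rw [add_mod_slot] at h h1
    have h2 : (u / 2 ^ j + (N - k)) % N = 0 := by
      by_contra h3
      have : 2 ^ j * 1 ≤ 2 ^ j * ((u / 2 ^ j + (N - k)) % N) := Nat.mul_le_mul_left _ (by omega)
      omega
    rw [h2] at h1
    exact ⟨(add_sub_mod hk).1 h2, by omega⟩

theorem since_succ_of_lt {N k j u : ℕ} (hk : k < N) (h : since N k j u < 2 ^ j) :
    since N k j (u + 1) = since N k j u + 1 := by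
  rw [since_succ hk, if_neg]
  intro hs
  exact (of_since_lt hk h).2 hs.1

/-- Blocks are nested: a higher slot begins at a multiple of `2 ^ j` only, so a busy copy never
misses a slot above the level of its job. -/
theorem since_succ_above {N k i j u : ℕ} (hk : k < N) (h : since N k j u < 2 ^ j) (hij : j < i) :
    since N k i (u + 1) = since N k i u + 1 := by
  rw [since_succ hk, if_neg]
  intro hs
  exact (of_since_lt hk h).2 (Nat.mod_eq_zero_of_dvd
    ((Nat.pow_dvd_pow 2 hij.le).trans (Nat.dvd_of_mod_eq_zero hs.1)))

/-! ### Updates -/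

/-- The effect of an update on a copy, as far as it matters for the invariant. -/
structure Upd (N J : ℕ) (S S' : Finset ℕ) (pr pr' : ℕ → ℕ) (L L' : ℕ → Finset ℕ) (c c' : Cp) :
    Prop where
  ph : c'.ph = c.ph
  lv : c'.lv = c.lv
  U : c'.U = c.U
  cnt : ∀ i, c'.stk.countP (fun e => e.2 ≤ i) + c'.V.length ≤
    c.stk.countP (fun e => e.2 ≤ i) + c.V.length + 1
  len : c'.V.length ≤ c.V.length + 1
  busy : c.ph ≠ 0 → ∀ i, c'.stk.countP (fun e => e.2 ≤ i) ≤ c.stk.countP (fun e => e.2 ≤ i)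
  mem : ∀ e ∈ c'.stk, e ∈ c.stk ∧ rank S pr e.1 ≤ rank S' pr' e.1 + 1 ∨ c.ph = 0 ∧ e.2 = 0
  depth : ∀ d e, c'.stk[d]? = some e → d = 0 ∨ ∃ d', d ≤ d' + 1 ∧ c.stk[d']? = some e ∧
    rank S pr e.1 ≤ rank S' pr' e.1 + 1
  low : ∀ l < J, (c'.V.filter (· ∉ L' l)).length ≤ (c.V.filter (· ∉ L l)).length + 2

theorem length_filter_le {V : List ℕ} (hV : V.Nodup) (F F' : Finset ℕ) :
    (V.filter (· ∉ F')).length ≤ (V.filter (· ∉ F)).length + (F \ F').card := by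
  rw [← List.toFinset_card_of_nodup (hV.filter _), ← List.toFinset_card_of_nodup (hV.filter _)]
  refine le_trans (Finset.card_le_card fun x hx => ?_) (Finset.card_union_le _ _)
  simp only [List.mem_toFinset, List.mem_filter, decide_eq_true_eq, Finset.mem_union,
    Finset.mem_sdiff] at *
  tauto

section

variable {N J M M' u k s : ℕ} {S S' : Finset ℕ} {pr pr' : ℕ → ℕ} {L L' : ℕ → Finset ℕ} {c c' : Cp}

theorem WF.V_nodup (h : WF J M S c) : c.V.Nodup :=
  (List.nodup_append'.1 (List.nodup_append'.1 h.nodup).2.1).2.1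

theorem Upd.ins (hc : WF J M S c) {x : ℕ} (hp : ∀ y ∈ S, pr' y = pr y)
    (hL : ∀ l < J, (L l \ L' l).card ≤ 1) : Upd N J S (insert x S) pr pr' L L' c (c.ins x) := by
  have hr : ∀ e ∈ c.stk, rank S pr e.1 ≤ rank (insert x S) pr' e.1 + 1 := fun e he =>
    (rank_le_insert (x := x) (hc.sub e he) hp).trans (by omega)
  unfold Cp.ins
  split_ifs with h
  · refine ⟨rfl, rfl, rfl, fun i => ?_, by simp, fun h' => absurd h h', fun e he => ?_,
      fun d e hd => ?_, fun l hl => ?_⟩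
    · rw [List.countP_cons]; split_ifs <;> simp only <;> omega
    · rcases List.mem_cons.1 he with rfl | he
      · exact .inr ⟨h, rfl⟩
      · exact .inl ⟨he, hr e he⟩
    · rcases d with _ | d
      · exact .inl rfl
      · simp only [List.getElem?_cons_succ] at hd
        exact .inr ⟨d, le_rfl, hd, hr e (List.mem_of_getElem? hd)⟩
    · have := length_filter_le hc.V_nodup (L l) (L' l)
      have := hL l hl
      simp only; omega
  · refine ⟨rfl, rfl, rfl, fun i => ?_, by simp, fun _ i => le_rfl, fun e he => ?_,
      fun d e hd => ?_, fun l hl => ?_⟩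
    · simp; omega
    · exact .inl ⟨he, hr e he⟩
    · exact .inr ⟨d, by omega, hd, hr e (List.mem_of_getElem? hd)⟩
    · have := length_filter_le hc.V_nodup (L l) (L' l)
      have := hL l hl
      -- The two units in `Upd.low`: one old element may have left the set of the level, and the new
      -- item may lie outside it.
      have : ([x].filter (· ∉ L' l)).length ≤ 1 := List.length_filter_le _ _
      simp only [List.filter_append, List.length_append]
      omega

theorem exists_of_getElem?_filter {α : Type*} (p : α → Bool) (l : List α) (d : ℕ) (e : α)
    (h : (l.filter p)[d]? = some e) : ∃ d', d ≤ d' ∧ l[d']? = some e := by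
  induction l generalizing d with
  | nil => simp at h
  | cons a l ih =>
    by_cases ha : p a
    · rw [List.filter_cons_of_pos ha] at h
      rcases d with _ | d
      · exact ⟨0, le_rfl, by simpa using h⟩
      · obtain ⟨d', h1, h2⟩ := ih d (by simpa using h)
        exact ⟨d' + 1, by omega, by simpa using h2⟩
    · rw [List.filter_cons_of_neg ha] at h
      obtain ⟨d', h1, h2⟩ := ih d h
      exact ⟨d' + 1, by omega, by simpa using h2⟩

theorem Upd.del (hc : WF J M S c) {x : ℕ}
    (hL : ∀ l < J, (L l \ L' l).card ≤ 1) : Upd N J S (S.erase x) pr pr L L' c (c.del x) := by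
  have hr : ∀ e ∈ c.stk, rank S pr e.1 ≤ rank (S.erase x) pr e.1 + 1 := fun e _ =>
    rank_le_erase ..
  have hcnt : ∀ i, (c.del x).stk.countP (fun e => e.2 ≤ i) ≤ c.stk.countP (fun e => e.2 ≤ i) :=
    fun i => List.Sublist.countP_le List.filter_sublist
  refine ⟨rfl, rfl, rfl, fun i => ?_, by simp [Cp.del], fun _ => hcnt, fun e he => ?_,
      fun d e hd => ?_, fun l hl => ?_⟩
  · have := hcnt i
    simp only [Cp.del] at this ⊢; omega
  · have he := List.mem_of_mem_filter he
    exact .inl ⟨he, hr e he⟩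
  · obtain ⟨d', h1, h2⟩ := exists_of_getElem?_filter _ _ _ _ hd
    exact .inr ⟨d', by omega, h2, hr e (List.mem_of_getElem? h2)⟩
  · have := length_filter_le hc.V_nodup (L l) (L' l)
    have := hL l hl
    simp only [Cp.del]; omega

/-- The new handle is larger than all handles that ever occurred, so it is distinct even from
handles of deleted items that are still waiting in a queue. -/
theorem WF.ins (hc : WF J M S c) (hM : M < M') : WF J M' (insert M' S) (c.ins M') := by
  have hnew : M' ∉ c.stk.map Prod.fst ++ (c.U ++ c.V) := fun h => by
    have := hc.bound _ h; omega
  obtain ⟨hnd, hsub, hcov, hbd, htag, hsort, hid, hpop, hph, hlv, hlt⟩ := hc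
  unfold Cp.ins
  split_ifs with h
  · refine ⟨?_, fun e he => ?_, fun y hy => ?_, fun y hy => ?_, fun e he => ?_, ?_, hid, hpop, hph,
      hlv, fun h' => by simp only at h'; omega⟩
    · simp only [List.map_cons, List.cons_append, List.nodup_cons]
      exact ⟨hnew, hnd⟩
    · rcases List.mem_cons.1 he with rfl | he
      · simp
      · exact Finset.mem_insert_of_mem (hsub e he)
    · rcases Finset.mem_insert.1 hy with rfl | hy
      · simp
      · have := hcov y hy
        simp only [List.map_cons, List.mem_cons]; tauto
    · simp only [List.map_cons, List.cons_append, List.mem_cons] at hy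
      rcases hy with rfl | hy
      · omega
      · have := hbd y hy; omega
    · rcases List.mem_cons.1 he with rfl | he
      · exact Nat.zero_le _
      · exact htag e he
    · exact List.pairwise_cons.2 ⟨fun e _ => Nat.zero_le _, hsort⟩
  · refine ⟨?_, fun e he => Finset.mem_insert_of_mem (hsub e he), fun y hy => ?_, fun y hy => ?_,
      htag, hsort, fun h' => absurd h' h, hpop, hph, hlv, hlt⟩
    · simp only
      rw [← List.append_assoc, ← List.append_assoc, List.append_assoc _ c.U,
        ← List.concat_eq_append, List.nodup_concat]
      exact ⟨hnew, hnd⟩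
    · rcases Finset.mem_insert.1 hy with rfl | hy
      · simp
      · have := hcov y hy
        simp only [List.mem_append] at this ⊢
        tauto
    · simp only [← List.append_assoc] at hy
      rcases List.mem_append.1 hy with hy | hy
      · have := hbd y (by simpa using hy); omega
      · simp only [List.mem_singleton] at hy; omega

theorem WF.del (hc : WF J M S c) (x : ℕ) : WF J M (S.erase x) (c.del x) := by
  obtain ⟨hnd, hsub, hcov, hbd, htag, hsort, hid, hpop, hph, hlv, hlt⟩ := hc
  have hs : (c.stk.filter (·.1 ≠ x)).Sublist c.stk := List.filter_sublist
  have hs' := (hs.map Prod.fst).append_right (c.U ++ c.V)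
  refine ⟨hnd.sublist hs', fun e he => ?_, fun y hy => ?_, fun y hy => hbd y (hs'.subset hy),
    fun e he => htag e (hs.subset he), hsort.sublist hs, hid, hpop, hph, hlv,
    fun h e he => hlt h e (hs.subset he)⟩
  · obtain ⟨h1, h2⟩ := List.mem_filter.1 he
    exact Finset.mem_erase.2 ⟨by simpa using h2, hsub e h1⟩
  · obtain ⟨h1, h2⟩ := Finset.mem_erase.1 hy
    rcases hcov y h2 with h3 | h3
    · left
      obtain ⟨e, he, rfl⟩ := List.mem_map.1 h3
      exact List.mem_map.2 ⟨e, List.mem_filter.2 ⟨he, by simpa using h1⟩, rfl⟩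
    · exact .inr h3

theorem WF.start (hc : WF J M S c) {i : ℕ} (hi : i < J) : WF J M S (c.start N u k i) := by
  unfold Cp.start
  split_ifs with h
  · obtain ⟨hnd, hsub, hcov, hbd, htag, hsort, hid, hpop, hph, hlv, hlt⟩ := hc
    exact ⟨hnd, hsub, hcov, hbd, htag, hsort, by simp, fun _ => (hid h.2).1, by simp,
      fun _ => hi, by simp⟩
  · exact hc

theorem WF.starts (hc : WF J M S c) {i : ℕ} (hi : i ≤ J) : WF J M S (c.starts N u k i) := by
  induction i generalizing c with
  | zero => exact hc
  | succ i ih => exact ih (hc.start (by omega)) (by omega)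

theorem starts_of_ne {i : ℕ} (h : c.ph ≠ 0) : c.starts N u k i = c := by
  induction i with
  | zero => rfl
  | succ i ih => rw [Cp.starts, Cp.start, if_neg (by tauto), ih]

/-- The depth of an item in the stack is bounded in terms of its rank. -/
theorem CInv.depth (h : CInv N J S pr L u k c 0) (hc : WF J M S c) (hM : M ≤ 2 ^ J) (hN : 2 ≤ N)
    {d : ℕ} {e : ℕ × ℕ} (hd : c.stk[d]? = some e) : d ≤ 35 * (N + rank S pr e.1) := by
  by_cases h1 : c.ph = 1
  · exact h.popping h1 d e hd
  have he : e ∈ c.stk := List.mem_of_getElem? hd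
  -- At every level, either the age is at most two periods plus one, or the copy is in a pass above
  -- level `i`. In the latter case everything on the stack has rank at least `16 * B - (B + 1)` for
  -- some `B ≥ Bv N i`.
  have hlev : ∀ i ≤ J, (∃ a ≤ 2 * Bv N i + 1, Age N S pr c i a) ∨ 11 * Bv N i ≤ rank S pr e.1 := by
    intro i hi
    rcases Nat.eq_or_lt_of_le hi with rfl | hi
    · exact .inl ⟨0, by omega, Age.top hc (by omega) hM le_rfl _⟩
    have hsl := since_le (by omega : 0 < N) k i u
    by_cases h0 : c.ph = 0
    · exact .inl ⟨_, by omega, h.idle h0 i hi⟩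
    have h2 : c.ph = 2 := by have := hc.ph_le; omega
    obtain ⟨j, hj, hlv, -, hage, hmu, hlev⟩ := h.busy h0
    by_cases hij : j < i
    · exact .inl ⟨_, by omega, hage i hij hi⟩
    by_cases hli : c.lv ≤ i
    · obtain ⟨a, hA, ha⟩ := hlev h2 i hli (by omega)
      have := age_le (N := N) (B := Bv N i) (m := mu N c) (a := a) (s := 0) (by omega) (by omega)
      exact .inl ⟨a, by omega, hA⟩
    · obtain ⟨a, ha1, -, ha3⟩ := h.pass h2 (by omega)
      have := age_le (N := N) (B := Bv N (c.lv - 1)) (m := mu N c) (a := a) (s := 0) (by omega)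
        (by omega)
      have h3 := ha1 e he
      have h4 := Bv_mono N (show i ≤ c.lv - 1 by omega)
      have h5 := le_Bv N (c.lv - 1)
      unfold Kv at h3
      right; omega
  -- An entry with tag above `i` has rank at least `16 * B - 2 * B - (2 * B + 1) ≥ 11 * B`. So the
  -- tag is at most `i`, and since tags increase downwards, all entries above it are counted by
  -- `Age.cnt`, whose bound is `32 * B + 2 * B + 1`.
  have hdep : ∀ i ≤ J, rank S pr e.1 < 11 * Bv N i → d < 35 * Bv N i := by
    intro i hi hr
    obtain ⟨a, ha, hA⟩ := (hlev i hi).resolve_right (by omega)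
    have hB := le_Bv N i
    have htag : e.2 ≤ i := by
      by_contra hlt
      have := hA.rk e he (by omega)
      unfold Kv at this; omega
    have hcnt := hA.cnt
    have : d + 1 ≤ c.stk.countP (fun e => e.2 ≤ i) := by
      obtain ⟨hdl, hde⟩ := List.getElem?_eq_some_iff.1 hd
      have h5 : (c.stk.take (d + 1)).countP (fun e => e.2 ≤ i) = (c.stk.take (d + 1)).length := by
        rw [List.countP_eq_length]
        intro f hf
        obtain ⟨m, hm, rfl⟩ := List.getElem_of_mem hf
        simp only [List.length_take] at hm
        rw [List.getElem_take]
        have hmd : m ≤ d := by omega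
        rcases Nat.eq_or_lt_of_le hmd with rfl | hlt
        · simpa [hde] using htag
        · have := List.pairwise_iff_getElem.1 hc.sorted m d (by omega) hdl hlt
          rw [hde] at this
          simp only [decide_eq_true_eq]; omega
      have h6 : (c.stk.take (d + 1)).countP (fun e => e.2 ≤ i) ≤ c.stk.countP (fun e => e.2 ≤ i) :=
        List.Sublist.countP_le (List.take_sublist _ _)
      rw [h5, List.length_take] at h6
      omega
    unfold Kv at hcnt; omega
  by_cases hr0 : rank S pr e.1 < 11 * Bv N 0
  · have := hdep 0 (by omega) hr0
    simp only [Bv, pow_zero, mul_one] at this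
    omega
  · by_cases hrJ : rank S pr e.1 < 11 * Bv N J
    · have hex : ∃ i, i < J ∧ 11 * Bv N i ≤ rank S pr e.1 ∧ rank S pr e.1 < 11 * Bv N (i + 1) := by
        by_contra hno
        push Not at hno
        have : ∀ i ≤ J, 11 * Bv N i ≤ rank S pr e.1 := by
          intro i
          induction i with
          | zero => intro _; omega
          | succ i ih => exact fun hi => hno i (by omega) (ih (by omega))
        have := this J le_rfl; omega
      obtain ⟨i, hi, h3, h4⟩ := hex
      have := hdep (i + 1) hi h4
      rw [Bv_succ] at this
      omega
    · have h3 := hc.len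
      have h4 : d < c.stk.length := (List.getElem?_eq_some_iff.1 hd).1
      have h5 : 2 ^ J ≤ Bv N J := Nat.le_mul_of_pos_left _ (by omega)
      omega

theorem Upd.age (h : Upd N J S S' pr pr' L L' c c') {i a : ℕ} (hA : Age N S pr c i a) :
    Age N S' pr' c' i (a + 1) := by
  constructor
  · have := hA.cnt; have := h.cnt i; rw [h.U]; omega
  · intro e he hie
    rcases h.mem e he with ⟨h1, h2⟩ | h1
    · have := hA.rk e h1 hie; omega
    · omega

theorem Upd.mu_le (h : Upd N J S S' pr pr' L L' c c') : mu N c' ≤ mu N c + 2 := by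
  have h1 := h.len
  unfold mu
  rw [h.ph, h.lv, h.U]
  split_ifs with h2 h3 h4
  · omega
  · have := h.busy h2 c.lv; omega
  · omega
  · omega

/-- An update, together with the start of new jobs, before the elementary steps. -/
theorem CInv.advance (h : CInv N J S pr L u k c 0) (hc : WF J M S c) (hM : M ≤ 2 ^ J) (hN : 2 ≤ N)
    (hk : k < N) (hu : Upd N J S S' pr pr' L L' c c') (hc' : WF J M' S' c') (hM' : M' ≤ 2 ^ J) :
    CInv N J S' pr' L' (u + 1) k (c'.starts N u k J) (250 * N) := by
  -- The update moves an entry down by at most one place and lowers its rank by at most one, a loss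
  -- of at most 36, which is less than the `250 * N` steps about to be made.
  have hpop : ∀ (d : ℕ) (e : ℕ × ℕ), c'.stk[d]? = some e →
      d ≤ 35 * (N + rank S' pr' e.1) + 250 * N := by
    intro d e hd
    rcases hu.depth d e hd with rfl | ⟨d', h1, h2, h3⟩
    · omega
    · have := h.depth hc hM hN h2; omega
  by_cases h0 : c.ph = 0
  · have h0' : c'.ph = 0 := hu.ph.trans h0
    have hage : ∀ i < J, Age N S' pr' c' i (since N k i u + Bv N i + 1) := fun i hi =>
      hu.age (h.idle h0 i hi)
    -- The levels are tried from the highest down. When a job starts at level `m`, no slot of this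
    -- copy begins at a higher level, and there `since` just increases.
    have key : ∀ m ≤ J, (∀ i, m ≤ i → i < J → ¬ Cp.Slot N i u k) →
        CInv N J S' pr' L' (u + 1) k (c'.starts N u k m) (250 * N) := by
      intro m
      induction m with
      | zero =>
        intro _ hs
        refine ⟨fun _ i hi => ?_, fun h' => absurd h0' h', fun h' => ?_, fun h' => ?_⟩
        · rw [since_succ hk, if_neg (hs i (by omega) hi), add_right_comm]
          exact hage i hi
        · simp only [Cp.starts] at h'; omega
        · simp only [Cp.starts] at h'; omega
      | succ m ih =>
        intro hm hs
        rw [Cp.starts, Cp.start]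
        by_cases hsl : Cp.Slot N m u k
        · rw [if_pos ⟨hsl, h0'⟩, starts_of_ne (by simp)]
          obtain ⟨hU, hV⟩ := hc'.idle h0'
          have hA : Age N S' pr' c' (m + 1) (2 * Bv N (m + 1)) := by
            by_cases hmJ : m + 1 < J
            · refine (hage _ hmJ).mono ?_
              have h1 := since_le (by omega : 0 < N) k (m + 1) u
              have h2 := mt (slot_iff hk).2 (hs (m + 1) le_rfl hmJ)
              omega
            · exact Age.top hc' (by omega) hM' (by omega) _
          have hcnt := hA.cnt
          have hBN := le_Bv N m
          have hB : Bv N m = N * 2 ^ m := rfl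
          refine ⟨by simp, fun _ => ⟨m, by omega, le_rfl, fun _ => rfl, fun i hi hiJ => ?_, ?_,
            by simp⟩, fun _ => hpop, by simp⟩
          · rw [since_succ hk, if_neg (hs i hi hiJ), add_right_comm]
            exact (hage i hiJ).of_le (by simp) (fun _ h _ => h)
          -- With `B = Bv N m`, at most `68 * B` entries are to be popped, the first pass is
          -- estimated by `68 * B + 3`, and the later passes by `80 * B`. The total `216 * B + 3`
          -- fits into `240 * B + 10 * N`, which is what the budget leaves after `since` has become
          -- one.
          · rw [since_succ hk, if_pos hsl]
            simp only [mu, one_ne_zero, if_false, if_true, Zv, Kv, Bv_succ] at hcnt ⊢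
            have : 240 * N * 2 ^ m = 240 * Bv N m := by rw [hB]; ring
            omega
        · rw [if_neg (by tauto)]
          exact ih (by omega) fun i hi hiJ => by
            rcases Nat.eq_or_lt_of_le hi with rfl | hi
            · exact hsl
            · exact hs i hi hiJ
    exact key J le_rfl (by omega)
  · have h0' : c'.ph ≠ 0 := by rwa [hu.ph]
    rw [starts_of_ne h0']
    obtain ⟨j, hj, hlv, hlv', hage, hmu, hlev⟩ := h.busy h0
    have hpos : 0 < mu N c := by
      unfold mu
      rw [if_neg h0]
      split_ifs <;> omega
    -- There is work left, so by the budget the slot of the job cannot be over.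
    have hlt : since N k j u < 2 ^ j := by
      by_contra hge
      have : 240 * N * 2 ^ j ≤ 240 * N * since N k j u := Nat.mul_le_mul_left _ (by omega)
      omega
    have hmu' := hu.mu_le
    refine ⟨fun h' => absurd h' h0', fun _ => ⟨j, hj, by rw [hu.lv]; exact hlv,
      by rw [hu.ph, hu.lv]; exact hlv', fun i hi hiJ => ?_, ?_, fun h2 i hi1 hi2 => ?_⟩,
      fun _ => hpop, fun h2 hl => ?_⟩
    · rw [since_succ_above hk hlt hi, add_right_comm]
      exact hu.age (hage i hi hiJ)
    -- The update adds at most two steps of work and `240 * N` to the left side; it provides `250 *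
    -- N` steps.
    · rw [since_succ_of_lt hk hlt, Nat.mul_add]
      omega
    · rw [hu.ph] at h2
      rw [hu.lv] at hi1
      obtain ⟨a, hA, ha⟩ := hlev h2 i hi1 hi2
      exact ⟨a + 1, hu.age hA, by rw [Nat.add_mul]; omega⟩
    · rw [hu.ph] at h2
      rw [hu.lv] at hl ⊢
      obtain ⟨a, ha1, ha2, ha3⟩ := h.pass h2 hl
      refine ⟨a + 1, fun e he => ?_, ?_, by rw [Nat.add_mul]; omega⟩
      · rcases hu.mem e he with ⟨h3, h4⟩ | h3
        · have := ha1 e h3; omega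
        · exact absurd h3.1 h0
      · have := hu.low (c.lv - 1) (by omega); omega

/-- A busy copy determines the level of its job. -/
theorem CInv.level (h : CInv N J S pr L u k c 0) (hk : k < N) (h0 : c.ph ≠ 0) :
    ∃ j < J, u / 2 ^ j % N = k := by
  obtain ⟨j, hj, -, -, -, hmu, -⟩ := h.busy h0
  have hpos : 0 < mu N c := by
    unfold mu
    rw [if_neg h0]
    split_ifs <;> omega
  refine ⟨j, hj, (of_since_lt hk ?_).1⟩
  by_contra hge
  have : 240 * N * 2 ^ j ≤ 240 * N * since N k j u := Nat.mul_le_mul_left _ (by omega)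
  omega

end

/-- One of `J + 1` copies is idle. -/
theorem exists_idle {N J u : ℕ} {S : Finset ℕ} {pr : ℕ → ℕ} {L : ℕ → Finset ℕ} {c : ℕ → Cp}
    (hN : N = J + 1) (h : ∀ k < N, CInv N J S pr L u k (c k) 0) : ∃ k < N, (c k).ph = 0 := by
  by_contra hno
  push Not at hno
  -- A busy copy is the owner of the current block at the level of its job. There are only `J` such
  -- owners.
  have : (Finset.range N) ⊆ (Finset.range J).image (fun j => u / 2 ^ j % N) := by
    intro k hk
    rw [Finset.mem_range] at hk
    obtain ⟨j, hj, hjk⟩ := (h k hk).level hk (hno k hk)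
    exact Finset.mem_image.2 ⟨j, Finset.mem_range.2 hj, hjk⟩
  have := (Finset.card_le_card this).trans Finset.card_image_le
  simp only [Finset.card_range] at this
  omega

/-- The initial state. -/
theorem CInv.init (N J : ℕ) (pr : ℕ → ℕ) (L : ℕ → Finset ℕ) (k : ℕ) :
    CInv N J ∅ pr L 0 k ⟨[], [], [], 0, 0⟩ 0 :=
  ⟨fun _ i _ => ⟨by simp, by simp⟩, by simp, by simp, by simp⟩

theorem WF.init (J : ℕ) : WF J 0 ∅ ⟨[], [], [], 0, 0⟩ :=
  ⟨by simp, by simp, by simp, by simp, by simp, by simp, by simp, by simp, by simp, by simp,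
    by simp⟩

/-! ### Notation for expressions -/

instance : Add Ex := ⟨Ex.add⟩
instance : Sub Ex := ⟨Ex.sub⟩

namespace Ex

abbrev k (x : KReg) : Ex := .reg (.k x)
abbrev m (x : MReg) : Ex := .reg (.m x)
abbrev s (x : SReg) : Ex := .reg (.s x)

@[simp] theorem ev_lit (σ : St) (n : ℕ) : (lit n).ev σ = n := rfl
@[simp] theorem ev_arg (σ : St) (j : Fin 4) : (arg j).ev σ = σ.io j := rfl
@[simp] theorem ev_reg (σ : St) (x : Reg) : (reg x).ev σ = σ.r x := rfl
@[simp] theorem ev_add (σ : St) (a b : Ex) : (a + b).ev σ = a.ev σ + b.ev σ := rfl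
@[simp] theorem ev_sub (σ : St) (a b : Ex) : (a - b).ev σ = a.ev σ - b.ev σ := rfl
@[simp] theorem ev_get (σ : St) (k : Arr) (i : Ex) : (get k i).ev σ = σ.a k (i.ev σ) := rfl
@[simp] theorem cost_lit (n : ℕ) : (lit n).cost = 1 := rfl
@[simp] theorem cost_arg (j : Fin 4) : (arg j).cost = 2 := rfl
@[simp] theorem cost_reg (x : Reg) : (reg x).cost = 2 := rfl
@[simp] theorem cost_add (a b : Ex) : (a + b).cost = a.cost + b.cost + 1 := rfl
@[simp] theorem cost_sub (a b : Ex) : (a - b).cost = a.cost + b.cost + 1 := rfl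
@[simp] theorem cost_get (k : Arr) (i : Ex) : (get k i).cost = i.cost + 9 := rfl

end Ex

attribute [simp] wp_skip wp_set wp_put wp_out wp_prim wp_seq

/-- Two-dimensional arrays are stored with stride `T`: column `c < T`, row `k`. The basic
instructions contain no multiplication, so row numbers and handles are stored multiplied by `T`
throughout. -/
theorem idx_inj {T c c' k k' : ℕ} (hc : c < T) (hc' : c' < T) :
    c + T * k = c' + T * k' ↔ c = c' ∧ k = k' := by
  constructor
  · intro h
    have h1 : (c + T * k) % T = (c' + T * k') % T := by rw [h]
    rw [Nat.add_mul_mod_self_left, Nat.add_mul_mod_self_left, Nat.mod_eq_of_lt hc,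
      Nat.mod_eq_of_lt hc'] at h1
    subst h1
    exact ⟨rfl, Nat.eq_of_mul_eq_mul_left (by omega : 0 < T) (by omega)⟩
  · rintro ⟨rfl, rfl⟩; rfl

/-! ### The memories of the copies -/

/-- The memory of copy `c`. -/
def pm (σ : St) (c : ℕ) : Memory := fun a => σ.a (.m .VAL) (σ.a (.m .PTR) a + c)

/-- Row `c` of the array `x`. -/
def cv (σ : St) (T c : ℕ) (x : CArr) (k : ℕ) : ℕ := σ.a (.c x) (c + T * k)

/-- The rows of cells that hold the memories of the copies are allocated correctly. -/
structure WFM (T : ℕ) (σ : St) : Prop where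
  -- For an arbitrary address `a` the product `T * a` cannot be computed quickly. Therefore `PTR`
  -- assigns a row of `VAL` to `a` when some copy writes there for the first time. Row zero stands
  -- for no row; it is never written and reads as zero, like the rows not yet used.
  ex : ∃ (ρ : ℕ → ℕ) (ν : ℕ), (∀ a, σ.a (.m .PTR) a = T * ρ a) ∧ σ.r (.s .next) = T * ν ∧
    (∀ a, ρ a ≤ ν) ∧ (∀ a b, ρ a = ρ b → ρ a ≠ 0 → a = b) ∧
    (∀ k c, c < T → k = 0 ∨ ν < k → σ.a (.m .VAL) (T * k + c) = 0)

/-- Only copy `c`, scratch registers and scratch arrays may have changed. -/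
structure Frame (T c : ℕ) (σ σ' : St) : Prop where
  io : σ'.io = σ.io
  kr : ∀ x, σ'.r (.k x) = σ.r (.k x)
  l : ∀ x, σ'.a (.l x) = σ.a (.l x)
  g : ∀ x, σ'.a (.g x) = σ.a (.g x)
  b : ∀ x, σ'.a (.b x) = σ.a (.b x)
  pm : ∀ c' < T, c' ≠ c → pm σ' c' = pm σ c'
  cv : ∀ c' < T, c' ≠ c → ∀ x, cv σ' T c' x = cv σ T c' x

/-- The registers and arrays of loops around the operation have not changed. -/
structure Keep (σ σ' : St) : Prop where
  mr : ∀ x, σ'.r (.m x) = σ.r (.m x)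
  t : ∀ x, σ'.a (.t x) = σ.a (.t x)

theorem Frame.refl (T c : ℕ) (σ : St) : Frame T c σ σ :=
  ⟨rfl, fun _ => rfl, fun _ => rfl, fun _ => rfl, fun _ => rfl, fun _ _ _ => rfl, fun _ _ _ _ => rfl⟩

theorem Frame.trans {T c : ℕ} {σ₁ σ₂ σ₃ : St} (h : Frame T c σ₁ σ₂) (h' : Frame T c σ₂ σ₃) :
    Frame T c σ₁ σ₃ :=
  ⟨h'.io.trans h.io, fun x => (h'.kr x).trans (h.kr x), fun x => (h'.l x).trans (h.l x),
    fun x => (h'.g x).trans (h.g x), fun x => (h'.b x).trans (h.b x),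
    fun c' h1 h2 => (h'.pm c' h1 h2).trans (h.pm c' h1 h2),
    fun c' h1 h2 x => (h'.cv c' h1 h2 x).trans (h.cv c' h1 h2 x)⟩

theorem Keep.refl (σ : St) : Keep σ σ := ⟨fun _ => rfl, fun _ => rfl⟩

theorem Keep.trans {σ₁ σ₂ σ₃ : St} (h : Keep σ₁ σ₂) (h' : Keep σ₂ σ₃) : Keep σ₁ σ₃ :=
  ⟨fun x => (h'.mr x).trans (h.mr x), fun x => (h'.t x).trans (h.t x)⟩

/-- Takes back the `d` logged writes from number `l` on. -/
def undo (la lv : ℕ → ℕ) (l : ℕ) : ℕ → Memory → Memory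
  | 0, m => m
  | d + 1, m => undo la lv l d (Function.update m (la (l + d)) (lv (l + d)))

theorem undo_add (la lv : ℕ → ℕ) (l d e : ℕ) (m : Memory) :
    undo la lv l (d + e) m = undo la lv l d (undo la lv (l + d) e m) := by
  induction e generalizing m with
  | zero => rfl
  | succ e ih => rw [← Nat.add_assoc, undo, ih, undo, Nat.add_assoc]

theorem undo_congr {la lv la' lv' : ℕ → ℕ} {l d : ℕ}
    (h : ∀ k, l ≤ k → k < l + d → la' k = la k ∧ lv' k = lv k) (m : Memory) :
    undo la' lv' l d m = undo la lv l d m := by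
  induction d generalizing m with
  | zero => rfl
  | succ d ih =>
    obtain ⟨h1, h2⟩ := h (l + d) (by omega) (by omega)
    rw [undo, undo, h1, h2, ih fun k h3 h4 => h k h3 (by omega)]

/-- `Sim T c l σ σ' d m`: on copy `c`, the memory was changed to `m` by `d` writes, which have been
logged from position `l` on. -/
structure Sim (T c l : ℕ) (σ σ' : St) (d : ℕ) (m : Memory) : Prop where
  wfm : WFM T σ'
  pm : pm σ' c = m
  lp : σ'.r (.s .lp) = c + T * (l + d)
  undo : undo (cv σ' T c .LA) (cv σ' T c .LV) l d m = RamDyn.pm σ c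
  old : ∀ k < l, cv σ' T c .LA k = cv σ T c .LA k ∧ cv σ' T c .LV k = cv σ T c .LV k
  arr : ∀ x, x ≠ .LA → x ≠ .LV → cv σ' T c x = cv σ T c x
  frame : Frame T c σ σ'
  keep : Keep σ σ'

/-- The second part only appends to the log, so the entries of the first part are intact and taking
back the two parts in reverse order restores the initial memory. -/
theorem Sim.trans {T c l d e : ℕ} {σ₁ σ₂ σ₃ : St} {m m' : Memory} (h : Sim T c l σ₁ σ₂ d m)
    (h' : Sim T c (l + d) σ₂ σ₃ e m') : Sim T c l σ₁ σ₃ (d + e) m' := by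
  refine ⟨h'.wfm, h'.pm, by rw [h'.lp, Nat.add_assoc], ?_, fun k hk => ?_, fun x h1 h2 => ?_,
    h.frame.trans h'.frame, h.keep.trans h'.keep⟩
  · rw [undo_add, h'.undo, h.pm, ← h.undo]
    exact undo_congr (fun k _ hk => h'.old k hk) _
  · obtain ⟨h1, h2⟩ := h.old k hk
    obtain ⟨h3, h4⟩ := h'.old k (by omega)
    exact ⟨h3.trans h1, h4.trans h2⟩
  · exact (h'.arr x h1 h2).trans (h.arr x h1 h2)

/-- The fixed registers that the operations on copy `c` rely on. -/
structure Env (T c : ℕ) (σ : St) : Prop where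
  hT : σ.r (.k .T) = T
  hc : σ.r (.k .c) = c
  lt : c < T

theorem Env.frame {T c c' : ℕ} {σ σ' : St} (h : Env T c σ) (hf : Frame T c' σ σ') : Env T c σ' :=
  ⟨(hf.kr _).trans h.hT, (hf.kr _).trans h.hc, h.lt⟩

/-! ### Simulation of a program on one copy, with a log -/

section Sim

variable {ι : Type}

/-- Writes `wv` to cell `wa` of copy `c`, with a log entry at `lp`. -/
def wr : Cmd ι :=
  .set (.s .p) (.get (.m .PTR) (.s .wa)) ;;
  .ite (.s .p) .skip
    (.set (.s .next) (.s .next + .k .T) ;; .set (.s .p) (.s .next) ;;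
      .put (.m .PTR) (.s .wa) (.s .p)) ;;
  .put (.c .LA) (.s .lp) (.s .wa) ;;
  .put (.c .LV) (.s .lp) (.get (.m .VAL) (.s .p + .k .c)) ;;
  .put (.m .VAL) (.s .p + .k .c) (.s .wv) ;;
  .set (.s .lp) (.s .lp + .k .T)

variable {prim : ι → ℕ → ℕ → ℕ} {T c l : ℕ} {σ : St}

theorem spec_wr (hE : Env T c σ) (hW : WFM T σ) (hl : σ.r (.s .lp) = c + T * l)
    {a v : ℕ} (ha : σ.r (.s .wa) = a) (hv : σ.r (.s .wv) = v) :
    Spec prim wr σ 140 fun σ' => Sim T c l σ σ' 1 (Function.update (pm σ c) a v) := by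
  obtain ⟨ρ, ν, h1, h2, h3, h4, h5⟩ := hW.ex
  have hT : 0 < T := by have := hE.lt; omega
  have hc := hE.lt
  apply Spec.of_wp
  simp only [wr, wp_seq, wp_set, wp_ite, wp_put, wp_skip, Ex.ev_reg, Ex.ev_get, Ex.ev_add, St.setR_r,
    Ex.cost_reg, Ex.cost_get, Ex.cost_add, Reg.s.injEq, reduceCtorEq, if_true, if_false]
  have haPTR := h1 a
  rw [ha]
  split_ifs with hp
  · -- the row of the cell exists already
    rw [haPTR] at hp
    have hρ : ρ a ≠ 0 := fun h => hp (by rw [h, Nat.mul_zero])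
    simp [hE.hc, hE.hT, hl, hv, haPTR]
    -- Allocated rows are distinct, so the write affects one cell of one copy only.
    have hpm : ∀ c' < T, ∀ b, Function.update (σ.a (.m .VAL)) (T * ρ a + c) v (T * ρ b + c') =
        if c' = c ∧ b = a then v else σ.a (.m .VAL) (T * ρ b + c') := by
      intro c' hc' b
      rw [Function.update_apply]
      congr 1
      rw [add_comm _ c', add_comm _ c, idx_inj hc' hc]
      refine propext ⟨fun ⟨x, y⟩ => ⟨x, (h4 a b y.symm hρ).symm⟩, ?_⟩
      rintro ⟨rfl, rfl⟩; exact ⟨rfl, rfl⟩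
    refine ⟨⟨⟨ρ, ν, by simpa using h1, by simpa using h2, h3, h4, fun k c' hc' hk => ?_⟩⟩, ?_, ?_, ?_,
      fun k hk => ?_, fun x hx1 hx2 => ?_, ?_, ?_⟩
    · simp
      rw [Function.update_of_ne, h5 k c' hc' hk]
      rw [add_comm _ c', add_comm _ c, ne_eq, idx_inj hc' hc]
      rintro ⟨-, rfl⟩
      have := h3 a
      omega
    · funext b
      simp only [pm, St.setR_a, St.setA_a, if_true, reduceCtorEq, if_false, Arr.m.injEq]
      rw [h1, hpm c hc, Function.update_apply]
      simp [h1, pm]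
    · simp [Nat.mul_add, Nat.add_assoc]
    · simp [undo, cv, pm, Function.update_eq_self_iff, haPTR]
    · simp [cv, Function.update_apply]
      omega
    · funext k; simp [cv, hx1, hx2]
    · refine ⟨rfl, by simp, by simp, by simp, by simp, fun c' h1' h2' => ?_, fun c' h1' h2' x => ?_⟩
      · funext b
        simp only [RamDyn.pm, St.setR_a, St.setA_a, if_true, reduceCtorEq, if_false, Arr.m.injEq]
        rw [h1, hpm c' h1']
        simp [h2']
      · funext k
        have : c' + T * k ≠ c + T * l := fun h => h2' ((idx_inj h1' hc).1 h).1
        simp [cv]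
        split_ifs with hx hx
        · subst hx; simp [this]
        · subst hx; simp [this]
        · rfl
    · exact ⟨by simp, by simp⟩
  · -- a new row
    simp only [haPTR, not_not] at hp
    have hρ : ρ a = 0 := by
      rcases Nat.mul_eq_zero.1 hp with h | h
      · omega
      · exact h
    have hnew : T * ν + T = T * (ν + 1) := by ring
    simp [hE.hc, hE.hT, hl, ha, hv, h2, hnew]
    -- The new row is still zero in the other columns, so the other copies keep reading zero at the
    -- address `a`.
    have hpm : ∀ c' < T, ∀ b, Function.update (σ.a (.m .VAL)) (T * (ν + 1) + c) v
        (Function.update (σ.a (.m .PTR)) a (T * (ν + 1)) b + c') =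
        if c' = c ∧ b = a then v else σ.a (.m .VAL) (T * ρ b + c') := by
      intro c' hc' b
      by_cases hb : b = a
      · subst hb
        rw [Function.update_self]
        by_cases hcc : c' = c
        · subst hcc; simp
        · rw [Function.update_of_ne (by omega), h5 _ _ hc' (.inr (by omega)), if_neg (by tauto), hρ,
            h5 _ _ hc' (.inl rfl)]
      · rw [Function.update_of_ne hb, h1, if_neg (by tauto), Function.update_of_ne]
        rw [add_comm _ c', add_comm _ c, ne_eq, idx_inj hc' hc]
        have := h3 b; omega
    have hold : σ.a (.m .VAL) (T * (ν + 1) + c) = pm σ c a := by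
      rw [h5 _ _ hc (.inr (by omega)), pm, haPTR, hρ, h5 _ _ hc (.inl rfl)]
    refine ⟨⟨⟨Function.update ρ a (ν + 1), ν + 1, fun b => ?_, by simp, fun b => ?_,
      fun b b' => ?_, fun k c' hc' hk => ?_⟩⟩, ?_, ?_, ?_,
      fun k hk => ?_, fun x hx1 hx2 => ?_, ?_, ?_⟩
    · simp [Function.update_apply, h1]
    · rw [Function.update_apply]
      have := h3 b
      split_ifs <;> omega
    · simp only [Function.update_apply]
      have := h3 b
      have := h3 b'
      split_ifs with hb hb' hb'
      · intros; rw [hb, hb']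
      · omega
      · omega
      · exact h4 b b'
    · simp
      rw [Function.update_of_ne, h5 k c' hc' (by omega)]
      rw [add_comm _ c', add_comm _ c, ne_eq, idx_inj hc' hc]
      omega
    · funext b
      simp only [pm, St.setR_a, St.setA_a, if_true, reduceCtorEq, if_false, Arr.m.injEq]
      rw [hpm c hc, Function.update_apply]
      simp [h1, pm]
    · simp [Nat.mul_add, Nat.add_assoc]
    · simp [undo, cv, hold]
    · simp [cv, Function.update_apply]
      omega
    · funext k; simp [cv, hx1, hx2]
    · refine ⟨rfl, by simp, by simp, by simp, by simp, fun c' h1' h2' => ?_, fun c' h1' h2' x => ?_⟩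
      · funext b
        simp only [RamDyn.pm, St.setR_a, St.setA_a, if_true, reduceCtorEq, if_false, Arr.m.injEq]
        rw [hpm c' h1']
        simp [h2', h1]
      · funext k
        have : c' + T * k ≠ c + T * l := fun h => h2' ((idx_inj h1' hc).1 h).1
        simp [cv]
        split_ifs with hx hx
        · subst hx; simp [this]
        · subst hx; simp [this]
        · rfl
    · exact ⟨by simp, by simp⟩

/-- The states agree except for scratch registers. -/
structure Scr (σ σ' : St) : Prop where
  io : σ'.io = σ.io
  a : σ'.a = σ.a
  kr : ∀ x, σ'.r (.k x) = σ.r (.k x)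
  mr : ∀ x, σ'.r (.m x) = σ.r (.m x)
  next : σ'.r (.s .next) = σ.r (.s .next)

theorem Scr.refl (σ : St) : Scr σ σ := ⟨rfl, rfl, fun _ => rfl, fun _ => rfl, rfl⟩

theorem Scr.setR {σ σ' : St} (h : Scr σ σ') {x : SReg} (hx : x ≠ .next) (v : ℕ) :
    Scr σ (σ'.setR (.s x) v) :=
  ⟨h.io, h.a, fun y => by simpa using h.kr y, fun y => by simpa using h.mr y,
    by simpa [hx.symm] using h.next⟩

theorem Scr.cv {σ σ' : St} (h : Scr σ σ') (T c : ℕ) : cv σ' T c = cv σ T c := by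
  unfold RamDyn.cv; rw [h.a]

theorem Scr.pm {σ σ' : St} (h : Scr σ σ') : pm σ' = pm σ := by
  unfold RamDyn.pm; rw [h.a]

theorem Scr.wfm {σ σ' : St} (h : Scr σ σ') (hW : WFM T σ) : WFM T σ' := by
  obtain ⟨⟨ρ, ν, h1, h2, h3, h4, h5⟩⟩ := hW
  exact ⟨ρ, ν, by rwa [h.a], h.next.trans h2, h3, h4, by rwa [h.a]⟩

theorem Scr.env {σ σ' : St} (h : Scr σ σ') (hE : Env T c σ) : Env T c σ' :=
  ⟨(h.kr _).trans hE.hT, (h.kr _).trans hE.hc, hE.lt⟩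

theorem Scr.frame {σ σ' : St} (h : Scr σ σ') (T c : ℕ) : Frame T c σ σ' :=
  ⟨h.io, h.kr, fun x => by rw [h.a], fun x => by rw [h.a], fun x => by rw [h.a],
    fun c' _ _ => by rw [h.pm], fun c' _ _ x => by rw [h.cv]⟩

theorem Scr.keep {σ σ' : St} (h : Scr σ σ') : Keep σ σ' := ⟨h.mr, fun x => by rw [h.a]⟩

theorem Sim.of_scr {σ₁ σ₂ σ₃ : St} {d : ℕ} {m : Memory} (hs : Scr σ₁ σ₂)
    (h : Sim T c l σ₂ σ₃ d m) : Sim T c l σ₁ σ₃ d m :=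
  ⟨h.wfm, h.pm, h.lp, by rw [h.undo, hs.pm], fun k hk => by rw [← hs.cv]; exact h.old k hk,
    fun x h1 h2 => by rw [← hs.cv]; exact h.arr x h1 h2, (hs.frame T c).trans h.frame,
    hs.keep.trans h.keep⟩

theorem wp_wr {σ' : St} (hs : Scr σ σ') (hE : Env T c σ) (hW : WFM T σ)
    (hl : σ'.r (.s .lp) = c + T * l) {a v : ℕ} (ha : σ'.r (.s .wa) = a) (hv : σ'.r (.s .wv) = v)
    {t : ℕ} {Q : ℕ → St → Prop}
    (hq : ∀ s σ₁, s ≤ t + 140 → Sim T c l σ σ₁ 1 (Function.update (pm σ c) a v) → Q s σ₁) :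
    wp prim wr σ' t Q :=
  (spec_wr (hs.env hE) (hs.wfm hW) hl ha hv).wp fun s σ₁ h1 h2 =>
    hq s σ₁ h1 (by rw [hs.pm] at h2; exact h2.of_scr hs)

/-- The contents of a cell of the current copy. -/
def rd (e : Ex) : Ex := .get (.m .VAL) (.get (.m .PTR) e + .k .c)

theorem ev_rd (e : Ex) (hE : Env T c σ) : (rd e).ev σ = pm σ c (e.ev σ) := by
  simp [rd, pm, hE.hc]

@[simp] theorem cost_rd (e : Ex) : (rd e).cost = e.cost + 21 := by
  simp [rd]

/-- The program, run on copy `c`, with a log. -/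
def sim : Program ι → Cmd ι
  | .const i n => .set (.s .wa) (.lit i) ;; .set (.s .wv) (.lit n) ;; wr
  | .add i j k => .set (.s .wa) (.lit i) ;; .set (.s .wv) (rd (.lit j) + rd (.lit k)) ;; wr
  | .sub i j k => .set (.s .wa) (.lit i) ;; .set (.s .wv) (rd (.lit j) - rd (.lit k)) ;; wr
  | .prim f i j k => .set (.s .t1) (rd (.lit j)) ;; .set (.s .t2) (rd (.lit k)) ;;
      .prim f (.s .wv) (.s .t1) (.s .t2) ;; .set (.s .wa) (.lit i) ;; wr
  | .load i j => .set (.s .wa) (.lit i) ;; .set (.s .wv) (rd (rd (.lit j))) ;; wr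
  | .store i j => .set (.s .wa) (rd (.lit i)) ;; .set (.s .wv) (rd (.lit j)) ;; wr
  | .seq p q => sim p ;; sim q
  | .ite i p q => .ite (rd (.lit i)) (sim p) (sim q)
  | .loop i p => .while (rd (.lit i)) (sim p)

/-- By induction on the execution, since termination is known only from there. A simulated step
makes at most one logged write, so the log grows by at most `t`, and rolling back costs no more than
running, up to a constant. -/
theorem spec_sim {p : Program ι} {m m' : Memory} {t : ℕ} (h : Exec prim p m t m') :
    ∀ {σ : St} {l : ℕ}, Env T c σ → WFM T σ → σ.r (.s .lp) = c + T * l → pm σ c = m →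
    Spec prim (sim p) σ (220 * t) fun σ' => ∃ d ≤ t, Sim T c l σ σ' d m' := by
  induction h with
  | const i n m =>
    intro σ l hE hW hl hm
    apply Spec.of_wp
    simp only [sim, wp_seq, wp_set]
    refine wp_wr (((Scr.refl σ).setR (by decide) _).setR (by decide) _) hE hW
      (by simpa using hl) rfl rfl fun s σ₁ h1 h2 => ⟨?_, 1, le_rfl, ?_⟩
    · simp at h1; omega
    · simpa [hm] using h2
  | add i j k m | sub i j k m | load i j m =>
    intro σ l hE hW hl hm
    apply Spec.of_wp
    simp only [sim, wp_seq, wp_set]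
    have hE' := ((Scr.refl σ).setR (x := .wa) (by decide) i).env hE
    refine wp_wr (((Scr.refl σ).setR (by decide) _).setR (by decide) _) hE hW
      (by simpa using hl) rfl rfl fun s σ₁ h1 h2 => ⟨?_, 1, le_rfl, ?_⟩
    · simp at h1; omega
    · simpa [← hm, ev_rd _ hE', ((Scr.refl σ).setR (x := .wa) (by decide) i).pm] using h2
  | store i j m =>
    intro σ l hE hW hl hm
    apply Spec.of_wp
    simp only [sim, wp_seq, wp_set, ev_rd _ hE]
    have hs := (Scr.refl σ).setR (x := .wa) (by decide) (pm σ c i)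
    refine wp_wr (((Scr.refl σ).setR (by decide) _).setR (by decide) _) hE hW
      (by simpa using hl) rfl rfl fun s σ₁ h1 h2 => ⟨?_, 1, le_rfl, ?_⟩
    · simp at h1; omega
    · simpa [← hm, ev_rd _ (hs.env hE), hs.pm] using h2
  | prim f i j k m =>
    intro σ l hE hW hl hm
    apply Spec.of_wp
    simp only [sim, wp_seq, wp_set, wp_prim, ev_rd _ hE]
    have hs := (Scr.refl σ).setR (x := .t1) (by decide) (pm σ c j)
    refine wp_wr (((((Scr.refl σ).setR (by decide) _).setR (by decide) _).setR (by decide) _).setR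
      (by decide) _) hE hW
      (by simpa using hl) rfl rfl fun s σ₁ h1 h2 => ⟨?_, 1, le_rfl, ?_⟩
    · simp at h1; omega
    · simpa [← hm, ev_rd _ (hs.env hE), hs.pm] using h2
  | seq h1 h2 ih1 ih2 =>
    intro σ l hE hW hl hm
    apply Spec.of_wp
    simp only [sim, wp_seq]
    refine (ih1 hE hW hl hm).wp fun s σ₁ hs ⟨d, hd, hsim⟩ => ?_
    refine (ih2 (hE.frame hsim.frame) hsim.wfm hsim.lp hsim.pm).wp
      fun s' σ₂ hs' ⟨d', hd', hsim'⟩ => ⟨by omega, d + d', by omega, hsim.trans hsim'⟩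
  | ite_true hi h1 ih =>
    intro σ l hE hW hl hm
    apply Spec.of_wp
    subst hm
    simp only [sim, wp_ite, ev_rd _ hE, Ex.ev_lit]
    rw [if_pos hi]
    refine (ih hE hW hl rfl).wp fun s σ₁ hs ⟨d, hd, hsim⟩ => ⟨?_, d, by omega, hsim⟩
    simp at hs; omega
  | ite_false hi h1 ih =>
    intro σ l hE hW hl hm
    apply Spec.of_wp
    subst hm
    simp only [sim, wp_ite, ev_rd _ hE, Ex.ev_lit]
    rw [if_neg (not_not.2 hi)]
    refine (ih hE hW hl rfl).wp fun s σ₁ hs ⟨d, hd, hsim⟩ => ⟨?_, d, by omega, hsim⟩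
    simp at hs; omega
  | loop_true hi h1 h2 ih1 ih2 =>
    intro σ l hE hW hl hm
    subst hm
    obtain ⟨s, σ₁, hr, hs, d, hd, hsim⟩ := ih1 hE hW hl rfl
    obtain ⟨s', σ₂, hr', hs', d', hd', hsim'⟩ :=
      ih2 (hE.frame hsim.frame) hsim.wfm hsim.lp hsim.pm
    refine ⟨_, _, .while_true (by rwa [ev_rd _ hE]) hr hr', ?_, d + d', by omega, hsim.trans hsim'⟩
    simp; omega
  | loop_false hi =>
    intro σ l hE hW hl hm
    subst hm
    refine ⟨_, _, .while_false (by rwa [ev_rd _ hE]), ?_, 0, by omega, hW, rfl, hl, rfl,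
      fun _ _ => ⟨rfl, rfl⟩, fun _ _ _ => rfl, .refl .., .refl _⟩
    simp

end Sim

/-! ### Rows of a copy and what leaves them unchanged -/

section Frames

variable {T c : ℕ} {σ σ' : St}

@[simp] theorem cv_setR (σ : St) (x : Reg) (v T c : ℕ) (y : CArr) :
    cv (σ.setR x v) T c y = cv σ T c y := rfl
@[simp] theorem pm_setR (σ : St) (x : Reg) (v c : ℕ) : pm (σ.setR x v) c = pm σ c := rfl
@[simp] theorem pm_setA_c (σ : St) (x : CArr) (i v c : ℕ) : pm (σ.setA (.c x) i v) c = pm σ c := by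
  unfold pm; simp

theorem cv_put (hc : c < T) (x : CArr) (k v : ℕ) (y : CArr) :
    cv (σ.setA (.c x) (c + T * k) v) T c y =
      if y = x then Function.update (cv σ T c x) k v else cv σ T c y := by
  funext j
  by_cases hy : y = x
  · subst hy
    simp only [cv, St.setA_a, if_true, Function.update_apply]
    by_cases hj : j = k
    · simp [hj]
    · rw [if_neg hj, if_neg fun h => hj ((idx_inj hc hc).1 h).2]
  · simp [cv, hy]

theorem cv_put_zero (hc : c < T) (x : CArr) (v : ℕ) (y : CArr) :
    cv (σ.setA (.c x) c v) T c y =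
      if y = x then Function.update (cv σ T c x) 0 v else cv σ T c y := by
  simpa using cv_put (σ := σ) hc x 0 v y

theorem cv_put_ne {c' : ℕ} (hc : c < T) (hc' : c' < T) (hne : c' ≠ c) (x : CArr) (k v : ℕ)
    (y : CArr) : cv (σ.setA (.c x) (c + T * k) v) T c' y = cv σ T c' y := by
  funext j
  by_cases hy : y = x
  · subst hy
    simp only [cv, St.setA_a, if_true, Function.update_apply]
    rw [if_neg fun h => hne ((idx_inj hc' hc).1 h).1]
  · simp [cv, hy]

theorem cv_zero (σ : St) (T c : ℕ) (x : CArr) : cv σ T c x 0 = σ.a (.c x) c := by simp [cv]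

theorem WFM.setA_c (h : WFM T σ) (x : CArr) (i v : ℕ) : WFM T (σ.setA (.c x) i v) := by
  obtain ⟨ρ, ν, h1, h2, h3, h4, h5⟩ := h
  exact ⟨ρ, ν, by simpa using h1, h2, h3, h4, by simpa using h5⟩

theorem WFM.setR (h : WFM T σ) {x : Reg} (hx : x ≠ .s .next) (v : ℕ) : WFM T (σ.setR x v) := by
  obtain ⟨ρ, ν, h1, h2, h3, h4, h5⟩ := h
  exact ⟨ρ, ν, h1, by simpa [hx.symm] using h2, h3, h4, h5⟩

theorem Frame.put (h : Frame T c σ σ') (hc : c < T) (x : CArr) (k v : ℕ) :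
    Frame T c σ (σ'.setA (.c x) (c + T * k) v) :=
  ⟨h.io, h.kr, fun y => by simpa using h.l y, fun y => by simpa using h.g y,
    fun y => by simpa using h.b y, fun c' h1 h2 => by simpa using h.pm c' h1 h2,
    fun c' h1 h2 y => by rw [cv_put_ne hc h1 h2, h.cv c' h1 h2]⟩

theorem Frame.put_zero (h : Frame T c σ σ') (hc : c < T) (x : CArr) (v : ℕ) :
    Frame T c σ (σ'.setA (.c x) c v) := by
  simpa using h.put hc x 0 v

theorem Frame.setS (h : Frame T c σ σ') (x : SReg) (v : ℕ) : Frame T c σ (σ'.setR (.s x) v) :=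
  ⟨h.io, fun y => by simpa using h.kr y, h.l, h.g, h.b, h.pm, h.cv⟩

theorem Frame.setM (h : Frame T c σ σ') (x : MReg) (v : ℕ) : Frame T c σ (σ'.setR (.m x) v) :=
  ⟨h.io, fun y => by simpa using h.kr y, h.l, h.g, h.b, h.pm, h.cv⟩

theorem Keep.put (h : Keep σ σ') (x : CArr) (i v : ℕ) : Keep σ (σ'.setA (.c x) i v) :=
  ⟨h.mr, fun y => by simpa using h.t y⟩

theorem Keep.setS (h : Keep σ σ') (x : SReg) (v : ℕ) : Keep σ (σ'.setR (.s x) v) :=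
  ⟨fun y => by simpa using h.mr y, h.t⟩

end Frames

/-! ### Rolling back the log -/

section Unwind

variable {ι : Type} {prim : ι → ℕ → ℕ → ℕ} {T c l : ℕ} {σ : St}

/-- Takes back the writes logged before position `lp`, down to the position stored for the
copy. -/
def unwind : Cmd ι :=
  .while (.s .lp - (.k .c + .get (.c .LPA) (.k .c))) <|
    .set (.s .lp) (.s .lp - .k .T) ;;
    .set (.s .wa) (.get (.c .LA) (.s .lp)) ;;
    .set (.s .wv) (.get (.c .LV) (.s .lp)) ;;
    wr ;;
    .set (.s .lp) (.s .lp - .k .T)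

/-- Only the memory of copy `c` and its log from position `l` on have changed. -/
structure Unw (T c l : ℕ) (σ σ' : St) (m : Memory) : Prop where
  wfm : WFM T σ'
  pm : pm σ' c = m
  old : ∀ k < l, cv σ' T c .LA k = cv σ T c .LA k ∧ cv σ' T c .LV k = cv σ T c .LV k
  arr : ∀ x, x ≠ .LA → x ≠ .LV → cv σ' T c x = cv σ T c x
  frame : Frame T c σ σ'
  keep : Keep σ σ'

theorem spec_unwind (hE : Env T c σ) (hW : WFM T σ) {d : ℕ} (hl : σ.r (.s .lp) = c + T * (l + d))
    (hlpa : cv σ T c .LPA 0 = T * l) {m : Memory}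
    (hm : undo (cv σ T c .LA) (cv σ T c .LV) l d (pm σ c) = m) :
    Spec prim unwind σ (250 * d + 20) fun σ' => Unw T c l σ σ' m := by
  have hT : 0 < T := by have := hE.lt; omega
  apply Spec.of_wp
  refine wp_while (b := 230) (fun d' σ' => σ'.r (.s .lp) = c + T * (l + d') ∧
    undo (cv σ' T c .LA) (cv σ' T c .LV) l d' (pm σ' c) = m ∧
    Unw T c l σ σ' (pm σ' c)) d ⟨hl, hm, hW, rfl, fun _ _ => ⟨rfl, rfl⟩, fun _ _ _ => rfl,
      .refl .., .refl _⟩ ?_ ?_ ?_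
  · rintro d' σ₁ ⟨h1, h2, h3⟩
    have hE₁ := hE.frame h3.frame
    have hlpa₁ : σ₁.a (.c .LPA) c = T * l := by
      rw [← cv_zero σ₁ T, h3.arr _ (by decide) (by decide), hlpa]
    constructor
    · simp only [Ex.ev_sub, Ex.ev_reg, Ex.ev_add, Ex.ev_get, h1, hE₁.hc, hlpa₁]
      have : T * (l + (d' + 1)) = T * l + T * d' + T := by ring
      omega
    · apply Spec.of_wp
      have h4 : c + T * (l + (d' + 1)) - T = c + T * (l + d') := by
        have : T * (l + (d' + 1)) = T * (l + d') + T := by ring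
        omega
      simp only [wp_seq, wp_set, Ex.ev_sub, Ex.ev_reg, Ex.ev_get, h1, hE₁.hT, h4, St.setR_r,
        St.setR_a, Reg.s.injEq, reduceCtorEq, if_true, if_false]
      -- The same routine `wr` restores the old value. It logs this write over the entry just
      -- consumed and advances `lp`; the last command of the loop body reverts the advance.
      refine wp_wr (((Scr.refl σ₁).setR (by decide) _).setR (by decide) _ |>.setR (by decide) _) hE₁
        h3.wfm (l := l + d') (by simp) (by simp; rfl) (by simp; rfl) fun s σ₂ hs h5 => ?_
      have hE₂ := hE₁.frame h5.frame
      have hs₂ := (Scr.refl σ₂).setR (x := .lp) (by decide) (σ₂.r (.s .lp) - σ₂.r (.k .T))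
      refine ⟨by simp at hs ⊢; omega, ?_, ?_, hs₂.wfm h5.wfm, rfl, fun k hk => ?_,
        fun x hx hx' => ?_, (h3.frame.trans h5.frame).trans (hs₂.frame ..),
        (h3.keep.trans h5.keep).trans hs₂.keep⟩
      · have : T * (l + d' + 1) = T * (l + d') + T := by ring
        simp only [h5.lp, hE₂.hT]
        omega
      · simp only [cv_setR, pm_setR]
        rw [← h2, undo, h5.pm]
        exact undo_congr (fun k _ hk => h5.old k hk) _
      · simp only [cv_setR]
        obtain ⟨h6, h7⟩ := h5.old k (by omega)
        obtain ⟨h8, h9⟩ := h3.old k hk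
        exact ⟨h6.trans h8, h7.trans h9⟩
      · simp only [cv_setR]
        exact (h5.arr x hx hx').trans (h3.arr x hx hx')
  · rintro σ₁ ⟨h1, h2, h3⟩
    have hlpa₁ : σ₁.a (.c .LPA) c = T * l := by
      rw [← cv_zero σ₁ T, h3.arr _ (by decide) (by decide), hlpa]
    simp [h1, hlpa₁, (hE.frame h3.frame).hc]
  · rintro s σ₁ hs ⟨h1, h2, h3⟩
    refine ⟨?_, by rw [← h2]; exact h3⟩
    simp at hs
    omega

end Unwind

/-- A call is two ordinary writes followed by the program, so the arguments are logged as well. They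
are the `2` in the bound `Γ + 2` of `LogStk`. -/
theorem enter_pair (x n : ℕ) (m : Memory) :
    enter [x, n] m = Function.update (Function.update m 0 x) 1 n := by
  funext a
  rcases a with _ | _ | a
  · simp [enter]
  · simp [enter]
  · simp [enter]

/-- The arrays of a copy that hold its queue and its phase. -/
def CArr.queue : CArr → Bool
  | .QU | .HD | .MK | .TL | .PH | .LVL => true
  | _ => false

/-! ### The stack of insertions on a copy -/

section Stack

variable {ι : Type} (prim : ι → ℕ → ℕ → ℕ) (P : IncrementalAlg ι) (Pr : DynProblem)
  (n T Γ : ℕ) (it : ℕ → ℕ)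

/-- The memory `m` was reached by inserting the items on the stack, and can be reduced to the
earlier memories with a log of length `l`. -/
def LogStk (la lv bnd st : ℕ → ℕ) : List (ℕ × ℕ) → ℕ → Memory → Prop
  | [], l, m => l = 0 ∧ m = fun _ => 0
  | e :: s, l, m => st s.length = T * e.1 ∧
      P.Reach prim Pr n T (((e :: s).map fun e => it e.1).toFinset) m ∧
      ∃ l₀ d, l = l₀ + d ∧ d ≤ Γ + 2 ∧ bnd s.length = T * l₀ ∧
        LogStk la lv bnd st s l₀ (undo la lv l₀ d m)

/-- The stack of copy `c`. -/
structure RepS (c : ℕ) (σ : St) (stk : List (ℕ × ℕ)) : Prop where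
  log : ∃ l, cv σ T c .LPA 0 = T * l ∧ LogStk prim P Pr n T Γ it (cv σ T c .LA) (cv σ T c .LV)
    (cv σ T c .BND) (cv σ T c .STK) stk l (pm σ c)
  spa : cv σ T c .SPA 0 = T * stk.length
  tagged : ∀ e ∈ stk, cv σ T c .TAG e.1 = e.2 + 1
  untagged : ∀ k, k ∉ stk.map Prod.fst → cv σ T c .TAG k = 0
  nodup : (stk.map Prod.fst).Nodup

/-- The fixed data that operations on copy `c` rely on. -/
structure PEnv (c : ℕ) (σ : St) : Prop extends Env T c σ where
  hn : σ.r (.k .n) = n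
  hit : ∀ k, σ.a (.g .ITEM) (T * k) = it k

/-- Only copy `c` has changed, and its stack is now `stk`. -/
structure StkOp (c : ℕ) (σ σ' : St) (stk : List (ℕ × ℕ)) : Prop where
  wfm : WFM T σ'
  rep : RepS prim P Pr n T Γ it c σ' stk
  queue : ∀ x : CArr, x.queue = true → cv σ' T c x = cv σ T c x
  frame : Frame T c σ σ'

/-- Inserts the item with handle `h` on copy `c`, and puts it on the stack with the tag `tg`. -/
def push : Cmd ι :=
  .put (.c .BND) (.k .c + .get (.c .SPA) (.k .c)) (.get (.c .LPA) (.k .c)) ;;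
  .put (.c .STK) (.k .c + .get (.c .SPA) (.k .c)) (.s .h) ;;
  .put (.c .SPA) (.k .c) (.get (.c .SPA) (.k .c) + .k .T) ;;
  .put (.c .TAG) (.k .c + .s .h) (.s .tg + .lit 1) ;;
  .set (.s .lp) (.k .c + .get (.c .LPA) (.k .c)) ;;
  .set (.s .wa) (.lit 0) ;; .set (.s .wv) (.get (.g .ITEM) (.s .h)) ;; wr ;;
  .set (.s .wa) (.lit 1) ;; .set (.s .wv) (.k .n) ;; wr ;;
  sim P.onInsert ;;
  .put (.c .LPA) (.k .c) (.s .lp - .k .c)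

/-- Takes back the last insertion on copy `c`, and leaves the handle and the tag in `h`, `tg`. -/
def pop : Cmd ι :=
  .put (.c .SPA) (.k .c) (.get (.c .SPA) (.k .c) - .k .T) ;;
  .set (.s .lp) (.k .c + .get (.c .LPA) (.k .c)) ;;
  .put (.c .LPA) (.k .c) (.get (.c .BND) (.k .c + .get (.c .SPA) (.k .c))) ;;
  unwind ;;
  .set (.s .h) (.get (.c .STK) (.k .c + .get (.c .SPA) (.k .c))) ;;
  .set (.s .tg) (.get (.c .TAG) (.k .c + .s .h) - .lit 1) ;;
  .put (.c .TAG) (.k .c + .s .h) (.lit 0)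

variable {prim P Pr n T Γ it}

theorem PEnv.frame {c c' : ℕ} {σ σ' : St} (h : PEnv n T it c σ) (hf : Frame T c' σ σ') :
    PEnv n T it c σ' :=
  ⟨h.toEnv.frame hf, (hf.kr _).trans h.hn, fun k => by rw [hf.g]; exact h.hit k⟩

/-- Only the log below its end and the stack below its top matter, so popped entries may be
overwritten. -/
theorem LogStk.congr {la lv bnd st la' lv' bnd' st' it' : ℕ → ℕ} {s : List (ℕ × ℕ)} {l : ℕ}
    {m : Memory} (h : LogStk prim P Pr n T Γ it la lv bnd st s l m)
    (hl : ∀ k < l, la' k = la k ∧ lv' k = lv k)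
    (hs : ∀ k < s.length, bnd' k = bnd k ∧ st' k = st k) (hi : ∀ e ∈ s, it' e.1 = it e.1) :
    LogStk prim P Pr n T Γ it' la' lv' bnd' st' s l m := by
  induction s generalizing l m with
  | nil => exact h
  | cons e s ih =>
    obtain ⟨h1, h2, l₀, d, rfl, hd, h3, h4⟩ := h
    obtain ⟨h5, h6⟩ := hs s.length (by simp)
    have h7 : (e :: s).map (fun e => it' e.1) = (e :: s).map (fun e => it e.1) :=
      List.map_congr_left hi
    refine ⟨h6.trans h1, by rw [h7]; exact h2, l₀, d, rfl, hd, h5.trans h3, ?_⟩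
    rw [undo_congr fun k _ hk => hl k hk]
    exact ih h4 (fun k hk => hl k (by omega)) (fun k hk => hs k (by simp; omega))
      fun e he => hi e (by simp [he])

theorem RepS.congr {c : ℕ} {σ σ' : St} {stk : List (ℕ × ℕ)} {it' : ℕ → ℕ}
    (h : RepS prim P Pr n T Γ it c σ stk) (hp : pm σ' c = pm σ c)
    (hc : ∀ x : CArr, x.queue = false → cv σ' T c x = cv σ T c x)
    (hi : ∀ e ∈ stk, it' e.1 = it e.1) : RepS prim P Pr n T Γ it' c σ' stk := by
  obtain ⟨⟨l, h1, h2⟩, h3, h4, h5, h6⟩ := h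
  refine ⟨⟨l, by rw [hc _ rfl, h1], ?_⟩, by rw [hc _ rfl, h3], by rw [hc _ rfl]; exact h4,
    by rw [hc _ rfl]; exact h5, h6⟩
  rw [hc .LA rfl, hc .LV rfl, hc .BND rfl, hc .STK rfl, hp]
  exact h2.congr (fun _ _ => ⟨rfl, rfl⟩) (fun _ _ => ⟨rfl, rfl⟩) hi

variable {c Q : ℕ} {σ : St} {stk : List (ℕ × ℕ)}

theorem LogStk.reach {la lv bnd st : ℕ → ℕ} {l : ℕ} {m : Memory}
    (h : LogStk prim P Pr n T Γ it la lv bnd st stk l m) :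
    P.Reach prim Pr n T ((stk.map fun e => it e.1).toFinset) m := by
  cases stk with
  | nil => obtain ⟨-, rfl⟩ := h; simpa using .start
  | cons e s => exact h.2.1

/-- Whatever was popped before, the memory of the copy is one that the incremental algorithm reaches
by inserting the items on the stack. Hence its time bound applies to the next insertion. -/
theorem spec_push (hP : P.Solves prim Pr n T Γ Q) (hE : PEnv n T it c σ) (hW : WFM T σ)
    (hR : RepS prim P Pr n T Γ it c σ stk) {k t : ℕ} (hh : σ.r (.s .h) = T * k)
    (ht : σ.r (.s .tg) = t) (hk : k ∉ stk.map Prod.fst) (hi : it k ∈ Pr.items)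
    (hk' : ∀ e ∈ stk, it e.1 ≠ it k) (hlen : stk.length < T) :
    Spec prim (push P) σ (700 * (Γ + 1)) fun σ' =>
      StkOp prim P Pr n T Γ it c σ σ' ((k, t) :: stk) ∧ Keep σ σ' := by
  obtain ⟨⟨l, hl, hlog⟩, hspa, htag, hutag, hnd⟩ := hR
  have hc := hE.lt
  have hl' : σ.a (.c .LPA) c = T * l := by rw [← cv_zero σ T, hl]
  have hspa' : σ.a (.c .SPA) c = T * stk.length := by rw [← cv_zero σ T, hspa]
  have hnot : it k ∉ (stk.map fun e => it e.1).toFinset := by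
    simp only [List.mem_toFinset, List.mem_map, not_exists, not_and]
    exact fun e he => hk' e he
  have hcard : (stk.map fun e => it e.1).toFinset.card < T :=
    (List.toFinset_card_le _).trans_lt (by simpa using hlen)
  obtain ⟨tm, m', hex, htm⟩ := (hP _ _ hlog.reach).1 _ hi hnot hcard
  have hreach := hlog.reach.ins hcard hi hnot hex
  rw [enter_pair] at hex
  apply Spec.of_wp
  simp only [push, wp_seq, wp_set, wp_put, Ex.ev_add, Ex.ev_sub, Ex.cost_sub, Ex.ev_reg, Ex.ev_get, Ex.ev_lit,
    St.setR_r, St.setA_r, St.setA_a, St.setR_a, hE.hc, hE.hT, hh, ht, hl', hspa', Arr.c.injEq,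
    reduceCtorEq, Reg.s.injEq, if_false, hE.hit, Ex.cost_add, Ex.cost_reg, Ex.cost_get, Ex.cost_lit]
  set σ₁ := (((σ.setA (.c .BND) (c + T * stk.length) (T * l)).setA (.c .STK) (c + T * stk.length)
    (T * k)).setA (.c .SPA) c (T * stk.length + T)).setA (.c .TAG) (c + T * k) (t + 1) with hσ₁
  have hW₁ : WFM T σ₁ := (((hW.setA_c ..).setA_c ..).setA_c ..).setA_c ..
  have hF₁ : Frame T c σ σ₁ := ((((Frame.refl T c σ).put hc ..).put hc ..).put_zero hc ..).put hc ..
  have hK₁ : Keep σ σ₁ := ((((Keep.refl σ).put ..).put ..).put ..).put ..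
  have hp₁ : pm σ₁ c = pm σ c := by simp [hσ₁]
  have hv₁ : ∀ x, cv σ₁ T c x = if x = .TAG then Function.update (cv σ T c .TAG) k (t + 1)
      else if x = .SPA then Function.update (cv σ T c .SPA) 0 (T * stk.length + T)
      else if x = .STK then Function.update (cv σ T c .STK) stk.length (T * k)
      else if x = .BND then Function.update (cv σ T c .BND) stk.length (T * l) else cv σ T c x := by
    intro x
    simp only [hσ₁, cv_put hc, cv_put_zero hc, reduceCtorEq, if_false]
  have hE₁ := hE.frame hF₁
  clear_value σ₁
  refine wp_wr ((((Scr.refl σ₁).setR (by decide) _).setR (by decide) _).setR (by decide) _)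
    hE₁.toEnv hW₁ (l := l) (by simp) (by simp; rfl) (by simp; rfl) fun s₂ σ₂ hs₂ h₂ => ?_
  have hE₂ := hE₁.frame h₂.frame
  have hn₂ := hE₂.hn
  rw [hn₂]
  refine wp_wr (((Scr.refl σ₂).setR (by decide) _).setR (by decide) _) hE₂.toEnv h₂.wfm
    (l := l + 1) (by simpa using h₂.lp) (by simp; rfl) (by simp; rfl) fun s₃ σ₃ hs₃ h₃ => ?_
  have hE₃ := hE₂.frame h₃.frame
  have h23 := h₂.trans h₃
  refine (spec_sim hex hE₃.toEnv h₃.wfm h₃.lp (by rw [h₃.pm, h₂.pm, hp₁])).wp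
    fun s₄ σ₄ hs₄ ⟨d, hd, h₄⟩ => ?_
  have h24 := h23.trans h₄
  have hE₄ := hE₃.frame h₄.frame
  have hlp₄ : σ₄.r (.s .lp) - σ₄.r (.k .c) = T * (l + (1 + 1 + d)) := by
    rw [h24.lp, hE₄.hc]; omega
  rw [hlp₄, hE₄.hc]
  have hv₅ : ∀ x, cv (σ₄.setA (.c .LPA) c (T * (l + (1 + 1 + d)))) T c x =
      if x = .LPA then Function.update (cv σ₄ T c .LPA) 0 (T * (l + (1 + 1 + d)))
      else cv σ₄ T c x := cv_put_zero hc _ _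
  have hv₄ : ∀ x, x ≠ .LA → x ≠ .LV → cv σ₄ T c x = cv σ₁ T c x := h24.arr
  refine ⟨by omega, ⟨?_, ⟨⟨l + (1 + 1 + d), by simp [hv₅], ?_⟩, ?_, ?_, ?_, ?_⟩, ?_, ?_⟩, ?_⟩
  · exact h₄.wfm.setA_c ..
  · simp only [hv₅, hv₄, hv₁, reduceCtorEq, if_false, if_true, ne_eq, not_false_eq_true, pm_setA_c]
    refine ⟨by simp, ?_, l, 1 + 1 + d, rfl, by omega, by simp, ?_⟩
    · rw [h₄.pm]; simpa using hreach
    · rw [h₄.pm, h24.undo, hp₁]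
      refine hlog.congr (fun j hj => ?_) (fun j hj => ?_) fun _ _ => rfl
      · have := h24.old j hj
        simpa only [hv₁, reduceCtorEq, if_false] using this
      · simp only [Function.update_of_ne hj.ne, and_self]
  · simp only [hv₅, hv₄, hv₁, reduceCtorEq, if_false, if_true, ne_eq, not_false_eq_true]
    simp [Nat.mul_add]
  · simp only [hv₅, hv₄, hv₁, reduceCtorEq, if_false, if_true, ne_eq, not_false_eq_true]
    intro e he
    rcases List.mem_cons.1 he with rfl | he
    · simp
    · rw [Function.update_of_ne, htag e he]
      intro h
      exact hk (List.mem_map.2 ⟨e, he, h⟩)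
  · simp only [hv₅, hv₄, hv₁, reduceCtorEq, if_false, if_true, ne_eq, not_false_eq_true]
    intro j hj
    simp only [List.map_cons, List.mem_cons, not_or] at hj
    rw [Function.update_of_ne hj.1, hutag j hj.2]
  · simpa using ⟨by simpa using hk, hnd⟩
  · intro x hx
    rw [hv₅, if_neg (by rintro rfl; cases hx), hv₄ x (by rintro rfl; cases hx)
      (by rintro rfl; cases hx), hv₁, if_neg (by rintro rfl; cases hx),
      if_neg (by rintro rfl; cases hx), if_neg (by rintro rfl; cases hx),
      if_neg (by rintro rfl; cases hx)]
  · exact (hF₁.trans h24.frame).put_zero hc ..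
  · exact (hK₁.trans h24.keep).put ..

/-- The log of one insertion has at most `Γ + 2` entries, and rolling it back yields exactly the
memory before that insertion, for which `LogStk` already records the rest of the history. -/
theorem spec_pop (hE : PEnv n T it c σ) (hW : WFM T σ) {e : ℕ × ℕ}
    (hR : RepS prim P Pr n T Γ it c σ (e :: stk)) :
    Spec prim pop σ (700 * (Γ + 1)) fun σ' =>
      StkOp prim P Pr n T Γ it c σ σ' stk ∧ Keep σ σ' ∧ σ'.r (.s .h) = T * e.1 ∧
        σ'.r (.s .tg) = e.2 := by
  obtain ⟨⟨l, hl, hst, -, l₀, d, rfl, hd, hbnd, hlog⟩, hspa, htag, hutag, hnd⟩ := hR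
  have hc := hE.lt
  have hl' : σ.a (.c .LPA) c = T * (l₀ + d) := by rw [← cv_zero σ T, hl]
  have hspa' : σ.a (.c .SPA) c - T = T * stk.length := by
    rw [← cv_zero σ T, hspa, List.length_cons, Nat.mul_succ, Nat.add_sub_cancel]
  have hbnd' : σ.a (.c .BND) (c + T * stk.length) = T * l₀ := hbnd
  apply Spec.of_wp
  simp only [pop, wp_seq, wp_set, wp_put, Ex.ev_add, Ex.ev_sub, Ex.ev_reg, Ex.ev_get, Ex.ev_lit,
    St.setR_r, St.setA_r, St.setA_a, St.setR_a, hE.hc, hE.hT, hl', hspa', hbnd', Arr.c.injEq,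
    reduceCtorEq, Function.update_self,
    Reg.s.injEq, if_true, if_false, Ex.cost_add, Ex.cost_reg, Ex.cost_get, Ex.cost_lit,
    Ex.cost_sub]
  set σ₁ := ((σ.setA (.c .SPA) c (T * stk.length)).setR (.s .lp) (c + T * (l₀ + d))).setA (.c .LPA)
    c (T * l₀) with hσ₁
  have hW₁ : WFM T σ₁ := ((hW.setA_c ..).setR (by decide) _).setA_c ..
  have hF₁ : Frame T c σ σ₁ := (((Frame.refl T c σ).put_zero hc ..).setS ..).put_zero hc ..
  have hK₁ : Keep σ σ₁ := (((Keep.refl σ).put ..).setS ..).put ..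
  have hp₁ : pm σ₁ c = pm σ c := by simp [hσ₁]
  have hv₁ : ∀ x, cv σ₁ T c x = if x = .LPA then Function.update (cv σ T c .LPA) 0 (T * l₀)
      else if x = .SPA then Function.update (cv σ T c .SPA) 0 (T * stk.length)
      else cv σ T c x := by
    intro x
    simp only [hσ₁, cv_setR, cv_put_zero hc, reduceCtorEq, if_false]
  have hlp₁ : σ₁.r (.s .lp) = c + T * (l₀ + d) := by simp [hσ₁]
  have hE₁ := hE.frame hF₁
  clear_value σ₁
  refine (spec_unwind hE₁.toEnv hW₁ hlp₁ (by simp [hv₁]) rfl).wp fun s₂ σ₂ hs₂ h₂ => ?_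
  have hE₂ := hE₁.frame h₂.frame
  have hv₂ : ∀ x, x ≠ .LA → x ≠ .LV → cv σ₂ T c x = cv σ₁ T c x := h₂.arr
  have hspa₂ : σ₂.a (.c .SPA) c = T * stk.length := by
    rw [← cv_zero σ₂ T, hv₂ _ (by decide) (by decide), hv₁]; simp
  have hst₂ : σ₂.a (.c .STK) (c + T * stk.length) = T * e.1 := by
    change cv σ₂ T c .STK _ = _
    rw [hv₂ _ (by decide) (by decide), hv₁]; simpa using hst
  have htag₂ : σ₂.a (.c .TAG) (c + T * e.1) = e.2 + 1 := by
    change cv σ₂ T c .TAG _ = _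
    rw [hv₂ _ (by decide) (by decide), hv₁]; simpa using htag e (by simp)
  simp only [hE₂.hc, hspa₂, hst₂, htag₂, Nat.add_sub_cancel]
  have hv₃ : ∀ x, cv (((σ₂.setR (.s .h) (T * e.1)).setR (.s .tg) e.2).setA (.c .TAG)
      (c + T * e.1) 0) T c x = if x = .TAG then Function.update (cv σ₂ T c .TAG) e.1 0
      else cv σ₂ T c x := cv_put hc _ _ _
  simp only [List.map_cons, List.nodup_cons] at hnd
  refine ⟨by omega, ⟨?_, ⟨⟨l₀, by simp [hv₃, hv₂, hv₁], ?_⟩, by simp [hv₃, hv₂, hv₁], ?_, ?_, ?_⟩,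
    ?_, ?_⟩, ?_, by simp, by simp⟩
  · exact ((h₂.wfm.setR (by decide) _).setR (by decide) _).setA_c ..
  · simp only [hv₃, hv₂, hv₁, reduceCtorEq, if_false, ne_eq, not_false_eq_true, pm_setA_c, pm_setR]
    rw [h₂.pm, hp₁]
    have h3 : undo (cv σ₁ T c .LA) (cv σ₁ T c .LV) l₀ d (pm σ c) =
        undo (cv σ T c .LA) (cv σ T c .LV) l₀ d (pm σ c) := by simp only [hv₁]; rfl
    rw [h3]
    refine hlog.congr (fun j hj => ?_) (fun j hj => ⟨rfl, rfl⟩) fun _ _ => rfl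
    have := h₂.old j hj
    simpa only [hv₁, reduceCtorEq, if_false] using this
  · simp only [hv₃, hv₂, hv₁, reduceCtorEq, if_false, if_true, ne_eq, not_false_eq_true]
    intro e' he'
    rw [Function.update_of_ne, htag e' (by simp [he'])]
    intro h
    exact hnd.1 (List.mem_map.2 ⟨e', he', h⟩)
  · simp only [hv₃, hv₂, hv₁, reduceCtorEq, if_false, if_true, ne_eq, not_false_eq_true]
    intro j hj
    rw [Function.update_apply]
    split_ifs with hje
    · rfl
    · exact hutag j (by simpa [hje] using hj)
  · exact hnd.2
  · intro x hx
    rw [hv₃, if_neg (by rintro rfl; cases hx), hv₂ x (by rintro rfl; cases hx)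
      (by rintro rfl; cases hx), hv₁, if_neg (by rintro rfl; cases hx),
      if_neg (by rintro rfl; cases hx)]
  · exact (((hF₁.trans h₂.frame).setS ..).setS ..).put hc ..
  · exact (((hK₁.trans h₂.keep).setS ..).setS ..).put ..

end Stack

/-! ### The queue of waiting items -/

section Queue

variable {ι : Type} {prim : ι → ℕ → ℕ → ℕ} {T c : ℕ} {σ : St} {cp : Cp}

/-- The queue and the phase of copy `c`. -/
structure RepQ (T c : ℕ) (σ : St) (cp : Cp) : Prop where
  -- Both lists lie in one array, `U` from `HD` to `MK` and `V` from `MK` to `TL`. When `U` is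
  -- exhausted, turning `V` into the new `U` only moves the mark.
  qu : ∃ hd, cv σ T c .HD 0 = T * hd ∧ cv σ T c .MK 0 = T * (hd + cp.U.length) ∧
    cv σ T c .TL 0 = T * (hd + cp.U.length + cp.V.length) ∧
    ∀ i x, (cp.U ++ cp.V)[i]? = some x → cv σ T c .QU (hd + i) = T * x
  ph : cv σ T c .PH 0 = cp.ph
  lv : cv σ T c .LVL 0 = cp.lv

theorem RepQ.congr {σ' : St} (h : RepQ T c σ cp)
    (hc : ∀ x : CArr, x.queue = true → cv σ' T c x = cv σ T c x) : RepQ T c σ' cp := by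
  obtain ⟨⟨hd, h1, h2, h3, h4⟩, h5, h6⟩ := h
  refine ⟨⟨hd, ?_, ?_, ?_, ?_⟩, ?_, ?_⟩ <;> rw [hc _ rfl] <;> assumption

/-- Only the queue and the phase of copy `c`, and scratch registers, have changed. -/
structure QOp (T c : ℕ) (σ σ' : St) : Prop where
  wfm : WFM T σ → WFM T σ'
  pm : pm σ' c = pm σ c
  cv : ∀ x : CArr, x.queue = false → cv σ' T c x = cv σ T c x
  frame : Frame T c σ σ'
  keep : Keep σ σ'

theorem QOp.refl (T c : ℕ) (σ : St) : QOp T c σ σ :=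
  ⟨id, rfl, fun _ _ => rfl, .refl .., .refl _⟩

theorem QOp.put {σ' : St} (h : QOp T c σ σ') (hc : c < T) {x : CArr} (hx : x.queue = true)
    (k v : ℕ) : QOp T c σ (σ'.setA (.c x) (c + T * k) v) :=
  ⟨fun hw => (h.wfm hw).setA_c .., by simpa using h.pm, fun y hy => by
    rw [cv_put hc, if_neg (by rintro rfl; rw [hx] at hy; cases hy), h.cv y hy],
    h.frame.put hc .., h.keep.put ..⟩

theorem QOp.put_zero {σ' : St} (h : QOp T c σ σ') (hc : c < T) {x : CArr} (hx : x.queue = true)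
    (v : ℕ) : QOp T c σ (σ'.setA (.c x) c v) := by
  simpa using h.put hc hx 0 v

theorem QOp.setS {σ' : St} (h : QOp T c σ σ') {x : SReg} (hx : x ≠ .next) (v : ℕ) :
    QOp T c σ (σ'.setR (.s x) v) :=
  ⟨fun hw => (h.wfm hw).setR (by simpa using hx) _, h.pm, h.cv, h.frame.setS .., h.keep.setS ..⟩

/-- Appends the handle `h` to the queue. -/
def enqueue : Cmd ι :=
  .put (.c .QU) (.k .c + .get (.c .TL) (.k .c)) (.s .h) ;;
  .put (.c .TL) (.k .c) (.get (.c .TL) (.k .c) + .k .T)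

theorem spec_enqueue (hE : Env T c σ) (hQ : RepQ T c σ cp) {x : ℕ} (hx : σ.r (.s .h) = T * x) :
    Spec prim enqueue σ 60 fun σ' => RepQ T c σ' { cp with V := cp.V ++ [x] } ∧ QOp T c σ σ' := by
  obtain ⟨⟨hd, h1, h2, h3, h4⟩, h5, h6⟩ := hQ
  have hc := hE.lt
  have h3' : σ.a (.c .TL) c = T * (hd + cp.U.length + cp.V.length) := by rw [← cv_zero σ T, h3]
  apply Spec.of_wp
  simp only [enqueue, wp_seq, wp_put, Ex.ev_add, Ex.ev_reg, Ex.ev_get, hE.hc, hE.hT, h3', hx,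
    St.setA_r, St.setA_a, reduceCtorEq, if_false, Arr.c.injEq]
  refine ⟨by simp, ⟨⟨hd, ?_, ?_, ?_, fun i y hy => ?_⟩, ?_, ?_⟩,
    ((QOp.refl T c σ).put hc rfl _ _).put_zero hc rfl _⟩ <;>
    simp only [cv_put hc, cv_put_zero hc, reduceCtorEq, if_false, if_true, h1, h2, h5, h6,
      Function.update_self]
  · simp only [List.length_append, List.length_singleton]; ring
  · simp only at hy
    rw [← List.append_assoc, List.getElem?_append] at hy
    split_ifs at hy with hi
    · rw [Function.update_of_ne, h4 i y hy]
      simp at hi; omega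
    · have : i - (cp.U ++ cp.V).length = 0 := by
        by_contra h0
        rw [List.getElem?_eq_none (by simp at h0 ⊢; omega)] at hy
        cases hy
      have hi' : hd + i = hd + cp.U.length + cp.V.length := by simp at hi this; omega
      rw [hi', Function.update_self]
      rw [this] at hy
      simp at hy
      rw [hy]

end Queue

/-! ### Deleting an item from the stack of a copy -/

section Remove

variable {ι : Type} {prim : ι → ℕ → ℕ → ℕ} {P : IncrementalAlg ι} {Pr : DynProblem}
  {n T Γ Q : ℕ} {it : ℕ → ℕ} {c : ℕ} {σ : St} {stk : List (ℕ × ℕ)}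

/-- The items on the stack can be inserted one after the other. -/
structure Okay (Pr : DynProblem) (T : ℕ) (it : ℕ → ℕ) (stk : List (ℕ × ℕ)) : Prop where
  items : ∀ e ∈ stk, it e.1 ∈ Pr.items
  inj : (stk.map fun e => it e.1).Nodup
  len : stk.length ≤ T

theorem Okay.of_mem {S : Finset ℕ} (h : ∀ e ∈ stk, e.1 ∈ S) (hnd : (stk.map Prod.fst).Nodup)
    (hi : ∀ k ∈ S, it k ∈ Pr.items) (hinj : Set.InjOn it S) (hlen : stk.length ≤ T) :
    Okay Pr T it stk := by
  refine ⟨fun e he => hi _ (h e he), ?_, hlen⟩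
  have : (stk.map fun e => it e.1) = (stk.map Prod.fst).map it := by simp
  rw [this]
  refine hnd.map_on fun x hx y hy hxy => hinj ?_ ?_ hxy
  · obtain ⟨e, he, rfl⟩ := List.mem_map.1 hx; exact h e he
  · obtain ⟨e, he, rfl⟩ := List.mem_map.1 hy; exact h e he

variable (P)

/-- Removes the item with handle `hx` from the stack of copy `c`. -/
def remove : Cmd ι :=
  .ite (.get (.c .TAG) (.k .c + .k .hx))
    (.set (.m .tp) (.lit 0) ;; pop ;;
      .while ((.s .h - .k .hx) + (.k .hx - .s .h))
        (.put (.t .TMP) (.m .tp) (.s .h) ;; .put (.t .TMPT) (.m .tp) (.s .tg) ;;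
          .set (.m .tp) (.m .tp + .lit 1) ;; pop) ;;
      .while (.m .tp)
        (.set (.m .tp) (.m .tp - .lit 1) ;; .set (.s .h) (.get (.t .TMP) (.m .tp)) ;;
          .set (.s .tg) (.get (.t .TMPT) (.m .tp)) ;; push P))
    .skip

variable {P}

theorem spec_remove_mem (hP : P.Solves prim Pr n T Γ Q) (hE : PEnv n T it c σ) (hW : WFM T σ)
    {x t : ℕ} {pre post : List (ℕ × ℕ)} (hR : RepS prim P Pr n T Γ it c σ (pre ++ (x, t) :: post))
    (hO : Okay Pr T it (pre ++ (x, t) :: post)) (hx : σ.r (.k .hx) = T * x) :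
    Spec prim (remove P) σ ((pre.length + 1) * (2000 * (Γ + 1)))
      (StkOp prim P Pr n T Γ it c σ · (pre ++ post)) := by
  have hT : 0 < T := by have := hE.lt; omega
  have hc := hE.lt
  have htag : σ.a (.c .TAG) (c + T * x) = t + 1 := hR.tagged (x, t) (by simp)
  apply Spec.of_wp
  simp only [remove, wp_ite, Ex.ev_get, Ex.ev_add, Ex.ev_reg, hE.hc, hx, htag, wp_seq, wp_set,
    Ex.ev_lit, Ex.cost_lit, Ex.cost_get, Ex.cost_add, Ex.cost_reg]
  rw [if_pos (by omega)]
  set σ₀ := σ.setR (.m .tp) 0 with hσ₀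
  have hF₀ : Frame T c σ σ₀ := (Frame.refl ..).setM ..
  have hW₀ : WFM T σ₀ := hW.setR (by decide) _
  have hR₀ : RepS prim P Pr n T Γ it c σ₀ (pre ++ (x, t) :: post) :=
    hR.congr rfl (fun _ _ => rfl) fun _ _ => rfl
  have htp₀ : σ₀.r (.m .tp) = 0 := by simp [hσ₀]
  have hq₀ : ∀ y : CArr, y.queue = true → cv σ₀ T c y = cv σ T c y := fun _ _ => rfl
  clear_value σ₀
  obtain ⟨e, r, her⟩ : ∃ e r, pre ++ (x, t) :: post = e :: r := by
    cases pre with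
    | nil => exact ⟨_, _, rfl⟩
    | cons a b => exact ⟨_, _, rfl⟩
  rw [her] at hR₀
  refine (spec_pop (hE.frame hF₀) hW₀ hR₀).wp fun s₁ σ₁ hs₁ ⟨ho₁, hk₁, hh₁, ht₁⟩ => ?_
  -- The entry `e` popped last is in the registers and not yet saved. The list `a` is the part saved
  -- in the scratch arrays, and `b` is what remained above the wanted handle before `e` was popped.
  refine wp_while (b := 1000 * (Γ + 1)) (fun k σ' => ∃ a b e r, pre = a ++ b ∧ b.length = k ∧
    b ++ (x, t) :: post = e :: r ∧ StkOp prim P Pr n T Γ it c σ σ' r ∧ σ'.r (.s .h) = T * e.1 ∧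
    σ'.r (.s .tg) = e.2 ∧ σ'.r (.m .tp) = a.length ∧
    ∀ i y, a[i]? = some y → σ'.a (.t .TMP) i = T * y.1 ∧ σ'.a (.t .TMPT) i = y.2) pre.length
    ⟨[], pre, e, r, rfl, rfl, her, ⟨ho₁.wfm, ho₁.rep, fun y hy => (ho₁.queue y hy).trans (hq₀ y hy),
      hF₀.trans ho₁.frame⟩, hh₁, ht₁, by rw [hk₁.mr, htp₀]; rfl, by simp⟩ ?_ ?_ ?_
  · rintro k σ' ⟨a, b, e, r, rfl, hb, hbr, ho, hh, ht, htp, htmp⟩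
    have hE' := hE.frame ho.frame
    have hhx : σ'.r (.k .hx) = T * x := (ho.frame.kr _).trans hx
    obtain ⟨e', b, rfl⟩ : ∃ e' b', b = e' :: b' := by
      cases b with
      | nil => simp at hb
      | cons => exact ⟨_, _, rfl⟩
    obtain ⟨rfl, rfl⟩ : e' = e ∧ b ++ (x, t) :: post = r := by simpa using hbr
    have hne : e'.1 ≠ x := by
      rintro rfl
      have h := hR.nodup
      rw [List.append_assoc, List.map_append, List.nodup_append] at h
      simpa using h.2.1
    constructor
    · simp only [Ex.ev_add, Ex.ev_sub, Ex.ev_reg, hh, hhx]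
      have : T * e'.1 ≠ T * x := fun h => hne (Nat.eq_of_mul_eq_mul_left hT h)
      omega
    · apply Spec.of_wp
      simp only [wp_seq, wp_put, wp_set, Ex.ev_reg, Ex.ev_add, Ex.ev_lit, hh, ht, htp, St.setA_r]
      set σ₂ := ((σ'.setA (.t .TMP) a.length (T * e'.1)).setA (.t .TMPT) a.length e'.2).setR
        (.m .tp) (a.length + 1) with hσ₂
      have hc₂ : ∀ y, cv σ₂ T c y = cv σ' T c y := fun y => by funext j; simp [hσ₂, cv]
      have hp₂ : ∀ c', pm σ₂ c' = pm σ' c' := fun c' => by unfold pm; simp [hσ₂]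
      have hF₂ : Frame T c σ' σ₂ := ⟨rfl, fun y => by simp [hσ₂], fun y => by simp [hσ₂],
        fun y => by simp [hσ₂], fun y => by simp [hσ₂], fun c' _ _ => hp₂ c',
        fun c' _ _ y => by funext j; simp [hσ₂, cv]⟩
      have hW₂ : WFM T σ₂ := by
        refine WFM.setR ?_ (by decide) _
        obtain ⟨ρ, ν, h1, h2, h3, h4, h5⟩ := ho.wfm
        exact ⟨ρ, ν, by simpa using h1, h2, h3, h4, by simpa using h5⟩
      have hR₂ := ho.rep.congr (hp₂ c) (fun y _ => hc₂ y) fun _ _ => rfl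
      have htp₂ : σ₂.r (.m .tp) = a.length + 1 := by simp [hσ₂]
      have htmp₂ : ∀ i y, (a ++ [e'])[i]? = some y →
          σ₂.a (.t .TMP) i = T * y.1 ∧ σ₂.a (.t .TMPT) i = y.2 := by
        intro i y hy
        rw [List.getElem?_append] at hy
        split_ifs at hy with hi
        · simpa [hσ₂, Function.update_of_ne hi.ne] using htmp i y hy
        · obtain rfl : i = a.length := by
            by_contra h0
            rw [List.getElem?_eq_none (by simp; omega)] at hy
            cases hy
          obtain rfl : e' = y := by simpa using hy
          simp [hσ₂]
      clear_value σ₂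
      obtain ⟨e₂, r₂, her₂⟩ : ∃ e r, b ++ (x, t) :: post = e :: r := by
        cases b with
        | nil => exact ⟨_, _, rfl⟩
        | cons a b => exact ⟨_, _, rfl⟩
      rw [her₂] at hR₂
      refine (spec_pop (hE'.frame hF₂) hW₂ hR₂).wp fun s₃ σ₃ hs₃ ⟨ho₃, hk₃, hh₃, ht₃⟩ => ?_
      refine ⟨by simp only [Ex.cost_lit, Ex.cost_add, Ex.cost_reg] at hs₃; linarith, a ++ [e'], b, e₂, r₂, by simp, by simpa using hb, her₂,
        ⟨ho₃.wfm, ho₃.rep, fun y hy => ?_, (ho.frame.trans hF₂).trans ho₃.frame⟩, hh₃, ht₃,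
        by simp [hk₃.mr, htp₂], fun i y hy => ?_⟩
      · rw [ho₃.queue y hy, hc₂, ho.queue y hy]
      · rw [hk₃.t, hk₃.t]; exact htmp₂ i y hy
  · rintro σ' ⟨a, b, e, r, rfl, hb, hbr, ho, hh, ht, htp, htmp⟩
    have hhx : σ'.r (.k .hx) = T * x := (ho.frame.kr _).trans hx
    obtain rfl := List.length_eq_zero_iff.1 hb
    simp only [List.nil_append, List.cons.injEq] at hbr
    obtain ⟨rfl, rfl⟩ := hbr
    simp [hh, hhx]
  · rintro s₂ σ₂ hs₂ ⟨a, b, e, r, rfl, hb, hbr, ho, hh, ht, htp, htmp⟩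
    obtain rfl := List.length_eq_zero_iff.1 hb
    simp only [List.nil_append, List.cons.injEq] at hbr
    obtain ⟨rfl, rfl⟩ := hbr
    simp only [List.append_nil] at *
    -- The saved entries are pushed back in reverse, with their old tags; `d` is the part already
    -- restored.
    refine wp_while (b := 800 * (Γ + 1)) (fun k σ' => ∃ b d, a = b ++ d ∧ b.length = k ∧
      StkOp prim P Pr n T Γ it c σ σ' (d ++ post) ∧ σ'.r (.m .tp) = k ∧
      ∀ i y, b[i]? = some y → σ'.a (.t .TMP) i = T * y.1 ∧ σ'.a (.t .TMPT) i = y.2) a.length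
      ⟨a, [], by simp, rfl, ho, htp, htmp⟩ ?_ ?_ ?_
    · rintro k σ' ⟨b, d, rfl, hb, ho, htp, htmp⟩
      have hE' := hE.frame ho.frame
      refine ⟨by simp [htp], ?_⟩
      obtain ⟨b, y, rfl⟩ : ∃ b' y, b = b' ++ [y] := by
        rcases List.eq_nil_or_concat' b with rfl | ⟨b', y, rfl⟩
        · simp at hb
        · exact ⟨_, _, rfl⟩
      obtain rfl : b.length = k := by simpa using hb
      obtain ⟨hy1, hy2⟩ := htmp b.length y (by simp)
      apply Spec.of_wp
      simp only [wp_seq, wp_set, Ex.ev_reg, Ex.ev_sub, Ex.ev_lit, Ex.ev_get, htp, St.setR_r,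
        St.setR_a, if_true, if_false, reduceCtorEq, Nat.add_sub_cancel, hy1, hy2]
      set σ₃ := ((σ'.setR (.m .tp) b.length).setR (.s .h) (T * y.1)).setR (.s .tg) y.2 with hσ₃
      have hF₃ : Frame T c σ' σ₃ := (((Frame.refl T c σ').setM ..).setS ..).setS ..
      have hW₃ : WFM T σ₃ := ((ho.wfm.setR (by decide) _).setR (by decide) _).setR (by decide) _
      have hnd := hR.nodup
      have hinj := hO.inj
      have hlen := hO.len
      simp only [List.append_assoc] at hnd hinj hlen
      refine (spec_push hP (hE'.frame hF₃) hW₃ (ho.rep.congr rfl (fun _ _ => rfl) fun _ _ => rfl)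
        (k := y.1) (t := y.2) (by simp [hσ₃]) (by simp [hσ₃]) ?_ ?_ ?_ ?_).wp
        fun s₄ σ₄ hs₄ ⟨ho₄, hk₄⟩ => ?_
      · intro hy
        rw [List.map_append, List.nodup_append] at hnd
        have := hnd.2.1
        simp only [List.singleton_append, List.map_cons, List.nodup_cons, List.map_append] at this
        refine this.1 ?_
        simp only [List.map_append, List.mem_append] at hy
        simp only [List.mem_append, List.mem_cons]
        tauto
      · exact hO.items y (by simp)
      · intro e he h
        rw [List.map_append, List.nodup_append] at hinj
        have := hinj.2.1
        simp only [List.singleton_append, List.map_cons, List.nodup_cons, List.map_append] at this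
        refine this.1 ?_
        rw [← h]
        simp only [List.mem_append, List.mem_cons] at he ⊢
        rcases he with he | he
        · exact .inl (List.mem_map.2 ⟨e, he, rfl⟩)
        · exact .inr (.inr (List.mem_map.2 ⟨e, he, rfl⟩))
      · simp at hlen ⊢; omega
      · refine ⟨by simp only [Ex.cost_lit, Ex.cost_sub, Ex.cost_get, Ex.cost_reg] at hs₄; linarith, b, y :: d, by simp, rfl, ⟨ho₄.wfm, ho₄.rep,
          fun z hz => ?_, (ho.frame.trans hF₃).trans ho₄.frame⟩, by rw [hk₄.mr]; simp [hσ₃],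
          fun i z hz => ?_⟩
        · rw [ho₄.queue z hz]; exact ho.queue z hz
        · rw [hk₄.t, hk₄.t]
          refine htmp i z ?_
          rw [List.getElem?_append_left, hz]
          exact (List.getElem?_eq_some_iff.1 hz).1
    · rintro σ' ⟨b, d, rfl, hb, ho, htp, htmp⟩
      simp [htp]
    · rintro s₃ σ₃ hs₃ ⟨b, d, rfl, hb, ho, htp, htmp⟩
      obtain rfl := List.length_eq_zero_iff.1 hb
      refine ⟨?_, ho⟩
      simp only [Ex.cost_add, Ex.cost_sub, Ex.cost_reg] at hs₂ hs₃
      set D := ([] ++ d).length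
      have h1 : D * (1000 * (Γ + 1) + (2 + 2 + 1 + (2 + 2 + 1) + 1) + 1) ≤ D * (1012 * (Γ + 1)) :=
        Nat.mul_le_mul_left _ (by omega)
      have h2 : D * (800 * (Γ + 1) + 2 + 1) ≤ D * (803 * (Γ + 1)) :=
        Nat.mul_le_mul_left _ (by omega)
      have h3 : D * (1012 * (Γ + 1)) + D * (803 * (Γ + 1)) ≤ D * (2000 * (Γ + 1)) := by
        rw [← Nat.mul_add]; exact Nat.mul_le_mul_left _ (by omega)
      rw [Nat.add_mul]
      omega

theorem spec_remove_not_mem (hE : PEnv n T it c σ) (hW : WFM T σ) {x : ℕ}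
    (hR : RepS prim P Pr n T Γ it c σ stk) (hx : σ.r (.k .hx) = T * x)
    (hn : x ∉ stk.map Prod.fst) :
    Spec prim (remove P) σ 50 (StkOp prim P Pr n T Γ it c σ · stk) := by
  have htag : σ.a (.c .TAG) (c + T * x) = 0 := hR.untagged x hn
  apply Spec.of_wp
  simp only [remove, wp_ite, Ex.ev_get, Ex.ev_add, Ex.ev_reg, hE.hc, hx, htag]
  rw [if_neg (by simp), wp_skip]
  exact ⟨by simp, hW, hR, fun _ _ => rfl, .refl ..⟩

/-- If the handle is not on the stack, the tag zero shows this at once. On a busy copy it may still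
be waiting in the queue, and is discarded there when it is examined. -/
theorem spec_remove (hP : P.Solves prim Pr n T Γ Q) (hE : PEnv n T it c σ) (hW : WFM T σ)
    {x : ℕ} (hR : RepS prim P Pr n T Γ it c σ stk) (hO : Okay Pr T it stk)
    (hx : σ.r (.k .hx) = T * x) {D : ℕ} (hD : ∀ d e, stk[d]? = some e → e.1 = x → d ≤ D) :
    Spec prim (remove P) σ ((D + 1) * (2000 * (Γ + 1)))
      (StkOp prim P Pr n T Γ it c σ · (stk.filter (·.1 ≠ x))) := by
  by_cases hm : x ∈ stk.map Prod.fst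
  · obtain ⟨⟨x', t⟩, he, rfl⟩ := List.mem_map.1 hm
    obtain ⟨pre, post, rfl⟩ := List.append_of_mem he
    have hnd := hR.nodup
    simp only [List.map_append, List.map_cons] at hnd
    have h1 := List.nodup_middle.1 hnd
    rw [List.nodup_cons, ← List.map_append] at h1
    have hf : (pre ++ (x', t) :: post).filter (·.1 ≠ x') = pre ++ post := by
      rw [List.filter_append, List.filter_cons_of_neg (by simp), ← List.filter_append,
        List.filter_eq_self]
      intro e he
      simp only [ne_eq, decide_not, Bool.not_eq_eq_eq_not, Bool.not_true, decide_eq_false_iff_not]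
      exact fun h => h1.1 (List.mem_map.2 ⟨e, he, h⟩)
    simp only [hf]
    refine (spec_remove_mem hP hE hW hR hO hx).mono (Nat.mul_le_mul_right _ ?_) fun _ h => h
    have := hD pre.length (x', t) (by simp) rfl
    omega
  · have hf : stk.filter (·.1 ≠ x) = stk := by
      rw [List.filter_eq_self]
      intro e he
      simp only [ne_eq, decide_not, Bool.not_eq_eq_eq_not, Bool.not_true, decide_eq_false_iff_not]
      exact fun h => hm (List.mem_map.2 ⟨e, he, h⟩)
    simp only [hf]
    refine (spec_remove_not_mem hE hW hR hx hm).mono ?_ fun _ h => h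
    nlinarith [Nat.zero_le (D * (Γ + 1))]

end Remove

/-! ### An elementary step on the machine -/

section Copy

variable {ι : Type} {prim : ι → ℕ → ℕ → ℕ} {P : IncrementalAlg ι} {Pr : DynProblem}
  {n T Γ Q : ℕ} {it : ℕ → ℕ} {c : ℕ} {σ : St} {cp : Cp}

variable (prim P Pr n T Γ it) in
/-- Copy `c` is represented. -/
structure RepC (c : ℕ) (σ : St) (cp : Cp) : Prop where
  stk : RepS prim P Pr n T Γ it c σ cp.stk
  q : RepQ T c σ cp

variable (prim P Pr n T Γ it) in
/-- Only copy `c` has changed, and it is now `cp`. -/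
structure CpOp (c : ℕ) (σ σ' : St) (cp : Cp) : Prop where
  wfm : WFM T σ'
  rep : RepC prim P Pr n T Γ it c σ' cp
  frame : Frame T c σ σ'

theorem RepS.qop {σ' : St} {stk : List (ℕ × ℕ)} (h : RepS prim P Pr n T Γ it c σ stk)
    (hq : QOp T c σ σ') : RepS prim P Pr n T Γ it c σ' stk :=
  h.congr hq.pm hq.cv fun _ _ => rfl

/-- Ends the first phase of a job. -/
def endPop : Cmd ι :=
  .put (.c .PH) (.k .c) (.lit 2) ;; .put (.c .MK) (.k .c) (.get (.c .TL) (.k .c))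

theorem spec_endPop (hE : Env T c σ) (hQ : RepQ T c σ cp) :
    Spec prim endPop σ 50 fun σ' =>
      RepQ T c σ' { cp with ph := 2, U := cp.U ++ cp.V, V := [] } ∧ QOp T c σ σ' := by
  obtain ⟨⟨hd, h1, h2, h3, h4⟩, h5, h6⟩ := hQ
  have hc := hE.lt
  have h3' : σ.a (.c .TL) c = T * (hd + cp.U.length + cp.V.length) := by rw [← cv_zero σ T, h3]
  apply Spec.of_wp
  simp only [endPop, wp_seq, wp_put, Ex.ev_reg, Ex.ev_get, Ex.ev_lit, hE.hc, h3',
    St.setA_r, St.setA_a, reduceCtorEq, if_false, Arr.c.injEq]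
  refine ⟨by simp, ⟨⟨hd, ?_, ?_, ?_, fun i y hy => ?_⟩, ?_, ?_⟩,
    ((QOp.refl T c σ).put_zero hc rfl _).put_zero hc rfl _⟩ <;>
    simp only [cv_put_zero hc, reduceCtorEq, if_false, if_true, h1, h3, h6,
      Function.update_self]
  · simp [add_assoc]
  · simp [add_assoc]
  · exact h4 i y (by simpa using hy)

variable (P)

/-- Examines the handle `h`. -/
def examine : Cmd ι :=
  .ite (.get (.g .ALIVE) (.s .h))
    (.ite (.get (.c .LVL) (.k .c))
      (.ite (.get (.l .LOW) (.get (.c .LVL) (.k .c) - .lit 1 + .s .h)) enqueue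
        (.set (.s .tg) (.get (.c .LVL) (.k .c)) ;; push P))
      (.set (.s .tg) (.get (.c .LVL) (.k .c)) ;; push P))
    .skip

/-- One elementary step of the reorganization of copy `c`. -/
def micro : Cmd ι :=
  .ite (.get (.c .PH) (.k .c))
    (.ite (.get (.c .PH) (.k .c) - .lit 1)
      (.ite (.get (.c .MK) (.k .c) - .get (.c .HD) (.k .c))
        (.set (.s .h) (.get (.c .QU) (.k .c + .get (.c .HD) (.k .c))) ;;
          .put (.c .HD) (.k .c) (.get (.c .HD) (.k .c) + .k .T) ;; examine P)
        (.ite (.get (.c .LVL) (.k .c))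
          (.put (.c .MK) (.k .c) (.get (.c .TL) (.k .c)) ;;
            .put (.c .LVL) (.k .c) (.get (.c .LVL) (.k .c) - .lit 1))
          (.ite (.get (.c .TL) (.k .c) - .get (.c .MK) (.k .c))
            (.put (.c .MK) (.k .c) (.get (.c .TL) (.k .c)))
            (.put (.c .PH) (.k .c) (.lit 0)))))
      (.ite (.get (.c .SPA) (.k .c))
        (.ite (.get (.c .TAG) (.k .c + .get (.c .STK) (.k .c + (.get (.c .SPA) (.k .c) - .k .T))) -
            (.get (.c .LVL) (.k .c) + .lit 1))
          endPop
          (pop ;; enqueue))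
        endPop))
    .skip

variable {P}

/-- The state knows the current items and those that are deleted next. -/
structure SEnv (T J : ℕ) (Pr : DynProblem) (it : ℕ → ℕ) (S : Finset ℕ) (L : ℕ → Finset ℕ)
    (σ : St) : Prop where
  alive : ∀ k, σ.a (.g .ALIVE) (T * k) ≠ 0 ↔ k ∈ S
  low : ∀ i < J, ∀ k, σ.a (.l .LOW) (i + T * k) ≠ 0 ↔ k ∈ L i
  items : ∀ k ∈ S, it k ∈ Pr.items
  inj : Set.InjOn it S

variable {J M : ℕ} {S : Finset ℕ} {L : ℕ → Finset ℕ}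

theorem SEnv.frame {σ' : St} (h : SEnv T J Pr it S L σ) (hf : Frame T c σ σ') :
    SEnv T J Pr it S L σ' :=
  ⟨fun k => by rw [hf.g]; exact h.alive k, fun i hi k => by rw [hf.l]; exact h.low i hi k,
    h.items, h.inj⟩

theorem spec_examine (hP : P.Solves prim Pr n T Γ Q) (hE : PEnv n T it c σ) (hW : WFM T σ)
    (hR : RepC prim P Pr n T Γ it c σ cp) (hS : SEnv T J Pr it S L σ)
    {x : ℕ} (hx : σ.r (.s .h) = T * x) (hsub : ∀ e ∈ cp.stk, e.1 ∈ S)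
    (hnx : x ∉ cp.stk.map Prod.fst) (hlen : cp.stk.length < T) (hlv : cp.lv ≤ J) :
    Spec prim (examine P) σ (800 * (Γ + 1)) (CpOp prim P Pr n T Γ it c σ ·
      (if x ∈ S then
        if cp.lv ≠ 0 ∧ x ∈ L (cp.lv - 1) then { cp with V := cp.V ++ [x] }
        else { cp with stk := (x, cp.lv) :: cp.stk }
      else cp)) := by
  have hc := hE.lt
  have hlv' : σ.a (.c .LVL) c = cp.lv := by rw [← cv_zero σ T, hR.q.lv]
  have hal : σ.a (.g .ALIVE) (T * x) ≠ 0 ↔ x ∈ S := hS.alive x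
  have hpush : ∀ t, x ∈ S → t ≤ 80 → wp prim (.set (.s .tg) (.get (.c .LVL) (.k .c)) ;; push P)
      σ t fun s σ' => s ≤ 800 * (Γ + 1) ∧
      CpOp prim P Pr n T Γ it c σ σ' { cp with stk := (x, cp.lv) :: cp.stk } := by
    intro t hxS ht
    simp only [wp_seq, wp_set, Ex.ev_get, Ex.ev_reg, hE.hc, hlv']
    have hF : Frame T c σ (σ.setR (.s .tg) cp.lv) := (Frame.refl ..).setS ..
    refine (spec_push hP (hE.frame hF) (hW.setR (by decide) _) (hR.stk.congr rfl (fun _ _ => rfl)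
      fun _ _ => rfl) (k := x) (t := cp.lv) (by simpa using hx) (by simp) hnx (hS.items x hxS)
      (fun e he h => hnx ?_) hlen).wp fun s σ' hs ⟨ho, _⟩ => ⟨?_, ho.wfm, ⟨ho.rep, ?_⟩,
        hF.trans ho.frame⟩
    · rw [← hS.inj (hsub e he) hxS h]; exact List.mem_map.2 ⟨e, he, rfl⟩
    · simp at hs; linarith
    · exact RepQ.congr (σ := σ) ⟨hR.q.qu, hR.q.ph, hR.q.lv⟩ ho.queue
  apply Spec.of_wp
  simp only [examine, wp_ite, Ex.ev_get, Ex.ev_add, Ex.ev_sub, Ex.ev_lit, Ex.ev_reg, hE.hc, hx,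
    hlv']
  by_cases hxS : x ∈ S
  · rw [if_pos (hal.2 hxS), if_pos hxS]
    by_cases h0 : cp.lv = 0
    · rw [if_neg (by simpa using h0), if_neg (by simp [h0])]
      exact hpush _ hxS (by simp)
    · rw [if_pos h0]
      have hlow := hS.low (cp.lv - 1) (by omega) x
      by_cases hl : x ∈ L (cp.lv - 1)
      · rw [if_pos (hlow.2 hl), if_pos ⟨h0, hl⟩]
        refine (spec_enqueue hE.toEnv hR.q hx).wp fun s σ' hs ⟨hq, ho⟩ => ⟨?_, ho.wfm hW,
          ⟨hR.stk.qop ho, hq⟩, ho.frame⟩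
        simp at hs; linarith
      · rw [if_neg (fun h => hl (hlow.1 h)), if_neg (by tauto)]
        exact hpush _ hxS (by simp)
  · rw [if_neg (fun h => hxS (hal.1 h)), if_neg hxS, wp_skip]
    exact ⟨by simp; linarith, hW, hR, .refl ..⟩

/-- An elementary step contains at most one push or pop and otherwise a bounded number of commands.
-/
theorem spec_micro (hP : P.Solves prim Pr n T Γ Q) (hE : PEnv n T it c σ) (hW : WFM T σ)
    (hR : RepC prim P Pr n T Γ it c σ cp) (hS : SEnv T J Pr it S L σ) (hwf : WF J M S cp)
    (hM : M ≤ T) :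
    Spec prim (micro P) σ (1000 * (Γ + 1)) (CpOp prim P Pr n T Γ it c σ · (cp.micro S L)) := by
  have hc := hE.lt
  have hT : 0 < T := by omega
  obtain ⟨⟨hd, hhd, hmk, htl, hqu⟩, hph, hlv⟩ := hR.q
  have hQ := hR.q
  have hph' : σ.a (.c .PH) c = cp.ph := by rw [← cv_zero σ T, hph]
  have hlv' : σ.a (.c .LVL) c = cp.lv := by rw [← cv_zero σ T, hlv]
  have hhd' : σ.a (.c .HD) c = T * hd := by rw [← cv_zero σ T, hhd]
  have hmk' : σ.a (.c .MK) c = T * (hd + cp.U.length) := by rw [← cv_zero σ T, hmk]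
  have htl' : σ.a (.c .TL) c = T * (hd + cp.U.length + cp.V.length) := by rw [← cv_zero σ T, htl]
  have hspa' : σ.a (.c .SPA) c = T * cp.stk.length := by rw [← cv_zero σ T, hR.stk.spa]
  apply Spec.of_wp
  simp only [micro, wp_ite, Ex.ev_get, Ex.ev_add, Ex.ev_sub, Ex.ev_lit, Ex.ev_reg, hE.hc, hph',
    hlv', hhd', hmk', htl', hspa', hE.hT, Ex.cost_get, Ex.cost_add, Ex.cost_sub, Ex.cost_lit,
    Ex.cost_reg]
  unfold Cp.micro
  by_cases h0 : cp.ph = 0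
  · rw [if_neg (by simpa using h0), if_pos h0, wp_skip]
    exact ⟨by linarith, hW, hR, .refl ..⟩
  rw [if_pos h0, if_neg h0]
  by_cases h1 : cp.ph = 1
  · rw [if_neg (by omega), if_pos h1]
    have hend : ∀ t, t ≤ 200 → wp prim endPop σ t fun s σ' => s ≤ 1000 * (Γ + 1) ∧
        CpOp prim P Pr n T Γ it c σ σ' { cp with ph := 2, U := cp.U ++ cp.V, V := [] } := by
      intro t ht
      exact (spec_endPop hE.toEnv hQ).wp fun s σ' hs ⟨hq, ho⟩ =>
        ⟨by linarith, ho.wfm hW, ⟨hR.stk.qop ho, hq⟩, ho.frame⟩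
    cases hs : cp.stk with
    | nil =>
      rw [if_neg (by simp)]
      rw [hs] at hend
      refine hend _ ?_
      norm_num
    | cons e s =>
      have hRs := hR.stk
      rw [hs] at hRs
      obtain ⟨l, -, hst, -⟩ := hRs.log
      have hst' : σ.a (.c .STK) (c + (T * (e :: s).length - T)) = T * e.1 := by
        rw [List.length_cons, Nat.mul_succ, Nat.add_sub_cancel]
        exact hst
      have htag : σ.a (.c .TAG) (c + T * e.1) = e.2 + 1 := hRs.tagged e (by simp)
      rw [if_pos (by simp; omega), hst', htag]
      simp only
      by_cases he : e.2 ≤ cp.lv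
      · rw [if_neg (by omega), if_pos he, wp_seq]
        refine (spec_pop hE hW hRs).wp fun s₁ σ₁ hs₁ ⟨ho₁, hk₁, hh₁, _⟩ => ?_
        refine (spec_enqueue (hE.frame ho₁.frame).toEnv (hQ.congr ho₁.queue) hh₁).wp
          fun s₂ σ₂ hs₂ ⟨hq, ho⟩ => ⟨by linarith, ho.wfm ho₁.wfm,
          ⟨ho₁.rep.qop ho, ⟨hq.qu, hq.ph, hq.lv⟩⟩, ho₁.frame.trans ho.frame⟩
      · rw [if_pos (by omega), if_neg he]
        rw [hs] at hend
        refine hend _ ?_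
        norm_num
  have h2 : cp.ph = 2 := by have := hwf.ph_le; omega
  rw [if_pos (by omega), if_neg h1]
  cases hU : cp.U with
  | cons x U =>
    rw [if_pos (by
      have : T * (hd + (x :: U).length) = T * hd + T * U.length + T := by simp; ring
      omega)]
    have hx : σ.a (.c .QU) (c + T * hd) = T * x := hqu 0 x (by simp [hU])
    simp only [wp_seq, wp_set, wp_put, Ex.ev_add, Ex.ev_reg, Ex.ev_get, St.setR_r, St.setR_a,
      reduceCtorEq, if_false, hE.hc, hE.hT, hhd', hx]
    set σ₁ := (σ.setR (.s .h) (T * x)).setA (.c .HD) c (T * hd + T) with hσ₁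
    have ho : QOp T c σ σ₁ := ((QOp.refl T c σ).setS (by decide) _).put_zero hc rfl _
    have hq : RepQ T c σ₁ { cp with U := U } := by
      refine ⟨⟨hd + 1, ?_, ?_, ?_, fun i y hy => ?_⟩, ?_, ?_⟩ <;>
        simp only [hσ₁, cv_put_zero hc, cv_setR, reduceCtorEq, if_false, if_true, hmk, htl, hph,
          hlv, Function.update_self]
      · ring
      · simp only [hU, List.length_cons]; ring
      · simp only [hU, List.length_cons]; ring
      · have := hqu (i + 1) y (by simpa [hU] using hy)
        rw [← this]; congr 1; omega
    have hh₁ : σ₁.r (.s .h) = T * x := by simp [hσ₁]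
    clear_value σ₁
    have hnd := hwf.nodup
    have hlen := hwf.len
    rw [hU] at hnd hlen
    refine (spec_examine (cp := { cp with U := U }) hP (hE.frame ho.frame) (ho.wfm hW) ⟨hR.stk.qop ho, hq⟩
      (hS.frame ho.frame) hh₁ hwf.sub (fun h => ?_) ?_ (hwf.lv_le h0)).wp
      fun s σ' hs ⟨h3, h4, h5⟩ => ⟨?_, h3, ?_, ho.frame.trans h5⟩
    · rw [List.nodup_append] at hnd
      exact hnd.2.2 _ h x (by simp) rfl
    · simp at hlen ⊢; omega
    · simp at hs; linarith
    · exact h4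
  | nil =>
    have hnil : (T * (hd + ([] : List ℕ).length) - T * hd) = 0 := by simp
    rw [if_neg (by simp)]
    simp only
    rw [hU] at hmk htl hqu
    simp only [List.length_nil, Nat.add_zero, List.nil_append] at hmk htl hqu
    have hpp : hd + ([] : List ℕ).length = hd := rfl
    rw [hpp]
    by_cases h3 : cp.lv = 0
    · have h3' : ¬cp.lv ≠ 0 := by simpa using h3
      rw [if_neg h3', if_neg h3']
      by_cases h4 : cp.V = []
      · rw [if_neg (by simp [h4]), if_neg (by simpa using h4), wp_put]
        have ho : QOp T c σ (σ.setA (.c .PH) c 0) := (QOp.refl T c σ).put_zero hc rfl _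
        simp only [Ex.ev_reg, Ex.ev_lit, hE.hc]
        refine ⟨by simp; linarith, ho.wfm hW, ⟨hR.stk.qop ho, ⟨hd, ?_, ?_, ?_, ?_⟩, ?_, ?_⟩,
          ho.frame⟩ <;>
          simp only [cv_put_zero hc, reduceCtorEq, if_false, if_true, hhd, hmk, htl, hlv,
            Function.update_self, List.length_nil, List.nil_append, Nat.add_zero]
        exact hqu
      · rw [if_pos (by
          have : T * (hd + cp.V.length) = T * hd + T * cp.V.length := by ring
          have : 0 < cp.V.length := List.length_pos_of_ne_nil h4
          have := Nat.mul_pos hT this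
          omega), if_pos h4, wp_put]
        simp only [Ex.ev_reg, Ex.ev_get, hE.hc, htl', hU, hpp]
        have ho : QOp T c σ (σ.setA (.c .MK) c (T * (hd + cp.V.length))) :=
          (QOp.refl T c σ).put_zero hc rfl _
        refine ⟨by simp; linarith, ho.wfm hW, ⟨hR.stk.qop ho, ⟨hd, ?_, ?_, ?_, ?_⟩, ?_, ?_⟩,
          ho.frame⟩ <;>
          simp only [cv_put_zero hc, reduceCtorEq, if_false, if_true, hhd, htl, hlv, hph,
            Function.update_self, List.length_nil, List.append_nil, Nat.add_zero]
        exact hqu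
    · rw [if_pos h3, if_pos h3]
      simp only [wp_seq, wp_put, Ex.ev_reg, Ex.ev_get, Ex.ev_sub, Ex.ev_lit, hE.hc, htl', hlv', hU,
        hpp, St.setA_r, St.setA_a, reduceCtorEq, if_false, Arr.c.injEq]
      have ho : QOp T c σ ((σ.setA (.c .MK) c (T * (hd + cp.V.length))).setA (.c .LVL) c
        (cp.lv - 1)) := ((QOp.refl T c σ).put_zero hc rfl _).put_zero hc rfl _
      refine ⟨by simp; linarith, ho.wfm hW, ⟨hR.stk.qop ho, ⟨hd, ?_, ?_, ?_, ?_⟩, ?_, ?_⟩,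
        ho.frame⟩ <;>
        simp only [cv_put_zero hc, reduceCtorEq, if_false, if_true, hhd, htl, hph,
          Function.update_self, List.length_nil, List.append_nil, Nat.add_zero]
      exact hqu

end Copy

/-! ### Tournament trees -/

section Tree

/-- Nonzero if the key `b` is strictly better than `a`: larger or smaller, according to `dir`. -/
def gap (dir : Bool) (a b : ℕ) : ℕ := if dir then b - a else a - b

/-- The better one of two entries with respect to the keys `κ`; no entry is written as `0`. -/
def join (dir : Bool) (κ : ℕ → ℕ) (a b : ℕ) : ℕ :=
  if b = 0 then a else if a = 0 then b else if gap dir (κ a) (κ b) ≠ 0 then b else a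

variable {dir : Bool} {κ : ℕ → ℕ} {T : ℕ} {F : Finset ℕ} {t : ℕ → ℕ}

theorem join_eq (dir : Bool) (κ : ℕ → ℕ) (a b : ℕ) : join dir κ a b = a ∨ join dir κ a b = b := by
  unfold join
  split_ifs <;> simp

theorem join_eq_zero {a b : ℕ} : join dir κ a b = 0 ↔ a = 0 ∧ b = 0 := by
  unfold join
  split_ifs <;> simp_all

theorem join_left {a b : ℕ} (ha : a ≠ 0) : gap dir (κ (join dir κ a b)) (κ a) = 0 := by
  unfold join gap
  split_ifs <;> simp_all <;> omega

theorem join_right {a b : ℕ} (hb : b ≠ 0) : gap dir (κ (join dir κ a b)) (κ b) = 0 := by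
  unfold join gap
  split_ifs <;> simp_all

theorem gap_trans {a b c : ℕ} (h : gap dir a b = 0) (h' : gap dir b c = 0) : gap dir a c = 0 := by
  unfold gap at *
  split_ifs at * <;> omega

/-- The entry that node `v` should have. -/
def node (dir : Bool) (κ : ℕ → ℕ) (T : ℕ) (F : Finset ℕ) (t : ℕ → ℕ) (v : ℕ) : ℕ :=
  join dir κ (join dir κ (if v ∈ F then T * v else 0) (t (2 * v))) (t (2 * v + 1))

/-- In the tree where `v` has the children `2 * v` and `2 * v + 1`, every node different from `x`
carries the best one of the elements of `F` below it. -/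
def Tree (dir : Bool) (κ : ℕ → ℕ) (T : ℕ) (F : Finset ℕ) (t : ℕ → ℕ) (x : ℕ) : Prop :=
  ∀ v, 1 ≤ v → v ≠ x → t v = node dir κ T F t v

/-- The entry required at a node depends on its two children only, so repairing `v` can spoil at
most its parent. The single defect climbs and disappears at node zero, which is outside the tree. -/
theorem Tree.step {v : ℕ} (h : Tree dir κ T F t v) :
    Tree dir κ T F (Function.update t v (node dir κ T F t v)) (v / 2) := by
  intro w hw hwv
  have h1 : 2 * w ≠ v := by omega
  have h2 : 2 * w + 1 ≠ v := by omega
  have h3 : node dir κ T F (Function.update t v (node dir κ T F t v)) w = node dir κ T F t w := by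
    rw [node, Function.update_of_ne h1, Function.update_of_ne h2, node]
  rw [h3, Function.update_apply]
  split_ifs with h3
  · rw [h3]
  · exact h w hw h3

theorem Tree.of_zero (h : Tree dir κ T F t 0) (x : ℕ) : Tree dir κ T F t x :=
  fun v hv _ => h v hv (by omega)

theorem Tree.congr {F' : Finset ℕ} {x : ℕ} (h : Tree dir κ T F t x)
    (hF : ∀ v, v ≠ x → (v ∈ F' ↔ v ∈ F)) : Tree dir κ T F' t x := by
  intro v hv hvx
  rw [h v hv hvx, node, node]
  simp only [hF v hvx]

/-- An entry comes either from the node itself or from a child. Following it downwards ends because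
there are no entries beyond `M`. -/
theorem Tree.mem {M : ℕ} (h : Tree dir κ T F t 0) (h0 : ∀ v, M < v → t v = 0) {v : ℕ} (hv : 1 ≤ v)
    (hr : t v ≠ 0) : ∃ b ∈ F, t v = T * b := by
  have key : ∀ d v, M < v + d → 1 ≤ v → t v ≠ 0 → ∃ b ∈ F, t v = T * b := by
    intro d
    induction d with
    | zero => intro v hM _ h1; exact absurd (h0 v (by omega)) h1
    | succ d ih =>
      intro v hM hv h1
      rw [h v hv (by omega)] at h1 ⊢
      unfold node at *
      rcases join_eq dir κ (join dir κ (if v ∈ F then T * v else 0) (t (2 * v)))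
        (t (2 * v + 1)) with h2 | h2
      · rw [h2] at h1 ⊢
        rcases join_eq dir κ (if v ∈ F then T * v else 0) (t (2 * v)) with h3 | h3
        · rw [h3] at h1 ⊢
          split_ifs at h1 ⊢ with h4
          · exact ⟨v, h4, rfl⟩
          · exact absurd rfl h1
        · rw [h3] at h1 ⊢
          exact ih _ (by omega) (by omega) h1
      · rw [h2] at h1 ⊢
        exact ih _ (by omega) (by omega) h1
  exact key (M + 1) v (by omega) hv hr

/-- Entries are always handles of elements of `F`, so the prediction of a new handle outside `F` can
be stored without touching the trees. -/
theorem Tree.congr_key {κ' : ℕ → ℕ} {M : ℕ} (h : Tree dir κ T F t 0) (h0 : ∀ v, M < v → t v = 0)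
    (hκ : ∀ b ∈ F, κ' (T * b) = κ (T * b)) : Tree dir κ' T F t 0 := by
  have hjoin : ∀ a b, (a ≠ 0 → κ' a = κ a) → (b ≠ 0 → κ' b = κ b) →
      join dir κ' a b = join dir κ a b := by
    intro a b ha hb
    unfold join
    split_ifs with h1 h2 h3 h4 h4 <;> simp_all
  have hent : ∀ v, 1 ≤ v → t v ≠ 0 → κ' (t v) = κ (t v) := by
    intro v hv h1
    obtain ⟨b, hb, h2⟩ := h.mem h0 hv h1
    rw [h2, hκ b hb]
  intro v hv hv0
  rw [h v hv hv0, node, node, hjoin (if v ∈ F then T * v else 0) (t (2 * v)), hjoin]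
  · intro h1
    rcases join_eq dir κ (if v ∈ F then T * v else 0) (t (2 * v)) with h2 | h2
    · rw [h2] at h1 ⊢
      split_ifs at h1 ⊢ with h3
      · exact hκ v h3
      · exact absurd rfl h1
    · rw [h2] at h1 ⊢
      exact hent _ (by omega) h1
  · exact hent _ (by omega)
  · split_ifs with h3
    · exact fun _ => hκ v h3
    · exact fun h => absurd rfl h
  · exact hent _ (by omega)

/-- Along the ancestors `u / 2 ^ e` entries only improve, and the root is reached at `e = Nat.log 2
u`. -/
theorem Tree.root_best (h : Tree dir κ T F t 0) (hT : 0 < T) {u : ℕ} (hu : u ∈ F) (h1 : 1 ≤ u) :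
    t 1 ≠ 0 ∧ gap dir (κ (t 1)) (κ (T * u)) = 0 := by
  have hne : T * u ≠ 0 := (Nat.mul_pos hT h1).ne'
  have hnode : ∀ v, 1 ≤ v → (∀ a ∈ [if v ∈ F then T * v else 0, t (2 * v), t (2 * v + 1)], a ≠ 0 →
      t v ≠ 0 ∧ gap dir (κ (t v)) (κ a) = 0) := by
    intro v hv a ha ha0
    rw [h v hv (by omega)]
    unfold node
    set b := if v ∈ F then T * v else 0
    have hl : ∀ x, join dir κ b (t (2 * v)) ≠ 0 → gap dir (κ (join dir κ b (t (2 * v)))) x = 0 →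
        join dir κ (join dir κ b (t (2 * v))) (t (2 * v + 1)) ≠ 0 ∧
        gap dir (κ (join dir κ (join dir κ b (t (2 * v))) (t (2 * v + 1)))) x = 0 := fun x hx hg =>
      ⟨fun h => hx (join_eq_zero.1 h).1, gap_trans (join_left hx) hg⟩
    simp only [List.mem_cons, List.not_mem_nil, or_false] at ha
    rcases ha with rfl | rfl | rfl
    · exact hl _ (fun h => ha0 (join_eq_zero.1 h).1) (join_left ha0)
    · exact hl _ (fun h => ha0 (join_eq_zero.1 h).2) (join_right ha0)
    · exact ⟨fun h => ha0 (join_eq_zero.1 h).2, join_right ha0⟩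
  have key : ∀ e, 1 ≤ u / 2 ^ e → t (u / 2 ^ e) ≠ 0 ∧ gap dir (κ (t (u / 2 ^ e))) (κ (T * u)) = 0 := by
    intro e
    induction e with
    | zero =>
      intro _
      rw [pow_zero, Nat.div_one]
      exact hnode u h1 (T * u) (by simp [hu]) hne
    | succ e ih =>
      intro hv
      rw [pow_succ, ← Nat.div_div_eq_div_mul] at hv ⊢
      set w := u / 2 ^ e
      obtain ⟨h2, h3⟩ := ih (by omega)
      obtain ⟨h4, h5⟩ := hnode (w / 2) hv (t w) (by
        have : w = 2 * (w / 2) ∨ w = 2 * (w / 2) + 1 := by omega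
        simp only [List.mem_cons]
        rcases this with h | h
        · exact .inr (.inl (congrArg t h))
        · exact .inr (.inr (.inl (congrArg t h)))) h2
      exact ⟨h4, gap_trans h5 h3⟩
  have hu1 : u / 2 ^ Nat.log 2 u = 1 := by
    refine Nat.div_eq_of_lt_le ?_ ?_
    · rw [one_mul]; exact Nat.pow_log_le_self 2 (by omega)
    · have := Nat.lt_pow_succ_log_self (b := 2) (by norm_num) u
      rw [pow_succ] at this; omega
  have := key (Nat.log 2 u) (by rw [hu1])
  rwa [hu1] at this

end Tree

/-! ### The items that are deleted next -/

/-- `L` consists of the `K` items with the smallest predictions. -/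
structure Lev (K : ℕ) (S : Finset ℕ) (pr : ℕ → ℕ) (L : Finset ℕ) : Prop where
  sub : L ⊆ S
  card : L.card ≤ K
  full : L.card < K → L = S
  ord : ∀ y ∈ L, ∀ z ∈ S, z ∉ L → pr y ≤ pr z

section Lev

variable {K : ℕ} {S L : Finset ℕ} {pr pr' : ℕ → ℕ} {x y : ℕ}

/-- An item is excluded only if the set is full, and then all `K` members are predicted to be
deleted no later. -/
theorem Lev.out (h : Lev K S pr L) {z : ℕ} (hz : z ∈ S) (hzL : z ∉ L) : K ≤ rank S pr z := by
  have h1 : L.card = K := by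
    rcases lt_or_ge L.card K with h1 | h1
    · exact absurd (h.full h1 ▸ hz) hzL
    · exact le_antisymm h.card h1
  rw [← h1, rank]
  refine Finset.card_le_card fun y hy => ?_
  rw [Finset.mem_filter, Finset.mem_erase]
  exact ⟨⟨fun h' => hzL (h' ▸ hy), h.sub hy⟩, h.ord y hy z hz hzL⟩

theorem Lev.insert_le (h : Lev K S pr L) (hx : x ∉ S) (hK : (insert x L).card ≤ K) :
    Lev K (insert x S) pr' (insert x L) := by
  have hxL : x ∉ L := fun h' => hx (h.sub h')
  rw [Finset.card_insert_of_notMem hxL] at hK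
  obtain rfl := h.full (by omega)
  exact ⟨le_rfl, by rw [Finset.card_insert_of_notMem hxL]; exact hK, fun _ => rfl,
    fun y _ z h1 h2 => absurd h1 h2⟩

theorem Lev.insert_gt (h : Lev K S pr L) (hx : x ∉ S) (hp : ∀ z ∈ S, pr' z = pr z)
    (hK : K < (insert x L).card) (hy : y ∈ insert x L) (hm : ∀ z ∈ insert x L, pr' z ≤ pr' y) :
    Lev K (insert x S) pr' ((insert x L).erase y) := by
  have hxL : x ∉ L := fun h' => hx (h.sub h')
  have hcard : ((insert x L).erase y).card = K := by
    have := h.card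
    rw [Finset.card_insert_of_notMem hxL] at hK
    rw [Finset.card_erase_of_mem hy, Finset.card_insert_of_notMem hxL]; omega
  refine ⟨fun z hz => ?_, hcard.le, fun h' => by omega, fun a ha z hz hzL => ?_⟩
  · simp only [Finset.mem_erase, Finset.mem_insert] at hz ⊢
    exact hz.2.imp id fun h' => h.sub h'
  · rcases eq_or_ne z y with rfl | hzy
    · exact hm a (Finset.mem_of_mem_erase ha)
    · have hz1 : z ∉ insert x L := fun h' => hzL (Finset.mem_erase.2 ⟨hzy, h'⟩)
      simp only [Finset.mem_erase, Finset.mem_insert, not_or] at ha hz hz1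
      have hzS : z ∈ S := hz.resolve_left hz1.1
      have hold : ∀ b ∈ L, pr' b ≤ pr' z := fun b hb => by
        rw [hp b (h.sub hb), hp z hzS]; exact h.ord b hb z hzS hz1.2
      -- If the new item stays, an old member `y` was evicted; its prediction lies between those of
      -- the new item and of any outsider.
      rcases ha.2 with rfl | haL
      · have hyL : y ∈ L := (Finset.mem_insert.1 hy).resolve_left (Ne.symm ha.1)
        exact (hm a (Finset.mem_insert_self ..)).trans (hold y hyL)
      · exact hold a haL

theorem Lev.erase_of_notMem (h : Lev K S pr L) (hx : x ∈ S) (hxL : x ∉ L) :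
    Lev K (S.erase x) pr L ∧ L.card = K := by
  have h1 : L.card = K := by
    rcases lt_or_ge L.card K with h1 | h1
    · exact absurd (h.full h1 ▸ hx) hxL
    · exact le_antisymm h.card h1
  refine ⟨⟨fun z hz => Finset.mem_erase.2 ⟨fun h' => hxL (h' ▸ hz), h.sub hz⟩, h.card,
    fun h' => by omega, fun y hy z hz => h.ord y hy z (Finset.mem_of_mem_erase hz)⟩, h1⟩

theorem Lev.erase_eq (h : Lev K S pr L) (hS : S.erase x ⊆ L.erase x) :
    Lev K (S.erase x) pr (L.erase x) := by
  have : L.erase x = S.erase x := (Finset.erase_subset_erase x h.sub).antisymm hS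
  rw [this]
  refine ⟨le_rfl, ?_, fun _ => rfl, fun y _ z h1 h2 => absurd h1 h2⟩
  rw [← this]
  exact (Finset.card_le_card (Finset.erase_subset ..)).trans h.card

theorem Lev.erase_insert (h : Lev K S pr L) (hxL : x ∈ L) (hy : y ∈ S.erase x)
    (hyL : y ∉ L.erase x) (hm : ∀ z ∈ S.erase x, z ∉ L.erase x → pr y ≤ pr z) :
    Lev K (S.erase x) pr (insert y (L.erase x)) := by
  have hyL' : y ∉ L := fun h' => hyL (Finset.mem_erase.2 ⟨(Finset.mem_erase.1 hy).1, h'⟩)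
  have hcard : (insert y (L.erase x)).card = L.card := by
    rw [Finset.card_insert_of_notMem hyL, Finset.card_erase_of_mem hxL]
    have := Finset.card_pos.2 ⟨x, hxL⟩
    omega
  refine ⟨fun z hz => ?_, hcard ▸ h.card, fun h' => ?_, fun a ha z hz hzL => ?_⟩
  · rcases Finset.mem_insert.1 hz with rfl | hz
    · exact hy
    · exact Finset.erase_subset_erase x h.sub hz
  · rw [hcard] at h'
    exact absurd (h.full h' ▸ Finset.mem_of_mem_erase hy) hyL'
  · simp only [Finset.mem_insert, not_or] at ha hzL
    rcases ha with rfl | ha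
    · exact hm z hz hzL.2
    · refine h.ord a (Finset.mem_of_mem_erase ha) z (Finset.mem_of_mem_erase hz) fun h' => ?_
      exact hzL.2 (Finset.mem_erase.2 ⟨(Finset.mem_erase.1 hz).1, h'⟩)

end Lev

section

variable {ι : Type} {prim : ι → ℕ → ℕ → ℕ}

/-- A loop with a bound for the number of iterations. -/
theorem wp_while_le {e : Ex} {p : Cmd ι} {σ : St} {t b : ℕ} {Q : ℕ → St → Prop}
    (I : ℕ → St → Prop) (k : ℕ) (h0 : I k σ)
    (hstep : ∀ k σ, I k σ → e.ev σ ≠ 0 → ∃ j, k = j + 1 ∧ Spec prim p σ b (I j))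
    (hq : ∀ s σ', s ≤ t + (k * (b + e.cost + 1) + e.cost + 1) → e.ev σ' = 0 → (∃ j, I j σ') →
      Q s σ') :
    wp prim (.while e p) σ t Q := by
  have key : ∀ k σ, I k σ → ∃ s σ', Cmd.Run prim (.while e p) σ s σ' ∧
      s ≤ k * (b + e.cost + 1) + e.cost + 1 ∧ e.ev σ' = 0 ∧ ∃ j, I j σ' := by
    intro k
    induction k with
    | zero =>
      intro σ h
      by_cases hc : e.ev σ = 0
      · exact ⟨_, _, .while_false hc, by omega, hc, _, h⟩
      · obtain ⟨j, hj, -⟩ := hstep _ _ h hc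
        omega
    | succ k ih =>
      intro σ h
      by_cases hc : e.ev σ = 0
      · exact ⟨_, _, .while_false hc, by omega, hc, _, h⟩
      obtain ⟨j, hj, s, σ₁, hr, hs, hI⟩ := hstep _ _ h hc
      obtain rfl : k = j := by omega
      obtain ⟨s', σ', hr', hs', hI'⟩ := ih σ₁ hI
      refine ⟨_, _, .while_true hc hr hr', ?_, hI'⟩
      rw [Nat.succ_mul]; omega
  obtain ⟨s, σ', hr, hs, hI⟩ := key k σ h0
  exact ⟨s, σ', hr, hq _ _ (by omega) hI.1 hI.2⟩

theorem St.setR_self {σ : St} {x : Reg} {v : ℕ} (h : σ.r x = v) : σ.setR x v = σ := by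
  subst h
  cases σ with
  | mk io r a =>
    simp only [St.setR, St.mk.injEq, true_and, and_true]
    funext y
    split_ifs with hy
    · rw [hy]
    · rfl

end

/-! ### Operations on a level -/

/-- Row `i` of the array `x`. -/
def lv (σ : St) (T i : ℕ) (x : LArr) (k : ℕ) : ℕ := σ.a (.l x) (i + T * k)

/-- Only row `i`, scratch registers and scratch arrays may have changed. -/
structure LFrame (T i : ℕ) (σ σ' : St) : Prop where
  io : σ'.io = σ.io
  kr : ∀ x, σ'.r (.k x) = σ.r (.k x)
  next : σ'.r (.s .next) = σ.r (.s .next)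
  c : ∀ x, σ'.a (.c x) = σ.a (.c x)
  g : ∀ x, σ'.a (.g x) = σ.a (.g x)
  b : ∀ x, σ'.a (.b x) = σ.a (.b x)
  m : ∀ x, σ'.a (.m x) = σ.a (.m x)
  lv : ∀ i' < T, i' ≠ i → ∀ x, lv σ' T i' x = lv σ T i' x
  zc : σ'.a (.l .ZC) = σ.a (.l .ZC)
  cc : σ'.a (.l .CC) = σ.a (.l .CC)

theorem LFrame.refl (T i : ℕ) (σ : St) : LFrame T i σ σ :=
  ⟨rfl, fun _ => rfl, rfl, fun _ => rfl, fun _ => rfl, fun _ => rfl, fun _ => rfl,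
    fun _ _ _ _ => rfl, rfl, rfl⟩

theorem LFrame.trans {T i : ℕ} {σ₁ σ₂ σ₃ : St} (h : LFrame T i σ₁ σ₂) (h' : LFrame T i σ₂ σ₃) :
    LFrame T i σ₁ σ₃ :=
  ⟨h'.io.trans h.io, fun x => (h'.kr x).trans (h.kr x), h'.next.trans h.next,
    fun x => (h'.c x).trans (h.c x), fun x => (h'.g x).trans (h.g x),
    fun x => (h'.b x).trans (h.b x), fun x => (h'.m x).trans (h.m x),
    fun i' h1 h2 x => (h'.lv i' h1 h2 x).trans (h.lv i' h1 h2 x), h'.zc.trans h.zc,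
    h'.cc.trans h.cc⟩

/-- The arrays of the level that the level operations change. -/
def LArr.own : LArr → Bool
  | .LOW | .MAXT | .MINT | .LSZ => true
  | _ => false

section Level

variable {ι : Type} {prim : ι → ℕ → ℕ → ℕ} {T i M : ℕ} {σ σ' : St}

@[simp] theorem lv_setR (σ : St) (x : Reg) (v T i : ℕ) (y : LArr) :
    lv (σ.setR x v) T i y = lv σ T i y := rfl

theorem lv_put (hi : i < T) (x : LArr) (k v : ℕ) (y : LArr) :
    lv (σ.setA (.l x) (i + T * k) v) T i y =
      if y = x then Function.update (lv σ T i x) k v else lv σ T i y := by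
  funext j
  by_cases hy : y = x
  · subst hy
    simp only [lv, St.setA_a, if_true, Function.update_apply]
    by_cases hj : j = k
    · simp [hj]
    · rw [if_neg hj, if_neg fun h => hj ((idx_inj hi hi).1 h).2]
  · simp [lv, hy]

theorem lv_put_zero (hi : i < T) (x : LArr) (v : ℕ) (y : LArr) :
    lv (σ.setA (.l x) i v) T i y =
      if y = x then Function.update (lv σ T i x) 0 v else lv σ T i y := by
  simpa using lv_put (σ := σ) hi x 0 v y

theorem lv_zero (σ : St) (T i : ℕ) (x : LArr) : lv σ T i x 0 = σ.a (.l x) i := by simp [lv]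

theorem LFrame.put (h : LFrame T i σ σ') (hi : i < T) {x : LArr} (hx : x.own = true) (k v : ℕ) :
    LFrame T i σ (σ'.setA (.l x) (i + T * k) v) := by
  refine ⟨h.io, h.kr, h.next, fun y => by simpa using h.c y, fun y => by simpa using h.g y,
    fun y => by simpa using h.b y, fun y => by simpa using h.m y, fun i' h1 h2 y => ?_, ?_, ?_⟩
  · rw [← h.lv i' h1 h2]
    funext j
    by_cases hy : y = x
    · subst hy
      simp only [RamDyn.lv, St.setA_a, if_true, Function.update_apply]
      rw [if_neg fun h => h2 ((idx_inj h1 hi).1 h).1]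
    · simp [RamDyn.lv, hy]
  · simp only [St.setA_a, Arr.l.injEq]
    rw [if_neg (by rintro rfl; cases hx), h.zc]
  · simp only [St.setA_a, Arr.l.injEq]
    rw [if_neg (by rintro rfl; cases hx), h.cc]

theorem LFrame.put_zero (h : LFrame T i σ σ') (hi : i < T) {x : LArr} (hx : x.own = true) (v : ℕ) :
    LFrame T i σ (σ'.setA (.l x) i v) := by
  simpa using h.put hi hx 0 v

theorem LFrame.setS (h : LFrame T i σ σ') {x : SReg} (hx : x ≠ .next) (v : ℕ) :
    LFrame T i σ (σ'.setR (.s x) v) :=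
  ⟨h.io, fun y => by simpa using h.kr y, by simpa [hx.symm] using h.next, h.c, h.g, h.b, h.m, h.lv,
    h.zc, h.cc⟩

theorem LFrame.setM (h : LFrame T i σ σ') (x : MReg) (v : ℕ) : LFrame T i σ (σ'.setR (.m x) v) :=
  ⟨h.io, fun y => by simpa using h.kr y, by simpa using h.next, h.c, h.g, h.b, h.m, h.lv, h.zc, h.cc⟩

/-- The data that the operations on level `i` rely on. -/
structure LEnv (T M i : ℕ) (κ : ℕ → ℕ) (S : Finset ℕ) (σ : St) : Prop where
  hT : σ.r (.k .T) = T
  hi : σ.r (.k .i) = i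
  lt : i < T
  pred : σ.a (.g .PRED) = κ
  alive : ∀ k, σ.a (.g .ALIVE) (T * k) = if k ∈ S then 1 else 0
  par : ∀ v, 1 ≤ v → v ≤ M → σ.a (.g .PAR) (T * v) = T * (v / 2)

variable {κ : ℕ → ℕ} {S L F : Finset ℕ}

theorem LEnv.frame {j : ℕ} (h : LEnv T M i κ S σ) (hf : LFrame T j σ σ') : LEnv T M i κ S σ' :=
  ⟨(hf.kr _).trans h.hT, (hf.kr _).trans h.hi, h.lt, (hf.g _).trans h.pred,
    by rw [hf.g]; exact h.alive, by rw [hf.g]; exact h.par⟩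

/-- The array of the tournament tree that looks for the largest or the smallest key. -/
def treeArr (dir : Bool) : LArr := if dir then .MAXT else .MINT

/-- Tells whether the handle `vv` takes part in the tournament. -/
def memE (dir : Bool) : Ex :=
  if dir then .get (.l .LOW) (.k .i + .m .vv)
  else .get (.g .ALIVE) (.m .vv) - .get (.l .LOW) (.k .i + .m .vv)

/-- Replaces `rc` by the value of `e` if that is a better entry. -/
def joinC (dir : Bool) (e : Ex) : Cmd ι :=
  .set (.s .rb) e ;;
  .ite (.s .rb)
    (.ite (.s .rc)
      (.ite (if dir then .get (.g .PRED) (.s .rb) - .get (.g .PRED) (.s .rc)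
          else .get (.g .PRED) (.s .rc) - .get (.g .PRED) (.s .rb))
        (.set (.s .rc) (.s .rb)) .skip)
      (.set (.s .rc) (.s .rb)))
    .skip

theorem wp_joinC {dir : Bool} {e : Ex} {t : ℕ} {Q : ℕ → St → Prop}
    (hq : ∀ s, s ≤ t + (e.cost + 50) → Q s ((σ.setR (.s .rb) (e.ev σ)).setR (.s .rc)
      (join dir (σ.a (.g .PRED)) (σ.r (.s .rc)) (e.ev σ)))) : wp prim (joinC dir e) σ t Q := by
  simp only [joinC, wp_seq, wp_set, wp_ite, wp_skip, Ex.ev_reg, St.setR_r, reduceCtorEq,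
    Reg.s.injEq, if_true, if_false]
  have hself : (σ.setR (.s .rb) (e.ev σ)).setR (.s .rc) (σ.r (.s .rc)) = σ.setR (.s .rb) (e.ev σ) :=
    St.setR_self (by simp)
  unfold join at hq
  cases dir
  · simp only [Bool.false_eq_true, if_false, Ex.ev_sub, Ex.ev_get, Ex.ev_reg, St.setR_r, St.setR_a,
      reduceCtorEq, Reg.s.injEq, if_true, gap] at hq ⊢
    split_ifs at hq ⊢ with h1 h2 h3 <;>
      first
      | (rw [hself] at hq; exact hq _ (by simp; omega))
      | exact hq _ (by simp; omega)
      | omega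
  · simp only [if_true, Ex.ev_sub, Ex.ev_get, Ex.ev_reg, St.setR_r, St.setR_a,
      reduceCtorEq, Reg.s.injEq, if_false, gap] at hq ⊢
    split_ifs at hq ⊢ with h1 h2 h3 <;>
      first
      | (rw [hself] at hq; exact hq _ (by simp; omega))
      | exact hq _ (by simp; omega)
      | omega

/-- Recomputes the entries of the tree on the path from `vv` to the root. -/
def refresh (dir : Bool) : Cmd ι :=
  .while (.m .vv)
    (.ite (memE dir) (.set (.s .rc) (.m .vv)) (.set (.s .rc) (.lit 0)) ;;
      joinC dir (.get (.l (treeArr dir)) (.k .i + (.m .vv + .m .vv))) ;;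
      joinC dir (.get (.l (treeArr dir)) (.k .i + (.m .vv + .m .vv + .k .T))) ;;
      .put (.l (treeArr dir)) (.k .i + .m .vv) (.s .rc) ;;
      .set (.m .vv) (.get (.g .PAR) (.m .vv)))

/-- Only row `i` of the array `x` and scratch registers have changed. -/
structure ROp (T i : ℕ) (x : LArr) (σ σ' : St) : Prop where
  frame : LFrame T i σ σ'
  lv : ∀ y, y ≠ x → lv σ' T i y = lv σ T i y
  hh : σ'.r (.m .hh) = σ.r (.m .hh)

theorem ROp.refl (T i : ℕ) (x : LArr) (σ : St) : ROp T i x σ σ := ⟨.refl .., fun _ _ => rfl, rfl⟩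

theorem treeArr_own (dir : Bool) : (treeArr dir).own = true := by cases dir <;> rfl

/-- The loop follows the table of parents, so no division is needed; `y < 2 ^ N` bounds the number
of rounds by `N`. -/
theorem spec_refresh {dir : Bool} (hE : LEnv T M i κ S σ)
    (hlow : ∀ k, lv σ T i .LOW k = if k ∈ L then 1 else 0) {y N : ℕ} (hv : σ.r (.m .vv) = T * y)
    (hy : y ≤ M) (hyN : y < 2 ^ N)
    (ht : Tree dir κ T (if dir then L else S \ L) (lv σ T i (treeArr dir)) y)
    (h0 : ∀ v, M < v → lv σ T i (treeArr dir) v = 0) :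
    Spec prim (refresh dir) σ (300 * (N + 1)) fun σ' =>
      Tree dir κ T (if dir then L else S \ L) (lv σ' T i (treeArr dir)) 0 ∧
      (∀ v, M < v → lv σ' T i (treeArr dir) v = 0) ∧ ROp T i (treeArr dir) σ σ' := by
  have hT : 0 < T := by have := hE.lt; omega
  have hi := hE.lt
  apply Spec.of_wp
  refine wp_while_le (b := 260) (fun k σ' => ∃ v, σ'.r (.m .vv) = T * v ∧ v < 2 ^ k ∧ v ≤ M ∧
    Tree dir κ T (if dir then L else S \ L) (lv σ' T i (treeArr dir)) v ∧
    (∀ v, M < v → lv σ' T i (treeArr dir) v = 0) ∧ ROp T i (treeArr dir) σ σ') N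
    ⟨y, hv, hyN, hy, ht, h0, .refl ..⟩ ?_ ?_
  · rintro k σ' ⟨v, hv, hvk, hvM, ht, h0, ho⟩ hne
    rw [Ex.ev_reg, hv] at hne
    have hv1 : 1 ≤ v := by
      rcases Nat.eq_zero_or_pos v with rfl | h
      · simp at hne
      · exact h
    obtain ⟨j, rfl⟩ : ∃ j, k = j + 1 := by
      cases k with
      | zero => simp at hvk; omega
      | succ j => exact ⟨j, rfl⟩
    have hE' := hE.frame ho.frame
    have hmem : (memE dir).ev σ' ≠ 0 ↔ v ∈ if dir then L else S \ L := by
      have hl : σ'.a (.l .LOW) (i + T * v) = if v ∈ L then 1 else 0 := by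
        change lv σ' T i .LOW v = _
        rw [ho.lv _ (by cases dir <;> decide), hlow]
      cases dir
      · simp only [memE, Bool.false_eq_true, if_false, Ex.ev_sub, Ex.ev_get, Ex.ev_add, Ex.ev_reg,
          hv, hE'.hi, hE'.alive, hl, Finset.mem_sdiff]
        split_ifs <;> simp_all
      · simp only [memE, if_true, Ex.ev_get, Ex.ev_add, Ex.ev_reg, hv, hE'.hi, hl]
        split_ifs <;> simp_all
    have hcost : (memE dir).cost ≤ 30 := by cases dir <;> simp [memE]
    refine ⟨j, rfl, Spec.of_wp ?_⟩
    have h1 : wp prim (.ite (memE dir) (.set (.s .rc) (.m .vv)) (.set (.s .rc) (.lit 0))) σ' 0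
        fun s σ'' => s ≤ 40 ∧ σ'' = σ'.setR (.s .rc)
          (if v ∈ (if dir then L else S \ L) then T * v else 0) := by
      simp only [wp_ite, wp_set, Ex.ev_reg, Ex.ev_lit, hv]
      by_cases hvF : v ∈ if dir then L else S \ L
      · rw [if_pos (hmem.2 hvF), if_pos hvF]
        exact ⟨by simp; omega, rfl⟩
      · rw [if_neg (fun h => hvF (hmem.1 h)), if_neg hvF]
        exact ⟨by simp; omega, rfl⟩
    rw [wp_seq]
    obtain ⟨s₁, σ₁, hr₁, hs₁, rfl⟩ := h1
    refine ⟨s₁, _, hr₁, ?_⟩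
    simp only [wp_seq]
    refine wp_joinC fun s₂ hs₂ => ?_
    refine wp_joinC fun s₃ hs₃ => ?_
    simp only [wp_put, wp_set, Ex.ev_reg, Ex.ev_add, Ex.ev_get, St.setR_r, St.setR_a,
      St.setA_r, St.setA_a, hv, hE'.hi, hE'.hT, reduceCtorEq, Reg.s.injEq, if_true, if_false,
      hE'.par v hv1 hvM, hE'.pred]
    have h2 : T * v + T * v = T * (2 * v) := by ring
    have h3 : T * (2 * v) + T = T * (2 * v + 1) := by ring
    simp only [h2, h3]
    have hnode := ht.step
    refine ⟨by simp at hs₂ hs₃ ⊢; omega, v / 2, by simp, ?_, by omega, ?_, fun w hw => ?_, ?_, ?_,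
      ?_⟩
    · rw [pow_succ] at hvk; omega
    · simp only [lv_setR, lv_put hi, if_true]
      exact hnode
    · simp only [lv_setR, lv_put hi, if_true]
      rw [Function.update_of_ne (by omega), h0 w hw]
    · exact ((((((ho.frame.setS (by decide) _).setS (by decide) _).setS (by decide) _).setS
        (by decide) _).setS (by decide) _).put hi (treeArr_own _) _ _).setM ..
    · intro x hx
      simp only [lv_setR, lv_put hi, if_neg hx]
      exact ho.lv x hx
    · simp [ho.hh]
  · rintro s σ' hs hz ⟨k, v, hv, hvk, hvM, ht, h0, ho⟩
    rw [Ex.ev_reg, hv] at hz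
    obtain rfl : v = 0 := by
      rcases Nat.mul_eq_zero.1 hz with h | h
      · omega
      · exact h
    refine ⟨?_, ht, h0, ho⟩
    simp only [Ex.cost_reg] at hs
    linarith

end Level

/-! ### Updating the set of a level -/

section Level

variable {ι : Type} {prim : ι → ℕ → ℕ → ℕ} {T i M N : ℕ} {σ σ' : St} {κ : ℕ → ℕ} {S L : Finset ℕ}

/-- Level `i` holds the set `L`; the trees are correct except perhaps at node `x`. -/
structure RepL (T M i : ℕ) (κ : ℕ → ℕ) (S L : Finset ℕ) (σ : St) (x : ℕ) : Prop where
  low : ∀ k, lv σ T i .LOW k = if k ∈ L then 1 else 0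
  sz : lv σ T i .LSZ 0 = L.card
  tree : ∀ dir, Tree dir κ T (if dir then L else S \ L) (lv σ T i (treeArr dir)) x
  supp : ∀ dir v, M < v → lv σ T i (treeArr dir) v = 0

theorem RepL.congr {x : ℕ} (h : RepL T M i κ S L σ x) (hl : ∀ y, lv σ' T i y = lv σ T i y) :
    RepL T M i κ S L σ' x :=
  ⟨by rw [hl]; exact h.low, by rw [hl]; exact h.sz, fun dir => by rw [hl]; exact h.tree dir,
    fun dir => by rw [hl]; exact h.supp dir⟩

/-- Recomputes both trees along the path from `hh`. -/
def refreshBoth : Cmd ι :=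
  .set (.m .vv) (.m .hh) ;; refresh true ;; .set (.m .vv) (.m .hh) ;; refresh false

theorem spec_refreshBoth (hE : LEnv T M i κ S σ) (hM : M < 2 ^ N) {y : ℕ}
    (hR : RepL T M i κ S L σ y) (hh : σ.r (.m .hh) = T * y) (hy : y ≤ M) :
    Spec prim refreshBoth σ (650 * (N + 1)) fun σ' =>
      RepL T M i κ S L σ' 0 ∧ LFrame T i σ σ' := by
  apply Spec.of_wp
  simp only [refreshBoth, wp_seq, wp_set, Ex.ev_reg, Ex.cost_reg]
  have hF₁ : LFrame T i σ (σ.setR (.m .vv) (σ.r (.m .hh))) := (LFrame.refl ..).setM ..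
  refine (spec_refresh (dir := true) (hE.frame hF₁) (L := L) hR.low (N := N) (y := y) (by simp [hh])
    hy (by omega) (hR.tree true) (hR.supp true)).wp fun s₂ σ₂ hs₂ ⟨ht₂, h0₂, ho₂⟩ => ?_
  have hF₂ := hF₁.trans ho₂.frame
  have hF₃ : LFrame T i σ (σ₂.setR (.m .vv) (σ₂.r (.m .hh))) := hF₂.setM ..
  have hl₂ : ∀ x, x ≠ .MAXT → lv σ₂ T i x = lv σ T i x := ho₂.lv
  have hh₂ : σ₂.r (.m .hh) = T * y := by rw [ho₂.hh]; simp [hh]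
  refine (spec_refresh (dir := false) (hE.frame hF₃) (L := L) (N := N) (y := y) ?_ (by simp [hh₂])
    hy (by omega) ?_ ?_).wp fun s₄ σ₄ hs₄ ⟨ht₄, h0₄, ho₄⟩ => ⟨by linarith, ?_, hF₃.trans ho₄.frame⟩
  · simp only [lv_setR, hl₂ .LOW (by decide)]; exact hR.low
  · have := hR.tree false
    rw [← hl₂ _ (by decide)] at this
    exact this
  · have := hR.supp false
    rw [← hl₂ _ (by decide)] at this
    exact this
  · have hl₄ : ∀ x, x ≠ .MINT → lv σ₄ T i x = lv σ₂ T i x := ho₄.lv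
    refine ⟨?_, ?_, fun dir => ?_, fun dir => ?_⟩
    · rw [hl₄ _ (by decide), hl₂ _ (by decide)]; exact hR.low
    · rw [hl₄ _ (by decide), hl₂ _ (by decide)]; exact hR.sz
    · cases dir
      · exact ht₄
      · have : treeArr true ≠ .MINT := by decide
        rw [hl₄ _ this]; exact ht₂
    · cases dir
      · exact h0₄
      · have : treeArr true ≠ .MINT := by decide
        rw [hl₄ _ this]; exact h0₂

/-- Puts the handle `hh` into the set of the level. -/
def grow : Cmd ι :=
  .put (.l .LOW) (.k .i + .m .hh) (.lit 1) ;;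
  .put (.l .LSZ) (.k .i) (.get (.l .LSZ) (.k .i) + .lit 1) ;; refreshBoth

/-- Removes the handle `hh` from the set of the level. -/
def shrink : Cmd ι :=
  .put (.l .LOW) (.k .i + .m .hh) (.lit 0) ;;
  .put (.l .LSZ) (.k .i) (.get (.l .LSZ) (.k .i) - .lit 1) ;; refreshBoth

/-- Changing the membership of `y` affects the required entry at node `y` only, in either tree, so
one climb from `y` repairs each. -/
theorem spec_grow (hE : LEnv T M i κ S σ) (hM : M < 2 ^ N) {y : ℕ}
    (hR : RepL T M i κ S L σ y) (hh : σ.r (.m .hh) = T * y) (hy : y ≤ M) (hyL : y ∉ L) :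
    Spec prim grow σ (700 * (N + 1)) fun σ' =>
      RepL T M i κ S (insert y L) σ' 0 ∧ LFrame T i σ σ' := by
  have hi := hE.lt
  have hsz : σ.a (.l .LSZ) i = L.card := by rw [← lv_zero σ T, hR.sz]
  apply Spec.of_wp
  simp only [grow, wp_seq, wp_put, Ex.ev_add, Ex.ev_reg, Ex.ev_get, Ex.ev_lit, hE.hi, hh,
    St.setA_r, St.setA_a, reduceCtorEq, Arr.l.injEq, if_false, hsz]
  have hF : LFrame T i σ ((σ.setA (.l .LOW) (i + T * y) 1).setA (.l .LSZ) i (L.card + 1)) :=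
    ((LFrame.refl ..).put hi rfl ..).put_zero hi rfl ..
  refine (spec_refreshBoth (hE.frame hF) hM (L := insert y L) (y := y) ?_ (by simpa using hh)
    hy).wp fun s σ' hs ⟨h1, h2⟩ => ⟨by simp at hs; linarith, h1, hF.trans h2⟩
  have hl : ∀ x, lv ((σ.setA (.l .LOW) (i + T * y) 1).setA (.l .LSZ) i (L.card + 1)) T i x =
      if x = .LSZ then Function.update (lv σ T i .LSZ) 0 (L.card + 1)
      else if x = .LOW then Function.update (lv σ T i .LOW) y 1 else lv σ T i x := by
    intro x; simp [lv_put_zero hi, lv_put hi]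
  have hd : ∀ dir, treeArr dir ≠ .LSZ ∧ treeArr dir ≠ .LOW := by decide
  refine ⟨fun k => ?_, ?_, fun dir => ?_, fun dir => ?_⟩
  · simp only [hl, reduceCtorEq, if_false, if_true, Function.update_apply, hR.low,
      Finset.mem_insert]
    split_ifs <;> simp_all
  · simp [hl, Finset.card_insert_of_notMem hyL]
  · rw [hl, if_neg (hd dir).1, if_neg (hd dir).2]
    refine (hR.tree dir).congr fun v hv => ?_
    cases dir <;> simp [hv]
  · rw [hl, if_neg (hd dir).1, if_neg (hd dir).2]
    exact hR.supp dir

theorem spec_shrink (hE : LEnv T M i κ S σ) (hM : M < 2 ^ N) {y : ℕ}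
    (hR : RepL T M i κ S L σ y) (hh : σ.r (.m .hh) = T * y) (hy : y ≤ M) (hyL : y ∈ L) :
    Spec prim shrink σ (700 * (N + 1)) fun σ' =>
      RepL T M i κ S (L.erase y) σ' 0 ∧ LFrame T i σ σ' := by
  have hi := hE.lt
  have hsz : σ.a (.l .LSZ) i = L.card := by rw [← lv_zero σ T, hR.sz]
  apply Spec.of_wp
  simp only [shrink, wp_seq, wp_put, Ex.ev_add, Ex.ev_sub, Ex.ev_reg, Ex.ev_get, Ex.ev_lit, hE.hi,
    hh, St.setA_r, St.setA_a, reduceCtorEq, Arr.l.injEq, if_false, hsz]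
  have hF : LFrame T i σ ((σ.setA (.l .LOW) (i + T * y) 0).setA (.l .LSZ) i (L.card - 1)) :=
    ((LFrame.refl ..).put hi rfl ..).put_zero hi rfl ..
  refine (spec_refreshBoth (hE.frame hF) hM (L := L.erase y) (y := y) ?_ (by simpa using hh)
    hy).wp fun s σ' hs ⟨h1, h2⟩ => ⟨by simp at hs; linarith, h1, hF.trans h2⟩
  have hl : ∀ x, lv ((σ.setA (.l .LOW) (i + T * y) 0).setA (.l .LSZ) i (L.card - 1)) T i x =
      if x = .LSZ then Function.update (lv σ T i .LSZ) 0 (L.card - 1)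
      else if x = .LOW then Function.update (lv σ T i .LOW) y 0 else lv σ T i x := by
    intro x; simp [lv_put_zero hi, lv_put hi]
  have hd : ∀ dir, treeArr dir ≠ .LSZ ∧ treeArr dir ≠ .LOW := by decide
  refine ⟨fun k => ?_, ?_, fun dir => ?_, fun dir => ?_⟩
  · simp only [hl, reduceCtorEq, if_false, if_true, Function.update_apply, hR.low,
      Finset.mem_erase]
    split_ifs <;> simp_all
  · simp [hl, Finset.card_erase_of_mem hyL]
  · rw [hl, if_neg (hd dir).1, if_neg (hd dir).2]
    refine (hR.tree dir).congr fun v hv => ?_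
    cases dir <;> simp [hv]
  · rw [hl, if_neg (hd dir).1, if_neg (hd dir).2]
    exact hR.supp dir

/-- The insertion of the handle `hx` at level `i`. -/
def levelIns : Cmd ι :=
  .set (.m .hh) (.k .hx) ;; grow ;;
  .ite (.get (.l .LSZ) (.k .i) - .get (.b .CAP) (.k .i))
    (.set (.m .hh) (.get (.l .MAXT) (.k .i + .k .T)) ;; shrink) .skip

/-- The deletion of the handle `hx` at level `i`. -/
def levelDel : Cmd ι :=
  .set (.m .hh) (.k .hx) ;;
  .ite (.get (.l .LOW) (.k .i + .k .hx)) shrink refreshBoth ;;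
  .ite (.get (.b .CAP) (.k .i) - .get (.l .LSZ) (.k .i))
    (.set (.m .hh) (.get (.l .MINT) (.k .i + .k .T)) ;; .ite (.m .hh) grow .skip) .skip

/-- The set `L` of the level has been updated. -/
def LevOp (T M i K : ℕ) (κ : ℕ → ℕ) (S L : Finset ℕ) (σ σ' : St) : Prop :=
  ∃ L', Lev K S (fun k => κ (T * k)) L' ∧ RepL T M i κ S L' σ' 0 ∧ (L \ L').card ≤ 1 ∧
    LFrame T i σ σ'

variable {K : ℕ} {pr : ℕ → ℕ}

theorem spec_levelIns {x : ℕ} (hE : LEnv T M i κ (insert x S) σ) (hM : M < 2 ^ N)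
    (hR : RepL T M i κ S L σ 0) (hL : Lev K S pr L) (hcap : σ.a (.b .CAP) i = K)
    (hx : σ.r (.k .hx) = T * x) (hxS : x ∉ S) (hxM : x ≤ M) (hp : ∀ k ∈ S, κ (T * k) = pr k)
    (hS : ∀ k ∈ insert x S, 1 ≤ k ∧ k ≤ M) :
    Spec prim levelIns σ (1500 * (N + 1)) (LevOp T M i K κ (insert x S) L σ) := by
  have hi := hE.lt
  have hT : 0 < T := by omega
  have hxL : x ∉ L := fun h => hxS (hL.sub h)
  apply Spec.of_wp
  simp only [levelIns, wp_seq, wp_set, wp_ite, wp_skip, Ex.ev_reg, hx, Ex.ev_sub, Ex.ev_get,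
    Ex.ev_add]
  have hF₁ : LFrame T i σ (σ.setR (.m .hh) (T * x)) := (LFrame.refl ..).setM ..
  have hR₁ : RepL T M i κ (insert x S) L (σ.setR (.m .hh) (T * x)) x := by
    refine ⟨hR.low, hR.sz, fun dir => ?_, hR.supp⟩
    refine ((hR.tree dir).of_zero x).congr fun v hv => ?_
    cases dir <;> simp [hv]
  refine (spec_grow (hE.frame hF₁) hM hR₁ (by simp) hxM hxL).wp fun s₂ σ₂ hs₂ ⟨hR₂, hf₂⟩ => ?_
  have hF₂ := hF₁.trans hf₂
  have hE₂ := hE.frame hF₂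
  have hsz₂ : σ₂.a (.l .LSZ) i = (insert x L).card := by rw [← lv_zero σ₂ T, hR₂.sz]
  have hcap₂ : σ₂.a (.b .CAP) i = K := by rw [hF₂.b, hcap]
  rw [hE₂.hi, hsz₂, hcap₂]
  by_cases hK : (insert x L).card ≤ K
  · rw [if_neg (by omega)]
    refine ⟨by simp at hs₂ ⊢; linarith, _, hL.insert_le hxS hK, hR₂, ?_, hF₂⟩
    rw [Finset.sdiff_eq_empty_iff_subset.2 (Finset.subset_insert ..)]
    simp
  · rw [if_pos (by omega)]
    -- The root is node one, hence the offset `T`. It holds the member with the largest prediction,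
    -- which is evicted if the capacity is exceeded.
    have hroot : σ₂.a (.l .MAXT) (i + σ₂.r (.k .T)) = lv σ₂ T i (treeArr true) 1 := by
      simp [lv, treeArr, hE₂.hT]
    have ht := hR₂.tree true
    simp only [if_true] at ht
    obtain ⟨hr0, -⟩ := ht.root_best hT (Finset.mem_insert_self x L) (hS x (by simp)).1
    obtain ⟨y, hy, hry⟩ := ht.mem (hR₂.supp true) le_rfl hr0
    have hLS : ∀ z ∈ insert x L, z ∈ insert x S := fun z hz =>
      Finset.insert_subset_insert x hL.sub hz
    rw [hroot, hry]
    have hF₃ : LFrame T i σ (σ₂.setR (.m .hh) (T * y)) := hF₂.setM ..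
    refine (spec_shrink (hE.frame hF₃) hM (L := insert x L)
      ⟨hR₂.low, hR₂.sz, fun dir => (hR₂.tree dir).of_zero y, hR₂.supp⟩ (by simp)
      (hS y (hLS y hy)).2 hy).wp fun s₃ σ₃ hs₃ ⟨hR₃, hf₃⟩ => ?_
    refine ⟨by simp at hs₂ hs₃ ⊢; linarith, _, hL.insert_gt (pr' := fun k => κ (T * k)) hxS hp
      (by omega) hy fun z hz => ?_, hR₃, ?_, hF₃.trans hf₃⟩
    · have := (ht.root_best hT hz (hS z (hLS z hz)).1).2
      rw [hry] at this
      simp only [gap, if_true] at this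
      omega
    · refine (Finset.card_le_card (t := {y}) fun z hz => ?_).trans (by simp)
      simp only [Finset.mem_sdiff, Finset.mem_erase, Finset.mem_insert, Finset.mem_singleton] at *
      tauto

theorem spec_levelDel {x : ℕ} (hE : LEnv T M i κ (S.erase x) σ) (hM : M < 2 ^ N)
    (hR : RepL T M i κ S L σ 0) (hL : Lev K S (fun k => κ (T * k)) L) (hcap : σ.a (.b .CAP) i = K)
    (hx : σ.r (.k .hx) = T * x) (hxS : x ∈ S) (hS : ∀ k ∈ S, 1 ≤ k ∧ k ≤ M) :
    Spec prim levelDel σ (1500 * (N + 1)) (LevOp T M i K κ (S.erase x) L σ) := by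
  have hi := hE.lt
  have hT : 0 < T := by omega
  have hxM := (hS x hxS).2
  apply Spec.of_wp
  simp only [levelDel, wp_seq, wp_set, wp_ite, wp_skip, Ex.ev_reg, hx, Ex.ev_sub, Ex.ev_get,
    Ex.ev_add, St.setR_r, St.setR_a, reduceCtorEq, if_false, hE.hi]
  have hF₁ : LFrame T i σ (σ.setR (.m .hh) (T * x)) := (LFrame.refl ..).setM ..
  have hR₁ : RepL T M i κ (S.erase x) L (σ.setR (.m .hh) (T * x)) x := by
    refine ⟨hR.low, hR.sz, fun dir => ?_, hR.supp⟩
    refine ((hR.tree dir).of_zero x).congr fun v hv => ?_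
    cases dir <;> simp [hv]
  have hlow : σ.a (.l .LOW) (i + T * x) = if x ∈ L then 1 else 0 := hR.low x
  have hcap₂ : ∀ {σ₂}, LFrame T i σ σ₂ → σ₂.a (.b .CAP) (σ₂.r (.k .i)) = K := fun h => by
    rw [h.b, h.kr, hE.hi, hcap]
  have hsz₂ : ∀ {σ₂ L'}, LFrame T i σ σ₂ → RepL T M i κ (S.erase x) L' σ₂ 0 →
      σ₂.a (.l .LSZ) (σ₂.r (.k .i)) = L'.card := fun h h' => by
    rw [h.kr, hE.hi, ← lv_zero _ T, h'.sz]
  by_cases hxL : x ∈ L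
  · rw [hlow, if_pos hxL, if_pos one_ne_zero]
    refine (spec_shrink (hE.frame hF₁) hM hR₁ (by simp) hxM hxL).wp fun s₂ σ₂ hs₂ ⟨hR₂, hf₂⟩ => ?_
    have hF₂ := hF₁.trans hf₂
    have hE₂ := hE.frame hF₂
    have hcard : (L.erase x).card < K := by
      have := hL.card
      rw [Finset.card_erase_of_mem hxL]
      have := Finset.card_pos.2 ⟨x, hxL⟩
      omega
    rw [hsz₂ hF₂ hR₂, hcap₂ hF₂, if_pos (by omega)]
    have hroot : σ₂.a (.l .MINT) (σ₂.r (.k .i) + σ₂.r (.k .T)) = lv σ₂ T i (treeArr false) 1 := by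
      simp [lv, treeArr, hE₂.hT, hE₂.hi]
    have ht := hR₂.tree false
    simp only [Bool.false_eq_true, if_false] at ht
    rw [hroot]
    have hS' : ∀ z ∈ S.erase x, 1 ≤ z ∧ z ≤ M := fun z hz => hS z (Finset.mem_of_mem_erase hz)
    -- An empty root of the tree of minima means that every remaining item is in the set already, so
    -- there is nothing to refill the vacancy with.
    by_cases hr0 : lv σ₂ T i (treeArr false) 1 = 0
    · rw [hr0, if_neg (by simp)]
      refine ⟨by simp at hs₂ ⊢; linarith, L.erase x, hL.erase_eq fun z hz => ?_,
        ⟨hR₂.low, hR₂.sz, hR₂.tree, hR₂.supp⟩, ?_, hF₂.setM ..⟩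
      · by_contra hzL
        exact (ht.root_best hT (Finset.mem_sdiff.2 ⟨hz, hzL⟩) (hS' z hz).1).1 hr0
      · refine (Finset.card_le_card (t := {x}) fun z hz => ?_).trans (by simp)
        simp only [Finset.mem_sdiff, Finset.mem_erase, Finset.mem_singleton] at *
        tauto
    · obtain ⟨y, hy, hry⟩ := ht.mem (hR₂.supp false) le_rfl hr0
      obtain ⟨hy1, hy2⟩ := Finset.mem_sdiff.1 hy
      rw [hry] at hr0
      rw [hry, if_pos (by simpa using hr0)]
      have hF₃ : LFrame T i σ (σ₂.setR (.m .hh) (T * y)) := hF₂.setM ..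
      refine (spec_grow (hE.frame hF₃) hM (L := L.erase x)
        ⟨hR₂.low, hR₂.sz, fun dir => (hR₂.tree dir).of_zero y, hR₂.supp⟩ (by simp)
        (hS' y hy1).2 hy2).wp fun s₃ σ₃ hs₃ ⟨hR₃, hf₃⟩ => ?_
      refine ⟨by simp at hs₂ hs₃ ⊢; linarith, _, hL.erase_insert hxL hy1 hy2 fun z hz hzL => ?_,
        hR₃, ?_, hF₃.trans hf₃⟩
      · have := (ht.root_best hT (Finset.mem_sdiff.2 ⟨hz, hzL⟩) (hS' z hz).1).2
        rw [hry] at this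
        simp only [gap, Bool.false_eq_true, if_false] at this
        omega
      · refine (Finset.card_le_card (t := {x}) fun z hz => ?_).trans (by simp)
        simp only [Finset.mem_sdiff, Finset.mem_erase, Finset.mem_insert,
          Finset.mem_singleton] at *
        tauto
  · rw [hlow, if_neg hxL, if_neg (by simp)]
    -- The set stays and is full, but the deleted item was an outsider and has to leave the tree of
    -- minima.
    refine (spec_refreshBoth (hE.frame hF₁) hM hR₁ (by simp) hxM).wp
      fun s₂ σ₂ hs₂ ⟨hR₂, hf₂⟩ => ?_
    have hF₂ := hF₁.trans hf₂
    obtain ⟨h1, h2⟩ := hL.erase_of_notMem hxS hxL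
    rw [hsz₂ hF₂ hR₂, hcap₂ hF₂, if_neg (by omega)]
    exact ⟨by simp at hs₂ ⊢; linarith, L, h1, hR₂, by simp, hF₂⟩

end Level

/-! ### Computing the parameters from `T` -/

section Tables

variable {ι : Type} {prim : ι → ℕ → ℕ → ℕ} {T : ℕ} {σ : St}

/-- Computes the number of levels, the number of copies and the capacities of the levels. -/
def tables : Cmd ι :=
  .set (.k .J) (.lit 0) ;; .set (.s .ra) (.lit 1) ;;
  .while (.k .T - .s .ra)
    (.set (.s .ra) (.s .ra + .s .ra) ;; .set (.k .J) (.k .J + .lit 1)) ;;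
  .set (.k .N) (.k .J + .lit 1) ;;
  .set (.k .W) (.k .N + .k .N + .k .N + .k .N + .k .N) ;;
  .set (.k .W) (.k .W + .k .W + .k .W + .k .W + .k .W) ;;
  .set (.k .W) (.k .W + .k .W + .k .W + .k .W + .k .W) ;;
  .set (.k .W) (.k .W + .k .W) ;;
  .set (.s .ra) (.lit 1) ;;
  .set (.s .rb) (.k .N + .k .N) ;; .set (.s .rb) (.s .rb + .s .rb) ;;
  .set (.s .rb) (.s .rb + .s .rb) ;; .set (.s .rb) (.s .rb + .s .rb) ;;
  .set (.k .i) (.lit 0) ;;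
  .while (.k .J - .k .i)
    (.put (.b .P2) (.k .i) (.s .ra) ;; .put (.b .CAP) (.k .i) (.s .rb) ;;
      .set (.s .ra) (.s .ra + .s .ra) ;; .set (.s .rb) (.s .rb + .s .rb) ;;
      .set (.k .i) (.k .i + .lit 1))

/-- The registers that `tables` computes, and loop variables. -/
def KReg.aux : KReg → Bool
  | .J | .N | .W | .c | .i | .s => true
  | _ => false

/-- Only tables, auxiliary registers and scratch registers have changed. -/
structure TFrame (σ σ' : St) : Prop where
  kr : ∀ x : KReg, x.aux = false → σ'.r (.k x) = σ.r (.k x)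
  next : σ'.r (.s .next) = σ.r (.s .next)
  c : ∀ x, σ'.a (.c x) = σ.a (.c x)
  l : ∀ x, σ'.a (.l x) = σ.a (.l x)
  g : ∀ x, σ'.a (.g x) = σ.a (.g x)
  m : ∀ x, σ'.a (.m x) = σ.a (.m x)

theorem TFrame.refl (σ : St) : TFrame σ σ :=
  ⟨fun _ _ => rfl, rfl, fun _ => rfl, fun _ => rfl, fun _ => rfl, fun _ => rfl⟩

theorem TFrame.setK {σ σ' : St} (h : TFrame σ σ') {x : KReg} (hx : x.aux = true) (v : ℕ) :
    TFrame σ (σ'.setR (.k x) v) :=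
  ⟨fun y hy => by
    rw [← h.kr y hy]
    simp only [St.setR_r, Reg.k.injEq]
    rw [if_neg (by rintro rfl; rw [hx] at hy; cases hy)], by simpa using h.next, h.c, h.l, h.g, h.m⟩

theorem TFrame.setS {σ σ' : St} (h : TFrame σ σ') {x : SReg} (hx : x ≠ .next) (v : ℕ) :
    TFrame σ (σ'.setR (.s x) v) :=
  ⟨fun y hy => by simpa using h.kr y hy, by simpa [hx.symm] using h.next, h.c, h.l, h.g, h.m⟩

theorem TFrame.putB {σ σ' : St} (h : TFrame σ σ') (x : BArr) (i v : ℕ) :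
    TFrame σ (σ'.setA (.b x) i v) :=
  ⟨h.kr, h.next, fun y => by simpa using h.c y, fun y => by simpa using h.l y,
    fun y => by simpa using h.g y, fun y => by simpa using h.m y⟩

/-- The tables have been computed. -/
structure Tabs (T N J : ℕ) (σ : St) : Prop where
  hJ : σ.r (.k .J) = J
  hN : σ.r (.k .N) = N
  hW : σ.r (.k .W) = 250 * N
  pow : ∀ i < J, σ.a (.b .P2) i = 2 ^ i
  cap : ∀ i < J, σ.a (.b .CAP) i = Kv N i

/-- The parameter `T` comes with each call, so the tables are recomputed in every update; this takes
only `O(J + 1)` steps. Additions suffice: the factor 250 is built as `5 * 5 * 5 * 2`, and powers and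
capacities by doubling. -/
theorem spec_tables (hT : σ.r (.k .T) = T) {J : ℕ} (hJ : J = Nat.clog 2 T) :
    Spec prim tables σ (500 * (J + 1)) fun σ' => Tabs T (J + 1) J σ' ∧ TFrame σ σ' := by
  apply Spec.of_wp
  simp only [tables, wp_seq, wp_set, Ex.ev_lit]
  refine wp_while (b := 30) (fun k σ' => ∃ j, j + k = J ∧ σ'.r (.s .ra) = 2 ^ j ∧
    σ'.r (.k .J) = j ∧ σ'.r (.k .T) = T ∧ TFrame σ σ') J ⟨0, by omega, by simp, by simp,
      by simp [hT], ((TFrame.refl σ).setK rfl _).setS (by decide) _⟩ ?_ ?_ ?_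
  · rintro k σ₁ ⟨j, hj, h1, h2, h3, h4⟩
    have hlt : 2 ^ j < T := Nat.pow_lt_of_lt_clog (by omega)
    refine ⟨by simp only [Ex.ev_sub, Ex.ev_reg, h1, h3]; omega, Spec.of_wp ?_⟩
    simp only [wp_seq, wp_set, Ex.ev_add, Ex.ev_reg, Ex.ev_lit, St.setR_r, h1, h2, reduceCtorEq,
      if_false]
    exact ⟨by simp, j + 1, by omega, by simp [pow_succ, mul_two], by simp, by simp [h3],
      (h4.setS (by decide) _).setK rfl _⟩
  · rintro σ₁ ⟨j, hj, h1, h2, h3, h4⟩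
    have hge : T ≤ 2 ^ j := by
      obtain rfl : j = Nat.clog 2 T := by omega
      exact Nat.le_pow_clog (by norm_num) T
    simp only [Ex.ev_sub, Ex.ev_reg, h1, h3]; omega
  · rintro s₁ σ₁ hs₁ ⟨j, hj, h1, h2, h3, h4⟩
    obtain rfl : j = J := by omega
    simp only [Ex.ev_add, Ex.ev_reg, Ex.ev_lit, St.setR_r, h2, reduceCtorEq, if_false, if_true,
      Reg.k.injEq, Reg.s.injEq]
    refine wp_while (b := 80) (fun k σ' => ∃ i, i + k = j ∧ σ'.r (.s .ra) = 2 ^ i ∧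
      σ'.r (.s .rb) = Kv (j + 1) i ∧ σ'.r (.k .i) = i ∧ σ'.r (.k .J) = j ∧ σ'.r (.k .N) = j + 1 ∧
      σ'.r (.k .W) = 250 * (j + 1) ∧ (∀ i' < i, σ'.a (.b .P2) i' = 2 ^ i') ∧
      (∀ i' < i, σ'.a (.b .CAP) i' = Kv (j + 1) i') ∧ TFrame σ σ') j
      ⟨0, by omega, by simp, by simp [Kv, Bv]; ring, by simp, by simp [h2], by simp,
        by simp; ring, by simp, by simp, ?_⟩ ?_ ?_ ?_
    · repeat' first | exact h4 | apply TFrame.setK | apply TFrame.setS | rfl | decide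
    · rintro k σ₂ ⟨i, hi, h1, h2, h3, h4, h5, h6, h7, h8, h9⟩
      refine ⟨by simp only [Ex.ev_sub, Ex.ev_reg, h3, h4]; omega, Spec.of_wp ?_⟩
      simp only [wp_seq, wp_put, wp_set, Ex.ev_add, Ex.ev_reg, Ex.ev_lit, St.setR_r, St.setA_r, h1,
        h2, h3, reduceCtorEq, if_false, Reg.s.injEq]
      refine ⟨by simp, i + 1, by omega, by simp [pow_succ, mul_two], ?_, by simp, by simp [h4],
        by simp [h5], by simp [h6], fun i' hi' => ?_, fun i' hi' => ?_, ?_⟩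
      · simp [Kv, Bv_succ]; ring
      · simp only [St.setR_a, St.setA_a, reduceCtorEq, Arr.b.injEq, if_false, if_true,
          Function.update_apply]
        split_ifs with h
        · rw [h]
        · exact h7 i' (by omega)
      · simp only [St.setR_a, St.setA_a, reduceCtorEq, Arr.b.injEq, if_false, if_true,
          Function.update_apply]
        split_ifs with h
        · rw [h]
        · exact h8 i' (by omega)
      · exact ((((h9.putB ..).putB ..).setS (by decide) _).setS (by decide) _).setK rfl _
    · rintro σ₂ ⟨i, hi, h1, h2, h3, h4, -⟩
      simp only [Ex.ev_sub, Ex.ev_reg, h3, h4]; omega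
    · rintro s₂ σ₂ hs₂ ⟨i, hi, h1, h2, h3, h4, h5, h6, h7, h8, h9⟩
      obtain rfl : i = j := by omega
      exact ⟨by simp at hs₁ hs₂; linarith, ⟨h4, h5, h6, h7, h8⟩, h9⟩

end Tables

/-! ### An operation on all levels -/

section Levels

variable {ι : Type} {prim : ι → ℕ → ℕ → ℕ} {T M J N : ℕ} {σ : St}

/-- Performs an operation on all levels. -/
def levels (p : Cmd ι) : Cmd ι :=
  .set (.k .i) (.k .J) ;; .while (.k .i) (.set (.k .i) (.k .i - .lit 1) ;; p)

/-- Only the levels, loop variables and scratch registers have changed. -/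
structure LsFrame (σ σ' : St) : Prop where
  kr : ∀ x, x ≠ .i → σ'.r (.k x) = σ.r (.k x)
  next : σ'.r (.s .next) = σ.r (.s .next)
  c : ∀ x, σ'.a (.c x) = σ.a (.c x)
  g : ∀ x, σ'.a (.g x) = σ.a (.g x)
  b : ∀ x, σ'.a (.b x) = σ.a (.b x)
  m : ∀ x, σ'.a (.m x) = σ.a (.m x)
  zc : σ'.a (.l .ZC) = σ.a (.l .ZC)
  cc : σ'.a (.l .CC) = σ.a (.l .CC)

theorem LsFrame.refl (σ : St) : LsFrame σ σ :=
  ⟨fun _ _ => rfl, rfl, fun _ => rfl, fun _ => rfl, fun _ => rfl, fun _ => rfl, rfl, rfl⟩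

theorem LsFrame.seti {σ σ' : St} (h : LsFrame σ σ') (v : ℕ) : LsFrame σ (σ'.setR (.k .i) v) :=
  ⟨fun x hx => by simpa [hx] using h.kr x hx, by simpa using h.next, h.c, h.g, h.b, h.m, h.zc, h.cc⟩

theorem LsFrame.trans_lframe {i : ℕ} {σ σ₁ σ₂ : St} (h : LsFrame σ σ₁) (h' : LFrame T i σ₁ σ₂) :
    LsFrame σ σ₂ :=
  ⟨fun x hx => (h'.kr x).trans (h.kr x hx), h'.next.trans h.next, fun x => (h'.c x).trans (h.c x),
    fun x => (h'.g x).trans (h.g x), fun x => (h'.b x).trans (h.b x),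
    fun x => (h'.m x).trans (h.m x), h'.zc.trans h.zc, h'.cc.trans h.cc⟩

/-- All levels have been updated. -/
structure LevsOp (T M J : ℕ) (K : ℕ → ℕ) (κ : ℕ → ℕ) (S : Finset ℕ) (L : ℕ → Finset ℕ) (σ σ' : St)
    (L' : ℕ → Finset ℕ) : Prop where
  lev : ∀ i < J, Lev (K i) S (fun k => κ (T * k)) (L' i)
  rep : ∀ i < J, RepL T M i κ S (L' i) σ' 0
  diff : ∀ i < J, (L i \ L' i).card ≤ 1
  frame : LsFrame σ σ'

theorem spec_levels {p : Cmd ι} {b : ℕ} {K κ : ℕ → ℕ} {S S' : Finset ℕ} {L : ℕ → Finset ℕ}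
    (hJT : J ≤ T) (hJ : σ.r (.k .J) = J) (hR : ∀ i < J, RepL T M i κ S (L i) σ 0)
    (hp : ∀ i < J, ∀ σ', LsFrame σ σ' → σ'.r (.k .i) = i → RepL T M i κ S (L i) σ' 0 →
      Spec prim p σ' b (LevOp T M i (K i) κ S' (L i) σ')) :
    Spec prim (levels p) σ (J * (b + 20) + 20) fun σ' => ∃ L', LevsOp T M J K κ S' L σ σ' L' := by
  apply Spec.of_wp
  simp only [levels, wp_seq, wp_set, Ex.ev_reg, hJ]
  refine wp_while (b := b + 10) (fun k σ' => σ'.r (.k .i) = k ∧ k ≤ J ∧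
    (∀ i < k, RepL T M i κ S (L i) σ' 0) ∧ LsFrame σ σ' ∧ ∃ L', ∀ i, k ≤ i → i < J →
      Lev (K i) S' (fun k => κ (T * k)) (L' i) ∧ RepL T M i κ S' (L' i) σ' 0 ∧
      (L i \ L' i).card ≤ 1) J ⟨by simp, le_rfl, fun i hi => (hR i hi).congr fun _ => rfl,
        (LsFrame.refl σ).seti _, L, fun i h1 h2 => by omega⟩ ?_ ?_ ?_
  · rintro k σ₁ ⟨h1, hk, h2, h3, L', h4⟩
    refine ⟨by simp [h1], Spec.of_wp ?_⟩
    simp only [wp_seq, wp_set, Ex.ev_sub, Ex.ev_reg, Ex.ev_lit, h1, Nat.add_sub_cancel]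
    refine (hp k (by omega) _ (h3.seti k) (by simp) ((h2 k (by omega)).congr fun _ => rfl)).wp
      fun s₂ σ₂ hs₂ ⟨L₂, h5, h6, h7, h8⟩ => ?_
    refine ⟨by simp at hs₂; omega, by rw [h8.kr]; simp, by omega, fun i hi => ?_,
      (h3.seti k).trans_lframe h8, Function.update L' k L₂, fun i h9 h10 => ?_⟩
    · exact (h2 i (by omega)).congr fun y => h8.lv i (by omega) (by omega) y
    · by_cases hik : i = k
      · subst hik
        rw [Function.update_self]
        exact ⟨h5, h6, h7⟩
      · rw [Function.update_of_ne hik]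
        obtain ⟨h11, h12, h13⟩ := h4 i (by omega) h10
        exact ⟨h11, h12.congr fun y => h8.lv i (by omega) hik y, h13⟩
  · rintro σ₁ ⟨h1, -⟩
    simp [h1]
  · rintro s₁ σ₁ hs₁ ⟨h1, hk, h2, h3, L', h4⟩
    refine ⟨?_, L', fun i hi => (h4 i (by omega) hi).1, fun i hi => (h4 i (by omega) hi).2.1,
      fun i hi => (h4 i (by omega) hi).2.2, h3⟩
    simp at hs₁
    nlinarith

end Levels

/-! ### An operation on all copies, followed by background work -/

section Copies

variable {ι : Type} {prim : ι → ℕ → ℕ → ℕ} {P : IncrementalAlg ι} {Pr : DynProblem}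
  {n T Γ Q : ℕ} {it : ℕ → ℕ} {N J u x c M : ℕ} {S : Finset ℕ} {L : ℕ → Finset ℕ} {pr : ℕ → ℕ}
  {σ σ' : St} {cp : Cp}

/-- Only the copies, loop variables and scratch registers have changed. -/
structure CsFrame (σ σ' : St) : Prop where
  kr : ∀ x, x ≠ .c → x ≠ .i → x ≠ .s → σ'.r (.k x) = σ.r (.k x)
  l : ∀ x, σ'.a (.l x) = σ.a (.l x)
  g : ∀ x, σ'.a (.g x) = σ.a (.g x)
  b : ∀ x, σ'.a (.b x) = σ.a (.b x)

/-- Only copy `c`, loop variables and scratch registers have changed. -/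
structure BFrame (T c : ℕ) (σ σ' : St) : Prop where
  kr : ∀ x, x ≠ .i → x ≠ .s → σ'.r (.k x) = σ.r (.k x)
  l : ∀ x, σ'.a (.l x) = σ.a (.l x)
  g : ∀ x, σ'.a (.g x) = σ.a (.g x)
  b : ∀ x, σ'.a (.b x) = σ.a (.b x)
  pm : ∀ c' < T, c' ≠ c → pm σ' c' = pm σ c'
  cv : ∀ c' < T, c' ≠ c → ∀ x, cv σ' T c' x = cv σ T c' x

theorem CsFrame.refl (σ : St) : CsFrame σ σ :=
  ⟨fun _ _ _ _ => rfl, fun _ => rfl, fun _ => rfl, fun _ => rfl⟩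

theorem CsFrame.trans {σ₁ σ₂ σ₃ : St} (h : CsFrame σ₁ σ₂) (h' : CsFrame σ₂ σ₃) : CsFrame σ₁ σ₃ :=
  ⟨fun x h1 h2 h3 => (h'.kr x h1 h2 h3).trans (h.kr x h1 h2 h3), fun x => (h'.l x).trans (h.l x),
    fun x => (h'.g x).trans (h.g x), fun x => (h'.b x).trans (h.b x)⟩

theorem CsFrame.setc (h : CsFrame σ σ') (v : ℕ) : CsFrame σ (σ'.setR (.k .c) v) :=
  ⟨fun x h1 h2 h3 => by simpa [h1] using h.kr x h1 h2 h3, h.l, h.g, h.b⟩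

theorem BFrame.refl (T c : ℕ) (σ : St) : BFrame T c σ σ :=
  ⟨fun _ _ _ => rfl, fun _ => rfl, fun _ => rfl, fun _ => rfl, fun _ _ _ => rfl,
    fun _ _ _ _ => rfl⟩

theorem BFrame.trans {σ₁ σ₂ σ₃ : St} (h : BFrame T c σ₁ σ₂) (h' : BFrame T c σ₂ σ₃) :
    BFrame T c σ₁ σ₃ :=
  ⟨fun x h1 h2 => (h'.kr x h1 h2).trans (h.kr x h1 h2), fun x => (h'.l x).trans (h.l x),
    fun x => (h'.g x).trans (h.g x), fun x => (h'.b x).trans (h.b x),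
    fun c' h1 h2 => (h'.pm c' h1 h2).trans (h.pm c' h1 h2),
    fun c' h1 h2 x => (h'.cv c' h1 h2 x).trans (h.cv c' h1 h2 x)⟩

theorem BFrame.cs (h : BFrame T c σ σ') : CsFrame σ σ' := ⟨fun x _ => h.kr x, h.l, h.g, h.b⟩

theorem Frame.toBFrame (h : Frame T c σ σ') : BFrame T c σ σ' :=
  ⟨fun x _ _ => h.kr x, h.l, h.g, h.b, h.pm, h.cv⟩

theorem BFrame.seti (h : BFrame T c σ σ') (v : ℕ) : BFrame T c σ (σ'.setR (.k .i) v) :=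
  ⟨fun x h1 h2 => by simpa [h1] using h.kr x h1 h2, h.l, h.g, h.b, h.pm, h.cv⟩

theorem BFrame.sets (h : BFrame T c σ σ') (v : ℕ) : BFrame T c σ (σ'.setR (.k .s) v) :=
  ⟨fun x h1 h2 => by simpa [h2] using h.kr x h1 h2, h.l, h.g, h.b, h.pm, h.cv⟩

theorem RepC.bframe {c' : ℕ} (h : RepC prim P Pr n T Γ it c' σ cp) (hf : BFrame T c σ σ')
    (hc : c' < T) (hne : c' ≠ c) : RepC prim P Pr n T Γ it c' σ' cp :=
  ⟨h.stk.congr (hf.pm c' hc hne) (fun x _ => hf.cv c' hc hne x) fun _ _ => rfl,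
    h.q.congr fun x _ => hf.cv c' hc hne x⟩

theorem RepC.setR (h : RepC prim P Pr n T Γ it c σ cp) (x : Reg) (v : ℕ) :
    RepC prim P Pr n T Γ it c (σ.setR x v) cp :=
  ⟨h.stk.congr rfl (fun _ _ => rfl) fun _ _ => rfl, h.q.congr fun _ _ => rfl⟩

/-- The data that an update of the copies relies on. -/
structure UEnv (T n N J u x : ℕ) (it : ℕ → ℕ) (Pr : DynProblem) (S : Finset ℕ) (L : ℕ → Finset ℕ)
    (σ : St) : Prop where
  hT : σ.r (.k .T) = T
  hn : σ.r (.k .n) = n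
  hN : σ.r (.k .N) = N
  hJ : σ.r (.k .J) = J
  hW : σ.r (.k .W) = 250 * N
  hx : σ.r (.k .hx) = T * x
  item : ∀ k, σ.a (.g .ITEM) (T * k) = it k
  zc : ∀ i < J, σ.a (.l .ZC) i = u % 2 ^ i
  cc : ∀ i < J, σ.a (.l .CC) i = u / 2 ^ i % N
  senv : SEnv T J Pr it S L σ

theorem UEnv.frame (h : UEnv T n N J u x it Pr S L σ) (hf : CsFrame σ σ') :
    UEnv T n N J u x it Pr S L σ' :=
  ⟨(hf.kr _ (by decide) (by decide) (by decide)).trans h.hT,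
    (hf.kr _ (by decide) (by decide) (by decide)).trans h.hn,
    (hf.kr _ (by decide) (by decide) (by decide)).trans h.hN,
    (hf.kr _ (by decide) (by decide) (by decide)).trans h.hJ,
    (hf.kr _ (by decide) (by decide) (by decide)).trans h.hW,
    (hf.kr _ (by decide) (by decide) (by decide)).trans h.hx,
    by rw [hf.g]; exact h.item, by rw [hf.l]; exact h.zc, by rw [hf.l]; exact h.cc,
    ⟨by rw [hf.g]; exact h.senv.alive, by rw [hf.l]; exact h.senv.low, h.senv.items, h.senv.inj⟩⟩

theorem UEnv.penv (h : UEnv T n N J u x it Pr S L σ) (hc : σ.r (.k .c) = c) (hcT : c < T) :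
    PEnv n T it c σ :=
  ⟨⟨h.hT, hc, hcT⟩, h.hn, h.item⟩

/-- Starts a job on copy `c` if it is idle and one of its slots begins. -/
def starts : Cmd ι :=
  .set (.k .i) (.k .J) ;;
  .while (.k .i)
    (.set (.k .i) (.k .i - .lit 1) ;;
      .ite (.get (.l .ZC) (.k .i)) .skip
        (.ite ((.get (.l .CC) (.k .i) - .k .c) + (.k .c - .get (.l .CC) (.k .i))) .skip
          (.ite (.get (.c .PH) (.k .c)) .skip
            (.put (.c .PH) (.k .c) (.lit 1) ;;
              .put (.c .LVL) (.k .c) (.k .i + .lit 1)))))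

/-- Copy `c` has changed to some `cp` satisfying `p`. -/
def CpOps (prim : ι → ℕ → ℕ → ℕ) (P : IncrementalAlg ι) (Pr : DynProblem) (n T Γ : ℕ) (it : ℕ → ℕ)
    (c : ℕ) (σ σ' : St) (p : Cp → Prop) : Prop :=
  WFM T σ' ∧ BFrame T c σ σ' ∧ ∃ cp, RepC prim P Pr n T Γ it c σ' cp ∧ p cp

theorem spec_starts (hE : UEnv T n N J u x it Pr S L σ) (hc : σ.r (.k .c) = c) (hcT : c < T)
    (hW : WFM T σ) (hR : RepC prim P Pr n T Γ it c σ cp) :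
    Spec prim starts σ (J * 150 + 20) fun σ' =>
      CpOps prim P Pr n T Γ it c σ σ' (· = cp.starts N u c J) := by
  apply Spec.of_wp
  simp only [starts, wp_seq, wp_set, Ex.ev_reg, hE.hJ]
  refine wp_while (b := 140) (fun k σ' => σ'.r (.k .i) = k ∧ k ≤ J ∧
    CpOps prim P Pr n T Γ it c σ σ' fun cp' => cp'.starts N u c k = cp.starts N u c J) J
    ⟨by simp, le_rfl, hW.setR (by decide) _, (BFrame.refl ..).seti _, cp, hR.setR .., rfl⟩ ?_ ?_ ?_
  · rintro k σ₁ ⟨h1, hk, h2, h3, cp', h4, h5⟩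
    have hE₁ := hE.frame h3.cs
    have hc₁ : σ₁.r (.k .c) = c := (h3.kr _ (by decide) (by decide)).trans hc
    have hph : σ₁.a (.c .PH) c = cp'.ph := by rw [← cv_zero σ₁ T, h4.q.ph]
    rw [Cp.starts] at h5
    refine ⟨by simp [h1], Spec.of_wp ?_⟩
    simp only [wp_seq, wp_set, wp_ite, wp_skip, wp_put, Ex.ev_sub, Ex.ev_add, Ex.ev_reg, Ex.ev_lit,
      Ex.ev_get, h1, Nat.add_sub_cancel, St.setR_r, St.setR_a, St.setA_r, reduceCtorEq, if_true,
      if_false, Reg.k.injEq, hE₁.zc k hk, hE₁.cc k hk, hc₁, hph]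
    have hskip : ¬(Cp.Slot N k u c ∧ cp'.ph = 0) → CpOps prim P Pr n T Γ it c σ
        (σ₁.setR (.k .i) k) fun cp' => cp'.starts N u c k = cp.starts N u c J := by
      intro hno
      rw [Cp.start, if_neg hno] at h5
      exact ⟨h2.setR (by decide) _, h3.seti _, cp', h4.setR .., h5⟩
    by_cases hz : u % 2 ^ k = 0
    · rw [if_neg (by simpa using hz)]
      by_cases hcc : u / 2 ^ k % N = c
      · rw [if_neg (by omega)]
        by_cases hp : cp'.ph = 0
        · rw [if_neg (by simpa using hp)]
          rw [Cp.start, if_pos ⟨⟨hz, hcc⟩, hp⟩] at h5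
          have ho : QOp T c (σ₁.setR (.k .i) k) (((σ₁.setR (.k .i) k).setA (.c .PH) c 1).setA
            (.c .LVL) c (k + 1)) := ((QOp.refl T c _).put_zero hcT rfl _).put_zero hcT rfl _
          refine ⟨by simp, by simp, by omega, ho.wfm (h2.setR (by decide) _),
            (h3.seti k).trans ho.frame.toBFrame, { cp' with ph := 1, lv := k + 1 }, ⟨(h4.stk.congr (σ' := σ₁.setR (.k .i) k) rfl
              (fun _ _ => rfl) fun _ _ => rfl).qop ho, ?_⟩, h5⟩
          obtain ⟨⟨hd, h6, h7, h8, h9⟩, h10, h11⟩ := h4.q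
          refine ⟨⟨hd, ?_, ?_, ?_, ?_⟩, ?_, ?_⟩ <;>
            simp only [cv_put_zero hcT, cv_setR, reduceCtorEq, if_false, if_true, h6, h7, h8,
              Function.update_self]
          exact h9
        · rw [if_pos hp]
          exact ⟨by simp, by simp, by omega, hskip fun h => hp h.2⟩
      · rw [if_pos (by omega)]
        exact ⟨by simp, by simp, by omega, hskip fun h => hcc h.1.2⟩
    · rw [if_pos hz]
      exact ⟨by simp, by simp, by omega, hskip fun h => hz h.1.1⟩
  · rintro σ₁ ⟨h1, -⟩
    simp [h1]
  · rintro s₁ σ₁ hs₁ ⟨h1, -, h2, h3, cp', h4, h5⟩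
    refine ⟨by simp at hs₁; omega, h2, h3, cp', h4, h5⟩

variable (P) in
/-- Advances copy `c`. -/
def micros : Cmd ι :=
  .set (.k .s) (.k .W) ;; .while (.k .s) (.set (.k .s) (.k .s - .lit 1) ;; micro P)

theorem spec_micros (hP : P.Solves prim Pr n T Γ Q) (hE : UEnv T n N J u x it Pr S L σ)
    (hc : σ.r (.k .c) = c) (hcT : c < T) (hW : WFM T σ) (hR : RepC prim P Pr n T Γ it c σ cp)
    {v : ℕ} (hwf : WF J M S cp) (hM : M ≤ T) (hMJ : M ≤ 2 ^ J) (hN : 2 ≤ N)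
    (hinv : CInv N J S pr L v c cp (250 * N)) (hL : Low N J S pr L) :
    Spec prim (micros P) σ (250 * N * (1020 * (Γ + 1)) + 20) fun σ' =>
      CpOps prim P Pr n T Γ it c σ σ' fun cp' => WF J M S cp' ∧ CInv N J S pr L v c cp' 0 := by
  apply Spec.of_wp
  simp only [micros, wp_seq, wp_set, Ex.ev_reg, hE.hW]
  refine wp_while (b := 1000 * (Γ + 1) + 10) (fun k σ' => σ'.r (.k .s) = k ∧ k ≤ 250 * N ∧
    CpOps prim P Pr n T Γ it c σ σ' fun cp' => WF J M S cp' ∧ CInv N J S pr L v c cp' k) (250 * N)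
    ⟨by simp, le_rfl, hW.setR (by decide) _, (BFrame.refl ..).sets _, cp, hR.setR .., hwf, hinv⟩
    ?_ ?_ ?_
  · rintro k σ₁ ⟨h1, hk, h2, h3, cp', h4, h5, h6⟩
    have hF := h3.sets k
    have hE₁ := hE.frame hF.cs
    have hc₁ : (σ₁.setR (.k .s) k).r (.k .c) = c := (hF.kr _ (by decide) (by decide)).trans hc
    refine ⟨by simp [h1], Spec.of_wp ?_⟩
    simp only [wp_seq, wp_set, Ex.ev_sub, Ex.ev_reg, Ex.ev_lit, h1, Nat.add_sub_cancel]
    refine (spec_micro hP (hE₁.penv hc₁ hcT) (h2.setR (by decide) _) (h4.setR _ _) hE₁.senv h5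
      hM).wp fun s₂ σ₂ hs₂ ⟨h7, h8, h9⟩ => ⟨by simp at hs₂; linarith, by rw [h9.kr]; simp, by omega,
        h7, hF.trans h9.toBFrame, _, h8, h5.micro, h6.micro hk h5 hL hMJ hN⟩
  · rintro σ₁ ⟨h1, -⟩
    simp [h1]
  · rintro s₁ σ₁ hs₁ ⟨h1, -, h2⟩
    refine ⟨?_, h2⟩
    simp only [Ex.cost_reg] at hs₁
    have : 250 * N * (1000 * (Γ + 1) + 10 + 2 + 1) ≤ 250 * N * (1020 * (Γ + 1)) :=
      Nat.mul_le_mul_left _ (by linarith)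
    omega

variable (P) in
/-- Performs an operation on all copies, and advances them. -/
def copies (p : Cmd ι) : Cmd ι :=
  .set (.k .c) (.k .N) ;;
  .while (.k .c) (.set (.k .c) (.k .c - .lit 1) ;; p ;; starts ;; micros P)

theorem spec_copies (hP : P.Solves prim Pr n T Γ Q) (hE : UEnv T n N J u x it Pr S L σ)
    (hNT : N ≤ T) (hW : WFM T σ) {cp cp₁ : ℕ → Cp}
    (hR : ∀ c < N, RepC prim P Pr n T Γ it c σ (cp c))
    (hM : M ≤ T) (hMJ : M ≤ 2 ^ J) (hN : 2 ≤ N) (hL : Low N J S pr L)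
    (hwf : ∀ c < N, WF J M S (cp₁ c))
    (hinv : ∀ c < N, CInv N J S pr L (u + 1) c ((cp₁ c).starts N u c J) (250 * N)) {p : Cmd ι}
    {b : ℕ} (hp : ∀ c < N, ∀ σ', CsFrame σ σ' → σ'.r (.k .c) = c → WFM T σ' →
      RepC prim P Pr n T Γ it c σ' (cp c) →
      Spec prim p σ' b (CpOp prim P Pr n T Γ it c σ' · (cp₁ c))) :
    Spec prim (copies P p) σ (N * (b + J * 150 + 250 * N * (1020 * (Γ + 1)) + 60) + 20) fun σ' =>
      WFM T σ' ∧ CsFrame σ σ' ∧ ∃ cp' : ℕ → Cp, ∀ c < N, RepC prim P Pr n T Γ it c σ' (cp' c) ∧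
        WF J M S (cp' c) ∧ CInv N J S pr L (u + 1) c (cp' c) 0 := by
  apply Spec.of_wp
  simp only [copies, wp_seq, wp_set, Ex.ev_reg, hE.hN]
  refine wp_while (b := b + J * 150 + 250 * N * (1020 * (Γ + 1)) + 50) (fun k σ' =>
    σ'.r (.k .c) = k ∧ k ≤ N ∧ WFM T σ' ∧ CsFrame σ σ' ∧
    (∀ c < k, RepC prim P Pr n T Γ it c σ' (cp c)) ∧ ∃ cp' : ℕ → Cp, ∀ c, k ≤ c → c < N →
      RepC prim P Pr n T Γ it c σ' (cp' c) ∧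
        WF J M S (cp' c) ∧ CInv N J S pr L (u + 1) c (cp' c) 0) N
    ⟨by simp, le_rfl, hW.setR (by decide) _, (CsFrame.refl _).setc _, fun c hc => (hR c hc).setR ..,
      cp, fun c h1 h2 => by omega⟩ ?_ ?_ ?_
  · rintro k σ₁ ⟨h1, hk, h2, h3, h4, cp', h5⟩
    have hF := h3.setc k
    refine ⟨by simp [h1], Spec.of_wp ?_⟩
    simp only [wp_seq, wp_set, Ex.ev_sub, Ex.ev_reg, Ex.ev_lit, h1, Nat.add_sub_cancel]
    refine (hp k (by omega) _ hF (by simp) (h2.setR (by decide) _) ((h4 k (by omega)).setR _ _)).wp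
      fun s₂ σ₂ hs₂ ⟨h6, h7, h8⟩ => ?_
    have hE₂ := hE.frame (hF.trans h8.toBFrame.cs)
    have hc₂ : σ₂.r (.k .c) = k := by rw [h8.kr]; simp
    refine (spec_starts hE₂ hc₂ (by omega) h6 h7).wp fun s₃ σ₃ hs₃ ⟨h9, h10, cp₃, h11, h12⟩ => ?_
    subst h12
    have hE₃ := hE₂.frame h10.cs
    have hc₃ : σ₃.r (.k .c) = k := (h10.kr _ (by decide) (by decide)).trans hc₂
    refine (spec_micros hP hE₃ hc₃ (by omega) h9 h11 ((hwf k (by omega)).starts le_rfl) hM hMJ hN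
      (hinv k (by omega)) hL).wp fun s₄ σ₄ hs₄ ⟨h13, h14, cp₄, h15, h16, h17⟩ => ?_
    have hB := (h8.toBFrame.trans h10).trans h14
    refine ⟨by simp at hs₂; omega, (h14.kr _ (by decide) (by decide)).trans hc₃, by omega, h13,
      hF.trans hB.cs, fun c hc => ((h4 c (by omega)).setR _ _).bframe hB (by omega) (by omega),
      Function.update cp' k cp₄, fun c hc1 hc2 => ?_⟩
    by_cases hck : c = k
    · subst hck
      rw [Function.update_self]
      exact ⟨h15, h16, h17⟩
    · rw [Function.update_of_ne hck]
      obtain ⟨h18, h19⟩ := h5 c (by omega) hc2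
      exact ⟨(h18.setR _ _).bframe hB (by omega) hck, h19⟩
  · rintro σ₁ ⟨h1, -⟩
    simp [h1]
  · rintro s₁ σ₁ hs₁ ⟨h1, -, h2, h3, -, cp', h4⟩
    refine ⟨?_, h2, h3, cp', fun c hc => h4 c (by omega) hc⟩
    simp only [Ex.cost_reg] at hs₁
    have : N * (b + J * 150 + 250 * N * (1020 * (Γ + 1)) + 50 + 2 + 1) ≤
      N * (b + J * 150 + 250 * N * (1020 * (Γ + 1)) + 60) := Nat.mul_le_mul_left _ (by omega)
    omega

variable (P) in
/-- The insertion of the handle `hx` on copy `c`. -/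
def insOp : Cmd ι :=
  .set (.s .h) (.k .hx) ;;
  .ite (.get (.c .PH) (.k .c)) enqueue (.set (.s .tg) (.lit 0) ;; push P)

theorem spec_insOp (hP : P.Solves prim Pr n T Γ Q) (hE : UEnv T n N J u x it Pr S L σ)
    (hc : σ.r (.k .c) = c) (hcT : c < T) (hW : WFM T σ) (hR : RepC prim P Pr n T Γ it c σ cp)
    {S' : Finset ℕ} (hS : S = insert x S') (hsub : ∀ e ∈ cp.stk, e.1 ∈ S') (hxS : x ∉ S')
    (hlen : cp.stk.length < T) :
    Spec prim (insOp P) σ (800 * (Γ + 1)) (CpOp prim P Pr n T Γ it c σ · (cp.ins x)) := by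
  have hph : σ.a (.c .PH) c = cp.ph := by rw [← cv_zero σ T, hR.q.ph]
  have hPE := hE.penv hc hcT
  have hmem : x ∈ S := by rw [hS]; exact Finset.mem_insert_self ..
  apply Spec.of_wp
  simp only [insOp, wp_seq, wp_set, wp_ite, Ex.ev_get, Ex.ev_reg, Ex.ev_lit, St.setR_r, St.setR_a,
    reduceCtorEq, if_false, hE.hx, hc, hph]
  unfold Cp.ins
  have hF : Frame T c σ (σ.setR (.s .h) (T * x)) := (Frame.refl ..).setS ..
  by_cases h0 : cp.ph = 0
  · rw [if_neg (by simpa using h0), if_pos h0]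
    have hF' := hF.setS .tg 0
    refine (spec_push hP (hPE.frame hF') ((hW.setR (by decide) _).setR (by decide) _)
      (((hR.setR ..).setR ..).stk) (k := x) (t := 0) (by simp) (by simp) (fun h => ?_)
      (hE.senv.items x hmem) (fun e he h => ?_) hlen).wp fun s σ' hs ⟨ho, _⟩ =>
        ⟨?_, ho.wfm, ⟨ho.rep, ?_⟩, hF'.trans ho.frame⟩
    · obtain ⟨e, he, rfl⟩ := List.mem_map.1 h
      exact hxS (hsub e he)
    · have h1 : e.1 ∈ S := by rw [hS]; exact Finset.mem_insert_of_mem (hsub e he)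
      have := hE.senv.inj h1 hmem h
      exact hxS (this ▸ hsub e he)
    · simp at hs; linarith
    · exact RepQ.congr (σ := σ) ⟨hR.q.qu, hR.q.ph, hR.q.lv⟩ ho.queue
  · rw [if_pos h0, if_neg h0]
    refine (spec_enqueue (hPE.frame hF).toEnv (hR.setR ..).q (x := x) (by simp)).wp
      fun s σ' hs ⟨hq, ho⟩ => ⟨?_, ho.wfm (hW.setR (by decide) _), ⟨(hR.setR ..).stk.qop ho, hq⟩,
        hF.trans ho.frame⟩
    simp at hs; linarith

theorem spec_delOp (hP : P.Solves prim Pr n T Γ Q) (hE : UEnv T n N J u x it Pr S L σ)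
    (hc : σ.r (.k .c) = c) (hcT : c < T) (hW : WFM T σ) (hR : RepC prim P Pr n T Γ it c σ cp)
    (hO : Okay Pr T it cp.stk) {D : ℕ} (hD : ∀ d e, cp.stk[d]? = some e → e.1 = x → d ≤ D) :
    Spec prim (remove P) σ ((D + 1) * (2000 * (Γ + 1)))
      (CpOp prim P Pr n T Γ it c σ · (cp.del x)) :=
  (spec_remove hP (hE.penv hc hcT) hW hR.stk hO hE.hx hD).mono le_rfl fun _ h =>
    ⟨h.wfm, ⟨h.rep, RepQ.congr (σ := σ) ⟨hR.q.qu, hR.q.ph, hR.q.lv⟩ h.queue⟩, h.frame⟩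

end Copies

/-! ### The clocks of the levels and the choice of an idle copy -/

section Clock

variable {ι : Type} {prim : ι → ℕ → ℕ → ℕ} {T N J u : ℕ} {σ σ' : St}

theorem succ_mod_pow (u i : ℕ) : (u + 1) % 2 ^ i =
    if 2 ^ i ≤ u % 2 ^ i + 1 then 0 else u % 2 ^ i + 1 := by
  have h := Nat.mod_lt u (Nat.two_pow_pos i)
  rw [succ_mod_eq (Nat.two_pow_pos i)]
  split_ifs <;> omega

theorem succ_div_pow (u i : ℕ) : (u + 1) / 2 ^ i =
    if 2 ^ i ≤ u % 2 ^ i + 1 then u / 2 ^ i + 1 else u / 2 ^ i := by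
  have h := Nat.mod_lt u (Nat.two_pow_pos i)
  have h1 := Nat.div_add_mod u (2 ^ i)
  split_ifs with h2
  · have : u + 1 = 2 ^ i * (u / 2 ^ i + 1) := by rw [Nat.mul_add]; omega
    rw [this, Nat.mul_div_cancel_left _ (Nat.two_pow_pos i)]
  · refine Nat.div_eq_of_lt_le ?_ ?_
    · rw [mul_comm]; omega
    · rw [mul_comm, Nat.mul_add]; omega

theorem succ_mod_le {N : ℕ} (hN : 0 < N) (v : ℕ) :
    (v + 1) % N = if N ≤ v % N + 1 then 0 else v % N + 1 := by
  have h := Nat.mod_lt v hN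
  rw [succ_mod_eq hN]
  split_ifs <;> omega

/-- Advances the clocks of all levels. -/
def tick : Cmd ι :=
  .set (.k .i) (.k .J) ;;
  .while (.k .i)
    (.set (.k .i) (.k .i - .lit 1) ;;
      .put (.l .ZC) (.k .i) (.get (.l .ZC) (.k .i) + .lit 1) ;;
      .ite (.get (.b .P2) (.k .i) - .get (.l .ZC) (.k .i)) .skip
        (.put (.l .ZC) (.k .i) (.lit 0) ;;
          .put (.l .CC) (.k .i) (.get (.l .CC) (.k .i) + .lit 1) ;;
          .ite (.k .N - .get (.l .CC) (.k .i)) .skip (.put (.l .CC) (.k .i) (.lit 0))))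

/-- Only the clocks and loop variables have changed. -/
structure KFrame (σ σ' : St) : Prop where
  kr : ∀ x, x ≠ .i → σ'.r (.k x) = σ.r (.k x)
  next : σ'.r (.s .next) = σ.r (.s .next)
  c : ∀ x, σ'.a (.c x) = σ.a (.c x)
  g : ∀ x, σ'.a (.g x) = σ.a (.g x)
  b : ∀ x, σ'.a (.b x) = σ.a (.b x)
  m : ∀ x, σ'.a (.m x) = σ.a (.m x)
  l : ∀ x : LArr, x.own = true → σ'.a (.l x) = σ.a (.l x)

theorem KFrame.refl (σ : St) : KFrame σ σ :=
  ⟨fun _ _ => rfl, rfl, fun _ => rfl, fun _ => rfl, fun _ => rfl, fun _ => rfl, fun _ _ => rfl⟩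

theorem KFrame.seti (h : KFrame σ σ') (v : ℕ) : KFrame σ (σ'.setR (.k .i) v) :=
  ⟨fun x hx => by simpa [hx] using h.kr x hx, by simpa using h.next, h.c, h.g, h.b, h.m, h.l⟩

theorem KFrame.put (h : KFrame σ σ') {x : LArr} (hx : x.own = false) (i v : ℕ) :
    KFrame σ (σ'.setA (.l x) i v) :=
  ⟨h.kr, h.next, fun y => by simpa using h.c y, fun y => by simpa using h.g y,
    fun y => by simpa using h.b y, fun y => by simpa using h.m y, fun y hy => by
      rw [← h.l y hy]
      simp only [St.setA_a, Arr.l.injEq]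
      rw [if_neg (by rintro rfl; rw [hx] at hy; cases hy)]⟩

/-- Position and owner of the current block are advanced by comparison and reset, for want of
division. -/
theorem spec_tick (hN0 : 0 < N) (hJ : σ.r (.k .J) = J) (hN : σ.r (.k .N) = N)
    (hpow : ∀ i < J, σ.a (.b .P2) i = 2 ^ i) (hz : ∀ i < J, σ.a (.l .ZC) i = u % 2 ^ i)
    (hc : ∀ i < J, σ.a (.l .CC) i = u / 2 ^ i % N) :
    Spec prim tick σ (J * 200 + 20) fun σ' => KFrame σ σ' ∧
      (∀ i < J, σ'.a (.l .ZC) i = (u + 1) % 2 ^ i) ∧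
      ∀ i < J, σ'.a (.l .CC) i = (u + 1) / 2 ^ i % N := by
  apply Spec.of_wp
  simp only [tick, wp_seq, wp_set, Ex.ev_reg, hJ]
  refine wp_while (b := 180) (fun k σ' => σ'.r (.k .i) = k ∧ k ≤ J ∧ KFrame σ σ' ∧
    (∀ i < J, σ'.a (.l .ZC) i = if i < k then u % 2 ^ i else (u + 1) % 2 ^ i) ∧
    ∀ i < J, σ'.a (.l .CC) i = if i < k then u / 2 ^ i % N else (u + 1) / 2 ^ i % N) J
    ⟨by simp, le_rfl, (KFrame.refl σ).seti _, fun i hi => by simp [hi, hz],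
      fun i hi => by simp [hi, hc]⟩ ?_ ?_ ?_
  · rintro k σ₁ ⟨h1, hk, h2, h3, h4⟩
    have hz₁ : σ₁.a (.l .ZC) k = u % 2 ^ k := by rw [h3 k hk]; simp
    have hc₁ : σ₁.a (.l .CC) k = u / 2 ^ k % N := by rw [h4 k hk]; simp
    have hp₁ : σ₁.a (.b .P2) k = 2 ^ k := by rw [h2.b, hpow k hk]
    have hN₁ : σ₁.r (.k .N) = N := by rw [h2.kr _ (by decide), hN]
    have hne : ∀ i, i ≠ k → (i < k + 1 ↔ i < k) := fun i hi => by omega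
    refine ⟨by simp [h1], Spec.of_wp ?_⟩
    simp only [wp_seq, wp_set, wp_ite, wp_skip, wp_put, Ex.ev_sub, Ex.ev_add, Ex.ev_reg, Ex.ev_lit,
      Ex.ev_get, h1, Nat.add_sub_cancel, St.setR_r, St.setR_a, St.setA_r, St.setA_a, reduceCtorEq,
      if_true, if_false, Reg.k.injEq, Arr.l.injEq, hz₁, hc₁, hp₁, hN₁, Function.update_self]
    have hmod := succ_mod_pow u k
    have hdiv := succ_div_pow u k
    by_cases h5 : 2 ^ k ≤ u % 2 ^ k + 1
    · rw [if_pos h5] at hmod hdiv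
      have hm2 := succ_mod_le hN0 (u / 2 ^ k)
      rw [← hdiv] at hm2
      rw [if_neg (by omega)]
      by_cases h6 : N ≤ u / 2 ^ k % N + 1
      · rw [if_pos h6] at hm2
        rw [if_neg (by omega)]
        refine ⟨by simp, by simp, by omega, (((h2.seti k).put rfl _ _).put rfl _ _).put rfl _ _
          |>.put rfl _ _, fun i hi => ?_, fun i hi => ?_⟩
        · simp only [Function.update_apply]
          by_cases hik : i = k
          · subst hik; simp [hmod]
          · simp only [hik, if_false, h3 i hi, hne i hik]
        · simp only [Function.update_apply]
          by_cases hik : i = k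
          · subst hik; simp [hm2]
          · simp only [hik, if_false, h4 i hi, hne i hik]
      · rw [if_neg h6] at hm2
        rw [if_pos (by omega)]
        refine ⟨by simp, by simp, by omega, (((h2.seti k).put rfl _ _).put rfl _ _).put rfl _ _,
          fun i hi => ?_, fun i hi => ?_⟩
        · simp only [Function.update_apply]
          by_cases hik : i = k
          · subst hik; simp [hmod]
          · simp only [hik, if_false, h3 i hi, hne i hik]
        · simp only [Function.update_apply]
          by_cases hik : i = k
          · subst hik; simp [hm2]
          · simp only [hik, if_false, h4 i hi, hne i hik]
    · rw [if_neg h5] at hmod hdiv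
      rw [if_pos (by omega)]
      refine ⟨by simp, by simp, by omega, (h2.seti k).put rfl _ _, fun i hi => ?_, fun i hi => ?_⟩
      · simp only [Function.update_apply]
        by_cases hik : i = k
        · subst hik; simp [hmod]
        · simp only [hik, if_false, h3 i hi, hne i hik]
      · by_cases hik : i = k
        · subst hik; simp [hdiv, hc₁]
        · simp only [h4 i hi, hne i hik]
  · rintro σ₁ ⟨h1, -⟩
    simp [h1]
  · rintro s₁ σ₁ hs₁ ⟨h1, -, h2, h3, h4⟩
    refine ⟨by simp at hs₁; omega, h2, fun i hi => ?_, fun i hi => ?_⟩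
    · simpa using h3 i hi
    · simpa using h4 i hi

/-- Chooses an idle copy. -/
def choose : Cmd ι :=
  .set (.k .c) (.k .N) ;;
  .while (.k .c)
    (.set (.k .c) (.k .c - .lit 1) ;; .ite (.get (.c .PH) (.k .c)) .skip (.set (.k .cur) (.k .c)))

theorem spec_choose (hN : σ.r (.k .N) = N) (hi : ∃ c < N, σ.a (.c .PH) c = 0) :
    Spec prim choose σ (N * 60 + 20) fun σ' => (∃ c < N, σ'.r (.k .cur) = c ∧ σ.a (.c .PH) c = 0) ∧
      (∀ x, x ≠ .k .c → x ≠ .k .cur → σ'.r x = σ.r x) ∧ σ'.a = σ.a := by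
  apply Spec.of_wp
  simp only [choose, wp_seq, wp_set, Ex.ev_reg, hN]
  refine wp_while (b := 50) (fun k σ' => σ'.r (.k .c) = k ∧ k ≤ N ∧
    ((∃ c < N, σ'.r (.k .cur) = c ∧ σ.a (.c .PH) c = 0) ∨
      ∀ c, k ≤ c → c < N → σ.a (.c .PH) c ≠ 0) ∧
    (∀ x, x ≠ .k .c → x ≠ .k .cur → σ'.r x = σ.r x) ∧ σ'.a = σ.a) N
    ⟨by simp, le_rfl, .inr fun c h1 h2 => by omega, fun x h1 h2 => by simp [h1], by simp⟩ ?_ ?_ ?_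
  · rintro k σ₁ ⟨h1, hk, h2, h3, h4⟩
    refine ⟨by simp [h1], Spec.of_wp ?_⟩
    simp only [wp_seq, wp_set, wp_ite, wp_skip, Ex.ev_sub, Ex.ev_reg, Ex.ev_lit,
      Ex.ev_get, h1, Nat.add_sub_cancel, St.setR_r, St.setR_a, reduceCtorEq,
      if_true, Reg.k.injEq, h4]
    by_cases h0 : σ.a (.c .PH) k = 0
    · rw [if_neg (by simpa using h0)]
      refine ⟨by simp, by simp, by omega, .inl ⟨k, by omega, by simp, h0⟩, fun x hx hx' => ?_, trivial⟩
      simp [hx, hx', h3]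
    · rw [if_pos h0]
      refine ⟨by simp, by simp, by omega, ?_, fun x hx hx' => by simp [hx, h3 x hx hx'], trivial⟩
      rcases h2 with ⟨c, hc, h5, h6⟩ | h2
      · exact .inl ⟨c, hc, by simpa using h5, h6⟩
      · refine .inr fun c hc hcN => ?_
        rcases Nat.eq_or_lt_of_le hc with rfl | hc
        · exact h0
        · exact h2 c hc hcN
  · rintro σ₁ ⟨h1, -⟩
    simp [h1]
  · rintro s₁ σ₁ hs₁ ⟨h1, -, h2, h3, h4⟩
    refine ⟨by simp at hs₁; omega, ?_, h3, h4⟩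
    rcases h2 with h2 | h2
    · exact h2
    · obtain ⟨c, hc, h0⟩ := hi
      exact absurd h0 (h2 c (by omega) hc)

end Clock

/-! ### Queries -/

section Query

variable {ι : Type} {prim : ι → ℕ → ℕ → ℕ} {P : IncrementalAlg ι} {Pr : DynProblem}
  {n T Γ Q : ℕ} {it : ℕ → ℕ} {c : ℕ} {σ : St} {cp : Cp}

variable (P) in
/-- Answers a query on the copy `cur`, and takes back the changes. -/
def query : Cmd ι :=
  .set (.k .n) (.arg 1) ;; .set (.k .T) (.arg 2) ;; .set (.k .c) (.k .cur) ;;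
  .set (.s .lp) (.k .c + .get (.c .LPA) (.k .c)) ;;
  .set (.s .wa) (.lit 0) ;; .set (.s .wv) (.arg 0) ;; wr ;;
  .set (.s .wa) (.lit 1) ;; .set (.s .wv) (.k .n) ;; wr ;;
  sim P.onQuery ;;
  .set (.k .ans) (rd (.lit 0)) ;; unwind ;; .out (.k .ans)

/-- What the representation of the data structure consists of has not changed. -/
structure QFrame (prim : ι → ℕ → ℕ → ℕ) (P : IncrementalAlg ι) (Pr : DynProblem) (n T Γ : ℕ)
    (σ σ' : St) : Prop where
  last : σ'.r (.k .last) = σ.r (.k .last)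
  cur : σ'.r (.k .cur) = σ.r (.k .cur)
  l : ∀ x, σ'.a (.l x) = σ.a (.l x)
  g : ∀ x, σ'.a (.g x) = σ.a (.g x)
  wfm : WFM T σ'
  rep : ∀ it, ∀ c < T, ∀ cp, RepC prim P Pr n T Γ it c σ cp → RepC prim P Pr n T Γ it c σ' cp

/-- The copy to be asked was fixed by the last update, so the cost depends on `t` only. The writes
of the query are logged behind those of the insertions and then taken back, so queries leave no
trace in the stored history. -/
theorem spec_query {q t : ℕ} {m' : Memory} (hq : σ.io 0 = q) (hn : σ.io 1 = n) (hT : σ.io 2 = T)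
    (hc : σ.r (.k .cur) = c) (hcT : c < T) (hW : WFM T σ)
    (hR : RepC prim P Pr n T Γ it c σ cp) (hex : Exec prim P.onQuery (enter [q, n] (pm σ c)) t m') :
    Spec prim (query P) σ (1500 * (t + 1)) fun σ' =>
      σ'.io 0 = m' 0 ∧ QFrame prim P Pr n T Γ σ σ' := by
  have hT0 : 0 < T := by omega
  obtain ⟨l, hl, -⟩ := hR.stk.log
  have hl' : σ.a (.c .LPA) c = T * l := by rw [← cv_zero σ T, hl]
  rw [enter_pair] at hex
  apply Spec.of_wp
  simp only [query, wp_seq, wp_set, Ex.ev_add, Ex.ev_arg, Ex.ev_reg, Ex.ev_get, Ex.ev_lit,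
    St.setR_r, St.setR_a, St.setR_io, hq, hn, hT, hc, hl', reduceCtorEq, Reg.k.injEq, if_false,
    if_true]
  set σ₁ := ((σ.setR (.k .n) n).setR (.k .T) T).setR (.k .c) c with hσ₁
  have hW₁ : WFM T σ₁ :=
    ((hW.setR (by decide) _).setR (by decide) _).setR (by decide) _
  have hE₁ : Env T c σ₁ := ⟨by simp [hσ₁], by simp [hσ₁], hcT⟩
  have hn₁ : σ₁.r (.k .n) = n := by simp [hσ₁]
  have hl₁ : σ₁.r (.k .last) = σ.r (.k .last) := by simp [hσ₁]
  have hc₁ : σ₁.r (.k .cur) = c := by simp [hσ₁, hc]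
  have ha₁ : σ₁.a = σ.a := rfl
  have hp₁ : pm σ₁ = pm σ := rfl
  have hcv₁ : cv σ₁ = cv σ := rfl
  clear_value σ₁
  refine wp_wr ((((Scr.refl σ₁).setR (by decide) _).setR (by decide) _).setR (by decide) _)
    hE₁ hW₁ (l := l) (by simp) (by simp; rfl) (by simp; rfl) fun s₂ σ₂ hs₂ h₂ => ?_
  have hE₂ := hE₁.frame h₂.frame
  rw [h₂.frame.kr, hn₁]
  refine wp_wr (((Scr.refl σ₂).setR (by decide) _).setR (by decide) _) hE₂ h₂.wfm
    (l := l + 1) (by simpa using h₂.lp) (by simp; rfl) (by simp; rfl) fun s₃ σ₃ hs₃ h₃ => ?_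
  have hE₃ := hE₂.frame h₃.frame
  refine (spec_sim hex hE₃ h₃.wfm h₃.lp (by rw [h₃.pm, h₂.pm, hp₁])).wp
    fun s₄ σ₄ hs₄ ⟨d, hd, h₄⟩ => ?_
  have h24 := (h₂.trans h₃).trans h₄
  have hE₄ := hE₃.frame h₄.frame
  rw [ev_rd _ hE₄, h₄.pm]
  have hE₅ : Env T c (σ₄.setR (.k .ans) (m' 0)) :=
    ⟨by simpa using hE₄.hT, by simpa using hE₄.hc, hcT⟩
  refine (spec_unwind (l := l) (d := 1 + 1 + d) hE₅ (h₄.wfm.setR (by decide) _) (by simpa using h24.lp)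
    (by rw [cv_setR, h24.arr _ (by decide) (by decide), hcv₁, hl]) (m := pm σ c)
    (by simp only [cv_setR, pm_setR]; rw [h₄.pm, h24.undo, hp₁])).wp fun s₅ σ₅ hs₅ h₅ => ?_
  rw [wp_out]
  have hkr : ∀ x, x ≠ .ans → σ₅.r (.k x) = σ₁.r (.k x) := fun x hx => by
    rw [h₅.frame.kr, ← h24.frame.kr]; simp [hx]
  refine ⟨?_, ?_, ?_, ?_, fun x => ?_, fun x => ?_, ?_, fun it' c' hc' cp' hR' => ?_⟩
  · simp at hs₂ hs₃ hs₅ ⊢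
    omega
  · simp [h₅.frame.kr]
  · rw [St.setOut_r, hkr _ (by decide), hl₁]
  · rw [St.setOut_r, hkr _ (by decide), hc₁, hc]
  · rw [St.setOut_a, h₅.frame.l, ← ha₁, ← h24.frame.l]; rfl
  · rw [St.setOut_a, h₅.frame.g, ← ha₁, ← h24.frame.g]; rfl
  · obtain ⟨ρ, ν, h⟩ := h₅.wfm
    exact ⟨ρ, ν, h⟩
  · have hpm : pm (σ₅.setOut ((Ex.reg (.k .ans)).ev σ₅)) = pm σ₅ := rfl
    have hcv : cv (σ₅.setOut ((Ex.reg (.k .ans)).ev σ₅)) = cv σ₅ := rfl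
    by_cases hcc : c' = c
    · subst hcc
      have harr : ∀ x, x ≠ .LA → x ≠ .LV → cv σ₅ T c' x = cv σ T c' x := fun x h1 h2 => by
        rw [h₅.arr x h1 h2, cv_setR, h24.arr x h1 h2, hcv₁]
      obtain ⟨⟨⟨l', h1, h2⟩, h3, h4, h5, h6⟩, hq'⟩ := hR'
      obtain rfl : l' = l := Nat.eq_of_mul_eq_mul_left hT0 (h1.symm.trans hl)
      refine ⟨⟨⟨l', ?_, ?_⟩, ?_, ?_, ?_, h6⟩, hq'.congr fun x hx => ?_⟩
      · rw [hcv, harr _ (by decide) (by decide), h1]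
      · rw [hcv, hpm, h₅.pm, harr .BND (by decide) (by decide), harr .STK (by decide) (by decide)]
        refine h2.congr (fun k hk => ?_) (fun _ _ => ⟨rfl, rfl⟩) fun _ _ => rfl
        obtain ⟨h7, h8⟩ := h₅.old k hk
        obtain ⟨h9, h10⟩ := h24.old k hk
        exact ⟨h7.trans (h9.trans (by rw [hcv₁])), h8.trans (h10.trans (by rw [hcv₁]))⟩
      · rw [hcv, harr _ (by decide) (by decide), h3]
      · rw [hcv, harr _ (by decide) (by decide)]; exact h4
      · rw [hcv, harr _ (by decide) (by decide)]; exact h5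
      · rw [hcv, harr x (by rintro rfl; cases hx) (by rintro rfl; cases hx)]
    · have hp : pm σ₅ c' = pm σ c' := by
        rw [h₅.frame.pm c' hc' hcc, pm_setR, h24.frame.pm c' hc' hcc, hp₁]
      have hv : ∀ x, cv σ₅ T c' x = cv σ T c' x := fun x => by
        rw [h₅.frame.cv c' hc' hcc, cv_setR, h24.frame.cv c' hc' hcc, hcv₁]
      exact ⟨hR'.stk.congr (by rw [hpm, hp]) (fun x _ => by rw [hcv, hv]) fun _ _ => rfl,
        hR'.q.congr fun x _ => by rw [hcv, hv]⟩

end Query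

/-! ### The invariant of the data structure and the last part of an update -/

section Finish

variable {ι : Type} {prim : ι → ℕ → ℕ → ℕ} {P : IncrementalAlg ι} {Pr : DynProblem}
  {n T Γ Q : ℕ} {it κ : ℕ → ℕ} {N J u x M : ℕ} {S : Finset ℕ} {L : ℕ → Finset ℕ}
  {σ σ' : St}

/-- The tables of items and of levels represent the current set of handles `S`. -/
structure GStat (Pr : DynProblem) (T N J M : ℕ) (it κ : ℕ → ℕ) (S : Finset ℕ) (L : ℕ → Finset ℕ)
    (σ : St) : Prop where
  lev : ∀ i < J, Lev (Kv N i) S (fun k => κ (T * k)) (L i)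
  rep : ∀ i < J, RepL T M i κ S (L i) σ 0
  item : ∀ k, σ.a (.g .ITEM) (T * k) = it k
  pred : σ.a (.g .PRED) = κ
  alive : ∀ k, σ.a (.g .ALIVE) (T * k) = if k ∈ S then 1 else 0
  par : ∀ v, 1 ≤ v → v ≤ 2 * M + 1 → σ.a (.g .PAR) (T * v) = T * (v / 2)
  hof : ∀ k ∈ S, σ.a (.g .HOF) (it k) = T * k
  mem : ∀ k ∈ S, 1 ≤ k ∧ k ≤ M
  items : ∀ k ∈ S, it k ∈ Pr.items
  inj : Set.InjOn it S
  last : σ.r (.k .last) = T * M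

/-- The copies of the incremental algorithm represent the current set of handles `S`. -/
structure GCop (prim : ι → ℕ → ℕ → ℕ) (P : IncrementalAlg ι) (Pr : DynProblem)
    (n T Γ N J u M : ℕ) (it κ : ℕ → ℕ) (S : Finset ℕ) (L : ℕ → Finset ℕ) (σ : St) : Prop where
  wfm : WFM T σ
  zc : ∀ i < J, σ.a (.l .ZC) i = u % 2 ^ i
  cc : ∀ i < J, σ.a (.l .CC) i = u / 2 ^ i % N
  copies : ∃ cp : ℕ → Cp, (∀ c < N, RepC prim P Pr n T Γ it c σ (cp c) ∧ WF J M S (cp c) ∧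
    CInv N J S (fun k => κ (T * k)) L u c (cp c) 0) ∧ ∃ c < N, σ.r (.k .cur) = c ∧ (cp c).ph = 0

theorem RepL.own {x i : ℕ} {F : Finset ℕ} (h : RepL T M i κ S F σ x)
    (hl : ∀ y : LArr, y.own = true → σ'.a (.l y) = σ.a (.l y)) : RepL T M i κ S F σ' x := by
  have hv : ∀ y : LArr, y.own = true → lv σ' T i y = lv σ T i y := fun y hy => by
    unfold lv; rw [hl y hy]
  exact ⟨by rw [hv _ rfl]; exact h.low, by rw [hv _ rfl]; exact h.sz,
    fun dir => by rw [hv _ (treeArr_own dir)]; exact h.tree dir,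
    fun dir => by rw [hv _ (treeArr_own dir)]; exact h.supp dir⟩

theorem GStat.congr (h : GStat Pr T N J M it κ S L σ)
    (hl : ∀ y : LArr, y.own = true → σ'.a (.l y) = σ.a (.l y))
    (hg : ∀ y, σ'.a (.g y) = σ.a (.g y)) (hlast : σ'.r (.k .last) = σ.r (.k .last)) :
    GStat Pr T N J M it κ S L σ' :=
  ⟨h.lev, fun i hi => (h.rep i hi).own hl, by rw [hg]; exact h.item, by rw [hg]; exact h.pred,
    by rw [hg]; exact h.alive, by rw [hg]; exact h.par, by rw [hg]; exact h.hof, h.mem, h.items,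
    h.inj, hlast.trans h.last⟩

theorem GStat.low (h : GStat Pr T N J M it κ S L σ) : Low N J S (fun k => κ (T * k)) L :=
  ⟨fun i hi => (h.lev i hi).card, fun i hi _ h1 h2 => (h.lev i hi).out h1 h2⟩

theorem GStat.senv (h : GStat Pr T N J M it κ S L σ) : SEnv T J Pr it S L σ :=
  ⟨fun k => by rw [h.alive]; split_ifs <;> simp [*],
    fun i hi k => by
      have := (h.rep i hi).low k
      rw [lv] at this
      rw [this]; split_ifs <;> simp [*], h.items, h.inj⟩

variable (P) in
/-- The last part of an update: an operation on all copies, and the choice of the copy that answers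
queries. -/
def finish (p : Cmd ι) : Cmd ι := copies P p ;; tick ;; choose

theorem spec_finish (hP : P.Solves prim Pr n T Γ Q) (hE : UEnv T n N J u x it Pr S L σ)
    (hpow : ∀ i < J, σ.a (.b .P2) i = 2 ^ i)
    (hNJ : N = J + 1) (hNT : N ≤ T) (hW : WFM T σ) {cp cp₁ : ℕ → Cp}
    (hR : ∀ c < N, RepC prim P Pr n T Γ it c σ (cp c))
    (hM : M ≤ T) (hMJ : M ≤ 2 ^ J) (hN : 2 ≤ N) (hL : GStat Pr T N J M it κ S L σ)
    (hwf : ∀ c < N, WF J M S (cp₁ c))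
    (hinv : ∀ c < N, CInv N J S (fun k => κ (T * k)) L (u + 1) c ((cp₁ c).starts N u c J) (250 * N))
    {p : Cmd ι} {b : ℕ} (hp : ∀ c < N, ∀ σ', CsFrame σ σ' → σ'.r (.k .c) = c → WFM T σ' →
      RepC prim P Pr n T Γ it c σ' (cp c) →
      Spec prim p σ' b (CpOp prim P Pr n T Γ it c σ' · (cp₁ c))) :
    Spec prim (finish P p) σ (N * (b + J * 150 + 250 * N * (1020 * (Γ + 1)) + 60) + J * 200 +
      N * 60 + 60) fun σ' => GStat Pr T N J M it κ S L σ' ∧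
        GCop prim P Pr n T Γ N J (u + 1) M it κ S L σ' := by
  apply Spec.of_wp
  simp only [finish, wp_seq]
  refine (spec_copies hP hE hNT hW hR hM hMJ hN hL.low hwf hinv hp).wp
    fun s₁ σ₁ hs₁ ⟨hW₁, hF₁, cp', hcp⟩ => ?_
  have hE₁ := hE.frame hF₁
  refine (spec_tick (u := u) (N := N) (by omega) hE₁.hJ hE₁.hN (by rw [hF₁.b]; exact hpow) hE₁.zc
    hE₁.cc).wp fun s₂ σ₂ hs₂ ⟨hF₂, hzc, hcc⟩ => ?_
  have hR₂ : ∀ c < N, RepC prim P Pr n T Γ it c σ₂ (cp' c) := fun c hc => by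
    have hpm : pm σ₂ c = pm σ₁ c := by unfold pm; rw [hF₂.m, hF₂.m]
    have hcv : ∀ y, cv σ₂ T c y = cv σ₁ T c y := fun y => by unfold cv; rw [hF₂.c]
    exact ⟨(hcp c hc).1.stk.congr hpm (fun y _ => hcv y) fun _ _ => rfl,
      (hcp c hc).1.q.congr fun y _ => hcv y⟩
  have hph : ∀ c < N, σ₂.a (.c .PH) c = (cp' c).ph := fun c hc => by
    rw [← cv_zero σ₂ T, (hR₂ c hc).q.ph]
  obtain ⟨c₀, hc₀, hc₀'⟩ := exists_idle hNJ fun c hc => (hcp c hc).2.2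
  refine (spec_choose (N := N) (by rw [hF₂.kr _ (by decide), hE₁.hN])
    ⟨c₀, hc₀, by rw [hph _ hc₀, hc₀']⟩).wp fun s₃ σ₃ hs₃ ⟨⟨c, hc, h1, h2⟩, h3, h4⟩ => ?_
  refine ⟨by omega, hL.congr (fun y hy => ?_) (fun y => ?_) ?_, ⟨?_, by rwa [h4], by rwa [h4],
    cp', fun c' hc' => ⟨?_, (hcp c' hc').2⟩, c, hc, h1, by rw [← hph c hc, h2]⟩⟩
  · rw [h4, hF₂.l y hy, hF₁.l]
  · rw [h4, hF₂.g, hF₁.g]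
  · rw [h3 _ (by decide) (by decide), hF₂.kr _ (by decide), hF₁.kr _ (by decide) (by decide)
      (by decide)]
  · obtain ⟨ρ, ν, h⟩ := hW₁
    refine ⟨ρ, ν, ?_⟩
    rw [h4, h3 _ (by decide) (by decide), hF₂.m, hF₂.m, hF₂.next]
    exact h
  · have hpm : pm σ₃ c' = pm σ₂ c' := by unfold pm; rw [h4]
    have hcv : ∀ y, cv σ₃ T c' y = cv σ₂ T c' y := fun y => by unfold cv; rw [h4]
    exact ⟨(hR₂ c' hc').stk.congr hpm (fun y _ => hcv y) fun _ _ => rfl,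
      (hR₂ c' hc').q.congr fun y _ => hcv y⟩

end Finish

/-! ### Insertions -/

section Updates

variable {ι : Type} {prim : ι → ℕ → ℕ → ℕ} {P : IncrementalAlg ι} {Pr : DynProblem}
  {n T Γ Q : ℕ} {it κ : ℕ → ℕ} {N J u x d M : ℕ} {S : Finset ℕ} {L : ℕ → Finset ℕ}
  {σ σ' : St}

/-- Creates a handle for the new item. -/
def newItem : Cmd ι :=
  .set (.k .last) (.k .last + .k .T) ;;
  .set (.k .hx) (.k .last) ;;
  .put (.g .ITEM) (.k .hx) (.k .X) ;;
  .put (.g .PRED) (.k .hx) (.k .D) ;;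
  .put (.g .ALIVE) (.k .hx) (.lit 1) ;;
  .put (.g .HOF) (.k .X) (.k .hx) ;;
  .put (.g .PAR) (.k .hx + .k .hx) (.k .hx) ;;
  .put (.g .PAR) (.k .hx + .k .hx + .k .T) (.k .hx)

/-- Looks up the handle of the item, and marks it as deleted. -/
def oldItem : Cmd ι :=
  .set (.k .hx) (.get (.g .HOF) (.k .X)) ;; .put (.g .ALIVE) (.k .hx) (.lit 0)

/-- Only the tables of items, and the registers for them, have changed. -/
structure IFrame (σ σ' : St) : Prop where
  kr : ∀ x, x ≠ .last → x ≠ .hx → σ'.r (.k x) = σ.r (.k x)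
  next : σ'.r (.s .next) = σ.r (.s .next)
  c : ∀ x, σ'.a (.c x) = σ.a (.c x)
  l : ∀ x, σ'.a (.l x) = σ.a (.l x)
  b : ∀ x, σ'.a (.b x) = σ.a (.b x)
  m : ∀ x, σ'.a (.m x) = σ.a (.m x)

/-- A new node is entered as the parent of its two future children. Thus the parents of all nodes up
to `2 * M + 1` are known without division. -/
theorem spec_newItem (hT : σ.r (.k .T) = T) (hl : σ.r (.k .last) = T * M) (hx : σ.r (.k .X) = x)
    (hd : σ.r (.k .D) = d) :
    Spec prim newItem σ 200 fun σ' => IFrame σ σ' ∧ σ'.r (.k .last) = T * (M + 1) ∧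
      σ'.r (.k .hx) = T * (M + 1) ∧
      σ'.a (.g .ITEM) = Function.update (σ.a (.g .ITEM)) (T * (M + 1)) x ∧
      σ'.a (.g .PRED) = Function.update (σ.a (.g .PRED)) (T * (M + 1)) d ∧
      σ'.a (.g .ALIVE) = Function.update (σ.a (.g .ALIVE)) (T * (M + 1)) 1 ∧
      σ'.a (.g .HOF) = Function.update (σ.a (.g .HOF)) x (T * (M + 1)) ∧
      σ'.a (.g .PAR) = Function.update (Function.update (σ.a (.g .PAR)) (T * (2 * (M + 1)))
        (T * (M + 1))) (T * (2 * (M + 1) + 1)) (T * (M + 1)) := by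
  have h1 : T * M + T = T * (M + 1) := by ring
  have h2 : T * (M + 1) + T * (M + 1) = T * (2 * (M + 1)) := by ring
  have h3 : T * (2 * (M + 1)) + T = T * (2 * (M + 1) + 1) := by ring
  apply Spec.of_wp
  simp only [newItem, wp_seq, wp_set, wp_put, Ex.ev_add, Ex.ev_reg, Ex.ev_lit, St.setR_r, St.setA_r,
    reduceCtorEq, Reg.k.injEq, if_false, if_true, hT, hl, hx, hd, h1, h2, h3]
  refine ⟨by simp, ⟨fun y h4 h5 => by simp [h4, h5], by simp, by simp, by simp, by simp, by simp⟩,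
    by simp, by simp, by simp, by simp, by simp, by simp, by simp⟩

theorem spec_oldItem {k : ℕ} (hx : σ.r (.k .X) = x) (hh : σ.a (.g .HOF) x = T * k) :
    Spec prim oldItem σ 40 fun σ' => IFrame σ σ' ∧ σ'.r (.k .last) = σ.r (.k .last) ∧
      σ'.r (.k .hx) = T * k ∧ (∀ y, y ≠ .ALIVE → σ'.a (.g y) = σ.a (.g y)) ∧
      σ'.a (.g .ALIVE) = Function.update (σ.a (.g .ALIVE)) (T * k) 0 := by
  apply Spec.of_wp
  simp only [oldItem, wp_seq, wp_set, wp_put, Ex.ev_get, Ex.ev_reg, Ex.ev_lit, St.setR_r,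
    if_true, hx, hh]
  exact ⟨by simp, ⟨fun y h4 h5 => by simp [h5], by simp, by simp, by simp, by simp, by simp⟩,
    by simp, by simp, fun y hy => by simp [hy], by simp⟩

theorem RepC.of_eq {it' : ℕ → ℕ} {c : ℕ} {cp : Cp} (h : RepC prim P Pr n T Γ it c σ cp)
    (hc : ∀ x, σ'.a (.c x) = σ.a (.c x)) (hm : ∀ x, σ'.a (.m x) = σ.a (.m x))
    (hi : ∀ e ∈ cp.stk, it' e.1 = it e.1) : RepC prim P Pr n T Γ it' c σ' cp := by
  have hpm : pm σ' c = pm σ c := by unfold pm; rw [hm, hm]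
  have hcv : ∀ y, cv σ' T c y = cv σ T c y := fun y => by unfold cv; rw [hc]
  exact ⟨h.stk.congr hpm (fun y _ => hcv y) hi, h.q.congr fun y _ => hcv y⟩

theorem WFM.of_eq (h : WFM T σ) (hm : ∀ x, σ'.a (.m x) = σ.a (.m x))
    (hn : σ'.r (.s .next) = σ.r (.s .next)) : WFM T σ' := by
  obtain ⟨ρ, ν, h⟩ := h
  exact ⟨ρ, ν, by rwa [hm, hm, hn]⟩

/-- The data structure represents the current set of handles `S`. -/
structure GRep (prim : ι → ℕ → ℕ → ℕ) (P : IncrementalAlg ι) (Pr : DynProblem)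
    (n T Γ N J u M : ℕ) (it κ : ℕ → ℕ) (S : Finset ℕ) (σ : St) : Prop where
  le : M ≤ u
  rep : ∃ L, GStat Pr T N J M it κ S L σ ∧ GCop prim P Pr n T Γ N J u M it κ S L σ

/-- The numbers of levels and copies. -/
structure Dims (T N J : ℕ) : Prop where
  hT : 2 ≤ T
  hJ : J = Nat.clog 2 T
  hN : N = J + 1

theorem Dims.le_pow (h : Dims T N J) : T ≤ 2 ^ J := by
  rw [h.hJ]; exact Nat.le_pow_clog (by norm_num) T

theorem Dims.one_le (h : Dims T N J) : 1 ≤ J := by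
  have h1 := h.le_pow
  have h2 := h.hT
  rcases Nat.eq_zero_or_pos J with h0 | h0
  · rw [h0] at h1; omega
  · exact h0

/-- Needed because the numbers of copies and levels serve as column indices below `T`. It follows
from `J - 1 < 2 ^ (J - 1) < T`. -/
theorem Dims.le (h : Dims T N J) : N ≤ T := by
  have h1 : 2 ^ (J - 1) < T := Nat.pow_lt_of_lt_clog (by have := h.one_le; have := h.hJ; omega)
  have h2 : J - 1 < 2 ^ (J - 1) := Nat.lt_two_pow_self
  have := h.hN
  omega

variable (P) in
/-- The program for insertions. -/
def insProg : Cmd ι :=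
  .set (.k .T) (.arg 3) ;; .set (.k .n) (.arg 2) ;; .set (.k .X) (.arg 0) ;; .set (.k .D) (.arg 1) ;;
  tables ;; newItem ;; levels levelIns ;; finish P (insOp P)

variable (P) in
/-- The program for deletions. -/
def delProg : Cmd ι :=
  .set (.k .T) (.arg 2) ;; .set (.k .n) (.arg 1) ;; .set (.k .X) (.arg 0) ;;
  tables ;; oldItem ;; levels levelDel ;; finish P (remove P)

theorem GStat.newItem (h : GStat Pr T N J M it κ S L σ) {it' κ' : ℕ → ℕ} {L' : ℕ → Finset ℕ}
    (hT : 0 < T) (hit : it' = Function.update it (M + 1) x)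
    (hκ : κ' = Function.update κ (T * (M + 1)) d)
    (hx : x ∈ Pr.items) (hxS : ∀ k ∈ S, it k ≠ x)
    (hlev : ∀ i < J, Lev (Kv N i) (insert (M + 1) S) (fun k => κ' (T * k)) (L' i))
    (hrep : ∀ i < J, RepL T (M + 1) i κ' (insert (M + 1) S) (L' i) σ' 0)
    (hlast : σ'.r (.k .last) = T * (M + 1))
    (h1 : σ'.a (.g .ITEM) = Function.update (σ.a (.g .ITEM)) (T * (M + 1)) x)
    (h2 : σ'.a (.g .PRED) = Function.update (σ.a (.g .PRED)) (T * (M + 1)) d)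
    (h3 : σ'.a (.g .ALIVE) = Function.update (σ.a (.g .ALIVE)) (T * (M + 1)) 1)
    (h4 : σ'.a (.g .HOF) = Function.update (σ.a (.g .HOF)) x (T * (M + 1)))
    (h5 : σ'.a (.g .PAR) = Function.update (Function.update (σ.a (.g .PAR)) (T * (2 * (M + 1)))
        (T * (M + 1))) (T * (2 * (M + 1) + 1)) (T * (M + 1))) :
    GStat Pr T N J (M + 1) it' κ' (insert (M + 1) S) L' σ' := by
  have hinj : ∀ k l, T * k = T * l ↔ k = l := fun k l => Nat.mul_right_inj hT.ne'
  have hne : ∀ k ∈ S, k ≠ M + 1 := fun k hk => by have := (h.mem k hk).2; omega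
  have hitS : ∀ k ∈ S, it' k = it k := fun k hk => by
    rw [hit, Function.update_of_ne (hne k hk)]
  have hitM : it' (M + 1) = x := by rw [hit, Function.update_self]
  refine ⟨hlev, hrep, fun k => ?_, by rw [h2, h.pred, hκ], fun k => ?_, fun v hv1 hv2 => ?_,
    fun k hk => ?_, fun k hk => ?_, fun k hk => ?_, ?_, hlast⟩
  · simp only [h1, hit, Function.update_apply, hinj, h.item]
  · simp only [h3, Function.update_apply, hinj, h.alive, Finset.mem_insert]
    by_cases hk : k = M + 1 <;> simp [hk]
  · simp only [h5, Function.update_apply, hinj]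
    split_ifs with h6 h7
    · congr 1; omega
    · congr 1; omega
    · exact h.par v hv1 (by omega)
  · rw [h4]
    rcases Finset.mem_insert.1 hk with rfl | hk
    · rw [hitM, Function.update_self]
    · rw [hitS k hk, Function.update_of_ne (hxS k hk), h.hof k hk]
  · rcases Finset.mem_insert.1 hk with rfl | hk
    · omega
    · have := h.mem k hk; omega
  · rcases Finset.mem_insert.1 hk with rfl | hk
    · rwa [hitM]
    · rw [hitS k hk]; exact h.items k hk
  · intro k hk l hl hkl
    rcases Finset.mem_insert.1 (Finset.mem_coe.1 hk) with rfl | hk <;>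
      rcases Finset.mem_insert.1 (Finset.mem_coe.1 hl) with rfl | hl
    · rfl
    · rw [hitM, hitS l hl] at hkl; exact absurd hkl.symm (hxS l hl)
    · rw [hitM, hitS k hk] at hkl; exact absurd hkl (hxS k hk)
    · rw [hitS k hk, hitS l hl] at hkl; exact h.inj hk hl hkl

/-- The main term is the background work, `250 * N` elementary steps on each of `N` copies, or
`255000 * N * N * G`. -/
theorem ins_cost {G : ℕ} (hJ : J ≤ N) (hN : 2 ≤ N) (hG : 1 ≤ G) :
    40 + 500 * (J + 1) + 200 + (J * (1500 * (N + 1) + 20) + 20) +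
      (N * (800 * G + J * 150 + 250 * N * (1020 * G) + 60) + J * 200 + N * 60 + 60) ≤
    300000 * (N * N * G) := by
  have e1 : N * N * 1 ≤ N * N * G := Nat.mul_le_mul_left _ hG
  have e2 : N * 2 ≤ N * N := Nat.mul_le_mul_left _ hN
  have e3 : J * N ≤ N * N := Nat.mul_le_mul_right _ hJ
  have e4 : N * G * 1 ≤ N * G * N := Nat.mul_le_mul_left _ (by omega)
  linarith

theorem spec_insProg (hP : P.Solves prim Pr n T Γ Q) (hD : Dims T N J)
    (hG : GRep prim P Pr n T Γ N J u M it κ S σ) (hu : u < T) (hx : x ∈ Pr.items)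
    (hxS : ∀ k ∈ S, it k ≠ x) (h0 : σ.io 0 = x) (h1 : σ.io 1 = d) (h2 : σ.io 2 = n)
    (h3 : σ.io 3 = T) :
    Spec prim (insProg P) σ (300000 * (N * N * (Γ + 1))) (GRep prim P Pr n T Γ N J (u + 1) (M + 1)
      (Function.update it (M + 1) x) (Function.update κ (T * (M + 1)) d) (insert (M + 1) S)) := by
  obtain ⟨hMu, L, hS, hW, hzc, hcc, cp, hcp, hcur⟩ := hG
  have hJ1 := hD.one_le
  have hNT := hD.le
  have hpow := hD.le_pow
  have hNJ := hD.hN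
  have hT := hD.hT
  have hpowN : 2 ^ N = 2 * 2 ^ J := by rw [hNJ, pow_succ]; ring
  have hMS : M + 1 ∉ S := fun h => by have := (hS.mem _ h).2; omega
  set it' := Function.update it (M + 1) x with hit'
  set κ' := Function.update κ (T * (M + 1)) d with hκ'
  have hκS : ∀ k ∈ S, κ' (T * k) = κ (T * k) := fun k hk => by
    rw [hκ', Function.update_of_ne]
    have := (hS.mem k hk).2
    rw [ne_eq, Nat.mul_right_inj (by omega)]; omega
  apply Spec.of_wp
  simp only [insProg, wp_seq, wp_set, Ex.ev_arg, St.setR_io, h0, h1, h2, h3]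
  set σ₁ := (((σ.setR (.k .T) T).setR (.k .n) n).setR (.k .X) x).setR (.k .D) d with hσ₁
  have hT₁ : σ₁.r (.k .T) = T := by simp [hσ₁]
  have hn₁ : σ₁.r (.k .n) = n := by simp [hσ₁]
  have hX₁ : σ₁.r (.k .X) = x := by simp [hσ₁]
  have hD₁ : σ₁.r (.k .D) = d := by simp [hσ₁]
  have hl₁ : σ₁.r (.k .last) = T * M := by simp [hσ₁, hS.last]
  have hnx₁ : σ₁.r (.s .next) = σ.r (.s .next) := by simp [hσ₁]
  have ha₁ : σ₁.a = σ.a := rfl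
  clear_value σ₁
  refine (spec_tables hT₁ hD.hJ).wp fun s₂ σ₂ hs₂ ⟨⟨hJ₂, hN₂, hW₂, hp₂, hc₂⟩, hF₂⟩ => ?_
  rw [← hNJ] at hN₂ hW₂ hc₂
  refine (spec_newItem (x := x) (d := d) (M := M) ((hF₂.kr _ rfl).trans hT₁)
    ((hF₂.kr _ rfl).trans hl₁) ((hF₂.kr _ rfl).trans hX₁) ((hF₂.kr _ rfl).trans hD₁)).wp
    fun s₃ σ₃ hs₃ ⟨hF₃, hl₃, hh₃, hI₃, hP₃, hA₃, hH₃, hR₃⟩ => ?_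
  have hkr₃ : ∀ y : KReg, y.aux = false → y ≠ .last → y ≠ .hx → σ₃.r (.k y) = σ₁.r (.k y) :=
    fun y h4 h5 h6 => (hF₃.kr y h5 h6).trans (hF₂.kr y h4)
  simp only [hF₂.g, ha₁] at hI₃ hP₃ hA₃ hH₃ hR₃
  -- the part of the new invariant that does not depend on the levels
  have hrep₃ : ∀ i < J, RepL T (M + 1) i κ' S (L i) σ₃ 0 := fun i hi => by
    have hv : ∀ y, lv σ₃ T i y = lv σ T i y := fun y => by
      unfold lv; rw [hF₃.l, hF₂.l, ha₁]
    obtain ⟨h4, h5, h6, h7⟩ := (hS.rep i hi).congr hv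
    refine ⟨h4, h5, fun dir => (h6 dir).congr_key (h7 dir) fun b hb => hκS b ?_,
      fun dir v hv => h7 dir v (by omega)⟩
    cases dir
    · exact (Finset.mem_sdiff.1 hb).1
    · exact (hS.lev i hi).sub hb
  have halive₃ : ∀ k, σ₃.a (.g .ALIVE) (T * k) = if k ∈ insert (M + 1) S then 1 else 0 := fun k => by
    simp only [hA₃, Function.update_apply, Nat.mul_right_inj (show T ≠ 0 by omega), hS.alive,
      Finset.mem_insert]
    by_cases hk : k = M + 1 <;> simp [hk]
  refine (spec_levels (b := 1500 * (N + 1)) (K := Kv N) (S' := insert (M + 1) S) (by omega)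
    (by rw [hF₃.kr _ (by decide) (by decide), hJ₂]) hrep₃ fun i hi σ' hF hi' hR => ?_).wp
    fun s₄ σ₄ hs₄ ⟨L', hlev, hrep, hdiff, hF₄⟩ => ?_
  · refine spec_levelIns ⟨?_, hi', by omega, ?_, ?_, fun v hv1 hv2 => ?_⟩ (by omega) hR (hS.lev i hi)
      ?_ ?_ hMS le_rfl hκS fun k hk => ?_
    · rw [hF.kr _ (by decide), hkr₃ _ rfl (by decide) (by decide), hT₁]
    · rw [hF.g, hP₃, hS.pred]
    · rw [hF.g]; exact halive₃
    · rw [hF.g, hR₃]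
      rw [Function.update_of_ne, Function.update_of_ne, hS.par v hv1 (by omega)] <;>
      · rw [ne_eq, Nat.mul_right_inj (by omega)]; omega
    · rw [hF.b, hF₃.b, hc₂ i hi]
    · rw [hF.kr _ (by decide), hh₃]
    · rcases Finset.mem_insert.1 hk with rfl | hk
      · omega
      · have := hS.mem k hk; omega
  have hkr₄ : ∀ y : KReg, y.aux = false → y ≠ .last → y ≠ .hx → σ₄.r (.k y) = σ₁.r (.k y) :=
    fun y h4 h5 h6 => (hF₄.kr y (by rintro rfl; cases h4)).trans (hkr₃ y h4 h5 h6)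
  have hcarr : ∀ y, σ₄.a (.c y) = σ.a (.c y) := fun y => by rw [hF₄.c, hF₃.c, hF₂.c, ha₁]
  have hmarr : ∀ y, σ₄.a (.m y) = σ.a (.m y) := fun y => by rw [hF₄.m, hF₃.m, hF₂.m, ha₁]
  have hS₄ : GStat Pr T N J (M + 1) it' κ' (insert (M + 1) S) L' σ₄ :=
    hS.newItem (by omega) hit' hκ' hx hxS hlev hrep
      (by rw [hF₄.kr _ (by decide), hl₃]) (by rw [hF₄.g, hI₃]) (by rw [hF₄.g, hP₃])
      (by rw [hF₄.g, hA₃]) (by rw [hF₄.g, hH₃]) (by rw [hF₄.g, hR₃])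
  have hitS : ∀ k ∈ S, it' k = it k := fun k hk => by
    rw [hit', Function.update_of_ne]; have := (hS.mem k hk).2; omega
  have hE₄ : UEnv T n N J u (M + 1) it' Pr (insert (M + 1) S) L' σ₄ :=
    ⟨by rw [hkr₄ _ rfl (by decide) (by decide), hT₁],
      by rw [hkr₄ _ rfl (by decide) (by decide), hn₁],
      by rw [hF₄.kr _ (by decide), hF₃.kr _ (by decide) (by decide), hN₂],
      by rw [hF₄.kr _ (by decide), hF₃.kr _ (by decide) (by decide), hJ₂],
      by rw [hF₄.kr _ (by decide), hF₃.kr _ (by decide) (by decide), hW₂],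
      by rw [hF₄.kr _ (by decide), hh₃], hS₄.item,
      by rw [hF₄.zc, hF₃.l, hF₂.l, ha₁]; exact hzc, by rw [hF₄.cc, hF₃.l, hF₂.l, ha₁]; exact hcc,
      hS₄.senv⟩
  have hwf : ∀ c < N, WF J (M + 1) (insert (M + 1) S) ((cp c).ins (M + 1)) := fun c hc =>
    (hcp c hc).2.1.ins (by omega)
  refine (spec_finish (b := 800 * (Γ + 1)) (cp := cp) (cp₁ := fun c => (cp c).ins (M + 1)) hP hE₄
    (fun i hi => by rw [hF₄.b, hF₃.b, hp₂ i hi]) hNJ hNT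
    (hW.of_eq hmarr (by rw [hF₄.next, hF₃.next, hF₂.next, hnx₁]))
    (fun c hc => (hcp c hc).1.of_eq hcarr hmarr fun e he => hitS _ ((hcp c hc).2.1.sub e he))
    (by omega) (by omega) (by omega) hS₄ hwf
    (fun c hc => (hcp c hc).2.2.advance (hcp c hc).2.1 (by omega) (by omega) hc
      (Upd.ins (hcp c hc).2.1 hκS hdiff) (hwf c hc) (by omega))
    fun c hc σ' hF hc' hW' hR' => spec_insOp hP (hE₄.frame hF) hc' (by omega) hW' hR' rfl
      (hcp c hc).2.1.sub hMS ?_).wp fun s₅ σ₅ hs₅ ⟨h4, h5⟩ => ⟨?_, by omega, L', h4, h5⟩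
  · have := (hcp c hc).2.1.len; omega
  · simp only [Ex.cost_arg] at hs₂
    have hb : s₅ ≤ 40 + 500 * (J + 1) + 200 + (J * (1500 * (N + 1) + 20) + 20) +
        (N * (800 * (Γ + 1) + J * 150 + 250 * N * (1020 * (Γ + 1)) + 60) + J * 200 + N * 60 + 60) := by
      omega
    refine hb.trans ?_
    exact ins_cost (by omega) (by omega) (by omega)

end Updates

/-! ### Deletions, the initial state, and queries -/

section Deletion

variable {ι : Type} {prim : ι → ℕ → ℕ → ℕ} {P : IncrementalAlg ι} {Pr : DynProblem}
  {n T Γ Q : ℕ} {it κ : ℕ → ℕ} {N J u k M : ℕ} {S : Finset ℕ} {L : ℕ → Finset ℕ}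
  {σ σ' : St}

/-- Besides the background work, each of the `N` copies reaches down to depth `35 * (N + η)`; this
is where the factor `1 + η` comes from. -/
theorem del_cost {G η : ℕ} (hJ : J ≤ N) (hN : 2 ≤ N) (hG : 1 ≤ G) :
    30 + 500 * (J + 1) + 40 + (J * (1500 * (N + 1) + 20) + 20) +
      (N * ((35 * (N + η) + 1) * (2000 * G) + J * 150 + 250 * N * (1020 * G) + 60) + J * 200 +
        N * 60 + 60) ≤ 400000 * (N * N * G * (1 + η)) := by
  have e1 : N * N * 1 ≤ N * N * G := Nat.mul_le_mul_left _ hG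
  have e2 : N * 2 ≤ N * N := Nat.mul_le_mul_left _ hN
  have e3 : J * N ≤ N * N := Nat.mul_le_mul_right _ hJ
  have e4 : N * G * 1 ≤ N * G * N := Nat.mul_le_mul_left _ (by omega)
  have e5 : N * (G * η) * 1 ≤ N * (G * η) * N := Nat.mul_le_mul_left _ (by omega)
  have e6 : N * J ≤ N * N := Nat.mul_le_mul_left _ hJ
  have e7 := Nat.zero_le (N * (G * η) * N)
  nlinarith only [e1, e2, e3, e4, e5, e6, e7, hJ, hN]

theorem spec_delProg (hP : P.Solves prim Pr n T Γ Q) (hD : Dims T N J)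
    (hG : GRep prim P Pr n T Γ N J u M it κ S σ) (hu : u < T) (hk : k ∈ S) (h0 : σ.io 0 = it k)
    (h1 : σ.io 1 = n) (h2 : σ.io 2 = T) :
    Spec prim (delProg P) σ
      (400000 * (N * N * (Γ + 1) * (1 + rank S (fun k => κ (T * k)) k)))
      (GRep prim P Pr n T Γ N J (u + 1) M it κ (S.erase k)) := by
  obtain ⟨hMu, L, hS, hW, hzc, hcc, cp, hcp, hcur⟩ := hG
  have hJ1 := hD.one_le
  have hNT := hD.le
  have hpow := hD.le_pow
  have hNJ := hD.hN
  have hT := hD.hT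
  have hpowN : 2 ^ N = 2 * 2 ^ J := by rw [hNJ, pow_succ]; ring
  apply Spec.of_wp
  simp only [delProg, wp_seq, wp_set, Ex.ev_arg, St.setR_io, h0, h1, h2]
  set σ₁ := ((σ.setR (.k .T) T).setR (.k .n) n).setR (.k .X) (it k) with hσ₁
  have hT₁ : σ₁.r (.k .T) = T := by simp [hσ₁]
  have hn₁ : σ₁.r (.k .n) = n := by simp [hσ₁]
  have hX₁ : σ₁.r (.k .X) = it k := by simp [hσ₁]
  have hl₁ : σ₁.r (.k .last) = T * M := by simp [hσ₁, hS.last]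
  have hnx₁ : σ₁.r (.s .next) = σ.r (.s .next) := by simp [hσ₁]
  have ha₁ : σ₁.a = σ.a := rfl
  clear_value σ₁
  refine (spec_tables hT₁ hD.hJ).wp fun s₂ σ₂ hs₂ ⟨⟨hJ₂, hN₂, hW₂, hp₂, hc₂⟩, hF₂⟩ => ?_
  rw [← hNJ] at hN₂ hW₂ hc₂
  refine (spec_oldItem (T := T) (x := it k) (k := k) ((hF₂.kr _ rfl).trans hX₁)
    (by rw [hF₂.g, ha₁, hS.hof k hk])).wp fun s₃ σ₃ hs₃ ⟨hF₃, hl₃, hh₃, hg₃, hA₃⟩ => ?_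
  have hkr₃ : ∀ y : KReg, y.aux = false → y ≠ .last → y ≠ .hx → σ₃.r (.k y) = σ₁.r (.k y) :=
    fun y h4 h5 h6 => (hF₃.kr y h5 h6).trans (hF₂.kr y h4)
  simp only [hF₂.g, ha₁] at hA₃ hg₃
  have halive₃ : ∀ j, σ₃.a (.g .ALIVE) (T * j) = if j ∈ S.erase k then 1 else 0 := fun j => by
    simp only [hA₃, Function.update_apply, Nat.mul_right_inj (show T ≠ 0 by omega), hS.alive,
      Finset.mem_erase]
    by_cases hj : j = k <;> simp [hj]
  refine (spec_levels (b := 1500 * (N + 1)) (K := Kv N) (S' := S.erase k) (M := M) (κ := κ) (S := S)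
    (L := L) (by omega) (by rw [hF₃.kr _ (by decide) (by decide), hJ₂])
    (fun i hi => (hS.rep i hi).own fun y _ => by rw [hF₃.l, hF₂.l, ha₁])
    fun i hi σ' hF hi' hR => ?_).wp fun s₄ σ₄ hs₄ ⟨L', hlev, hrep, hdiff, hF₄⟩ => ?_
  · refine spec_levelDel ⟨?_, hi', by omega, ?_, ?_, fun v hv1 hv2 => ?_⟩ (by omega) hR (hS.lev i hi)
      ?_ ?_ hk hS.mem
    · rw [hF.kr _ (by decide), hkr₃ _ rfl (by decide) (by decide), hT₁]
    · rw [hF.g, hg₃ _ (by decide), hS.pred]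
    · rw [hF.g]; exact halive₃
    · rw [hF.g, hg₃ _ (by decide), hS.par v hv1 (by omega)]
    · rw [hF.b, hF₃.b, hc₂ i hi]
    · rw [hF.kr _ (by decide), hh₃]
  have hkr₄ : ∀ y : KReg, y.aux = false → y ≠ .last → y ≠ .hx → σ₄.r (.k y) = σ₁.r (.k y) :=
    fun y h4 h5 h6 => (hF₄.kr y (by rintro rfl; cases h4)).trans (hkr₃ y h4 h5 h6)
  have hcarr : ∀ y, σ₄.a (.c y) = σ.a (.c y) := fun y => by rw [hF₄.c, hF₃.c, hF₂.c, ha₁]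
  have hmarr : ∀ y, σ₄.a (.m y) = σ.a (.m y) := fun y => by rw [hF₄.m, hF₃.m, hF₂.m, ha₁]
  have hS₄ : GStat Pr T N J M it κ (S.erase k) L' σ₄ := by
    have hg : ∀ y, y ≠ .ALIVE → σ₄.a (.g y) = σ.a (.g y) := fun y hy => by rw [hF₄.g, hg₃ y hy]
    refine ⟨hlev, hrep, by rw [hg _ (by decide)]; exact hS.item, by rw [hg _ (by decide)]; exact hS.pred,
      by rw [hF₄.g]; exact halive₃, by rw [hg _ (by decide)]; exact hS.par,
      fun j hj => by rw [hg _ (by decide)]; exact hS.hof j (Finset.mem_of_mem_erase hj),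
      fun j hj => hS.mem j (Finset.mem_of_mem_erase hj),
      fun j hj => hS.items j (Finset.mem_of_mem_erase hj),
      hS.inj.mono (Finset.coe_subset.2 (Finset.erase_subset ..)), ?_⟩
    rw [hF₄.kr _ (by decide), hl₃, hF₂.kr _ rfl, hl₁]
  have hE₄ : UEnv T n N J u k it Pr (S.erase k) L' σ₄ :=
    ⟨by rw [hkr₄ _ rfl (by decide) (by decide), hT₁],
      by rw [hkr₄ _ rfl (by decide) (by decide), hn₁],
      by rw [hF₄.kr _ (by decide), hF₃.kr _ (by decide) (by decide), hN₂],
      by rw [hF₄.kr _ (by decide), hF₃.kr _ (by decide) (by decide), hJ₂],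
      by rw [hF₄.kr _ (by decide), hF₃.kr _ (by decide) (by decide), hW₂],
      by rw [hF₄.kr _ (by decide), hh₃], hS₄.item,
      by rw [hF₄.zc, hF₃.l, hF₂.l, ha₁]; exact hzc, by rw [hF₄.cc, hF₃.l, hF₂.l, ha₁]; exact hcc,
      hS₄.senv⟩
  have hwf : ∀ c < N, WF J M (S.erase k) ((cp c).del k) := fun c hc => (hcp c hc).2.1.del k
  refine (spec_finish (b := (35 * (N + rank S (fun k => κ (T * k)) k) + 1) * (2000 * (Γ + 1)))
    (cp := cp) (cp₁ := fun c => (cp c).del k) hP hE₄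
    (fun i hi => by rw [hF₄.b, hF₃.b, hp₂ i hi]) hNJ hNT
    (hW.of_eq hmarr (by rw [hF₄.next, hF₃.next, hF₂.next, hnx₁]))
    (fun c hc => (hcp c hc).1.of_eq hcarr hmarr fun _ _ => rfl)
    (by omega) (by omega) (by omega) hS₄ hwf
    (fun c hc => (hcp c hc).2.2.advance (hcp c hc).2.1 (by omega) (by omega) hc
      (Upd.del (hcp c hc).2.1 hdiff) (hwf c hc) (by omega))
    fun c hc σ' hF hc' hW' hR' => spec_delOp hP (hE₄.frame hF) hc' (by omega) hW' hR'
      (Okay.of_mem (hcp c hc).2.1.sub hR'.stk.nodup hS.items hS.inj ?_)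
      fun d e hd he => ?_).wp fun s₅ σ₅ hs₅ ⟨h4, h5⟩ => ⟨?_, by omega, L', h4, h5⟩
  · have := (hcp c hc).2.1.len; omega
  -- The depth bound refers to the set before the deletion, in which the rank of the handle is its
  -- prediction error.
  · have := (hcp c hc).2.2.depth (hcp c hc).2.1 (by omega) (by omega) hd
    rwa [he] at this
  · simp only [Ex.cost_arg] at hs₂
    refine le_trans ?_ (del_cost (J := J) (N := N) (by omega) (by omega) (by omega))
    omega

/-- The initial state. -/
def St.init : St := ⟨fun _ => 0, fun _ => 0, fun _ _ => 0⟩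

theorem Rel.init : Rel St.init fun _ => 0 := ⟨fun _ => rfl, fun _ => rfl, fun _ _ => rfl⟩

theorem GRep.init (hD : Dims T N J) :
    GRep prim P Pr n T Γ N J 0 0 (fun _ => 0) (fun _ => 0) ∅ St.init := by
  refine ⟨le_rfl, fun _ => ∅, ⟨fun i hi => ⟨by simp, by simp, fun _ => rfl, by simp⟩, fun i hi =>
    ⟨fun k => by simp [lv, St.init], by simp [lv, St.init], fun dir v hv hv0 => ?_,
      fun dir v hv => rfl⟩, fun k => rfl, rfl, fun k => by simp [St.init], fun v hv hv' => ?_,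
      by simp, by simp, by simp, by simp, rfl⟩,
    ⟨⟨fun _ => 0, 0, fun _ => rfl, rfl, by simp, by simp, fun _ _ _ _ => rfl⟩, ?_, ?_,
      fun _ => ⟨[], [], [], 0, 0⟩, fun c hc => ⟨⟨⟨⟨0, rfl, rfl, rfl⟩, rfl, by simp, fun _ _ => rfl,
        by simp⟩, ⟨⟨0, rfl, rfl, rfl, by simp⟩, rfl, rfl⟩⟩, WF.init J, CInv.init ..⟩, 0, ?_, rfl, rfl⟩⟩
  · cases dir <;> simp [node, join, lv, St.init]
  · obtain rfl : v = 1 := by omega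
    simp [St.init]
  · simp [St.init]
  · simp [St.init]
  · have := hD.hN; omega

/-- What a call of the query program relies on. -/
theorem GRep.query (hP : P.Solves prim Pr n T Γ Q) (hD : Dims T N J)
    (hG : GRep prim P Pr n T Γ N J u M it κ S σ) {q : ℕ} (hq : q ∈ Pr.queries) (h0 : σ.io 0 = q)
    (h1 : σ.io 1 = n) (h2 : σ.io 2 = T) :
    Spec prim (query P) σ (3000 * Q) fun σ' => Pr.correct (S.image it) q (σ'.io 0) ∧
      GRep prim P Pr n T Γ N J u M it κ S σ' := by
  obtain ⟨hMu, L, hS, hW, hzc, hcc, cp, hcp, c, hc, hcur, hidle⟩ := hG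
  have hNT := hD.le
  obtain ⟨hR, hwf, -⟩ := hcp c hc
  obtain ⟨l, -, hlog⟩ := hR.stk.log
  -- On an idle copy nothing waits, so the stack is a listing of exactly the current set. Its order
  -- does not matter to `Pr.correct`.
  have hset : ((cp c).stk.map fun e => it e.1).toFinset = S.image it := by
    ext y
    simp only [List.mem_toFinset, List.mem_map, Finset.mem_image]
    constructor
    · rintro ⟨e, he, rfl⟩
      exact ⟨e.1, hwf.sub e he, rfl⟩
    · rintro ⟨k, hk, rfl⟩
      have := hwf.cover k hk
      rw [(hwf.idle hidle).1, (hwf.idle hidle).2] at this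
      obtain ⟨e, he, rfl⟩ := List.mem_map.1 (this.resolve_right (by simp))
      exact ⟨e, he, rfl⟩
  obtain ⟨t, m', hex, ht, hans⟩ := (hP _ _ hlog.reach).2 q hq
  rw [hset] at hans
  -- From `1 ≤ t ≤ Q` the bound `1500 * (t + 1)` is at most `3000 * Q`.
  have := Exec.one_le hex
  refine (spec_query h0 h1 h2 hcur (by omega) hW hR hex).mono (by omega) fun σ' ⟨h3, h4⟩ =>
    ⟨h3 ▸ hans, hMu, L, hS.congr (fun y _ => h4.l y) h4.g h4.last, h4.wfm, by rwa [h4.l],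
      by rwa [h4.l], cp, fun c' hc' => ⟨h4.rep _ _ (by omega) _ (hcp c' hc').1, (hcp c' hc').2⟩, c, hc,
      h4.cur.trans hcur, hidle⟩

end Deletion

/-! ### From handles and states back to items and memories -/

section Main

variable {ι : Type} {prim : ι → ℕ → ℕ → ℕ} {P : IncrementalAlg ι} {Pr : DynProblem}
  {n T Γ Q : ℕ} {it κ : ℕ → ℕ} {N J u k M : ℕ} {S : Finset ℕ} {σ σ' : St}

theorem GRep.enter (hG : GRep prim P Pr n T Γ N J u M it κ S σ) (args : List ℕ) :
    GRep prim P Pr n T Γ N J u M it κ S (σ.enter args) := by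
  obtain ⟨hMu, L, hS, hW, hzc, hcc, cp, hcp, hcur⟩ := hG
  exact ⟨hMu, L, hS.congr (fun _ _ => rfl) (fun _ => rfl) rfl,
    hW.of_eq (fun _ => rfl) rfl, hzc, hcc, cp, fun c hc =>
      ⟨(hcp c hc).1.of_eq (fun _ => rfl) (fun _ => rfl) fun _ _ => rfl, (hcp c hc).2⟩, hcur⟩

theorem Spec.exec {c : Cmd ι} {b : ℕ} {R : St → Prop} (h : Spec prim c σ b R) {m : Memory}
    (hm : Rel σ m) : ∃ t m' σ', Exec prim c.code m t m' ∧ t ≤ b ∧ Rel σ' m' ∧ R σ' := by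
  obtain ⟨t, σ', hr, hb, hR⟩ := h
  obtain ⟨m', he, hm'⟩ := hr.exec hm
  exact ⟨t, m', σ', he, hb, hm', hR⟩

variable (P) in
/-- The fully dynamic algorithm. -/
def dynAlg : FullyDynamicAlg ι := ⟨(insProg P).code, (delProg P).code, (query P).code⟩

/-- The memory `m` represents the set `S` of items with the predictions `pred`, after `u` updates. -/
def Repr (prim : ι → ℕ → ℕ → ℕ) (P : IncrementalAlg ι) (Pr : DynProblem) (n T Γ N J u : ℕ)
    (S : Finset ℕ) (pred : ℕ → ℕ) (m : Memory) : Prop :=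
  ∃ σ M it κ S', Rel σ m ∧ GRep prim P Pr n T Γ N J u M it κ S' σ ∧ S = S'.image it ∧
    ∀ h ∈ S', pred (it h) = κ (T * h)

variable {pred : ℕ → ℕ} {m : Memory}

theorem Repr.ins (hP : P.Solves prim Pr n T Γ Q) (hD : Dims T N J)
    (h : Repr prim P Pr n T Γ N J u S pred m) (hu : u < T) {x : ℕ} (hx : x ∈ Pr.items)
    (hxS : x ∉ S) (d : ℕ) : ∃ t m', Exec prim (dynAlg P).onInsert (enter [x, d, n, T] m) t m' ∧
      t ≤ 300000 * (N * N * (Γ + 1)) ∧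
      Repr prim P Pr n T Γ N J (u + 1) (insert x S) (Function.update pred x d) m' := by
  obtain ⟨σ, M, it, κ, S', hm, hG, rfl, hp⟩ := h
  have hxS' : ∀ k ∈ S', it k ≠ x := fun k hk h => hxS (Finset.mem_image.2 ⟨k, hk, h⟩)
  obtain ⟨t, m', σ', he, ht, hm', hG'⟩ := (spec_insProg (d := d) hP hD (hG.enter [x, d, n, T]) hu hx hxS'
    rfl rfl rfl rfl).exec (hm.enter (by simp))
  obtain ⟨-, L, hS, -⟩ := hG
  have hne : ∀ k ∈ S', k ≠ M + 1 := fun k hk => by have := (hS.mem k hk).2; omega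
  refine ⟨t, m', he, ht, σ', _, _, _, _, hm', hG', ?_, fun k hk => ?_⟩
  · rw [Finset.image_insert, Function.update_self]
    congr 1
    exact Finset.image_congr fun k hk => (Function.update_of_ne (hne k hk) ..).symm
  · have hT : T ≠ 0 := by have := hD.hT; omega
    rcases Finset.mem_insert.1 hk with rfl | hk
    · simp
    · rw [Function.update_of_ne (hne k hk), Function.update_of_ne (hxS' k hk),
        Function.update_of_ne (by rw [ne_eq, Nat.mul_right_inj hT]; exact hne k hk), hp k hk]

theorem Repr.del (hP : P.Solves prim Pr n T Γ Q) (hD : Dims T N J)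
    (h : Repr prim P Pr n T Γ N J u S pred m) (hu : u < T) {x : ℕ} (hxS : x ∈ S) :
    ∃ t m', Exec prim (dynAlg P).onDelete (enter [x, n, T] m) t m' ∧
      t ≤ 400000 * (N * N * (Γ + 1) * (1 + predictionError S pred x)) ∧
      Repr prim P Pr n T Γ N J (u + 1) (S.erase x) pred m' := by
  obtain ⟨σ, M, it, κ, S', hm, hG, rfl, hp⟩ := h
  obtain ⟨k, hk, rfl⟩ := Finset.mem_image.1 hxS
  obtain ⟨t, m', σ', he, ht, hm', hG'⟩ := (spec_delProg hP hD (hG.enter [it k, n, T]) hu hk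
    rfl rfl rfl).exec (hm.enter (by simp))
  obtain ⟨-, L, hS, -⟩ := hG
  have herase : (S'.image it).erase (it k) = (S'.erase k).image it := by
    ext y
    simp only [Finset.mem_erase, Finset.mem_image]
    constructor
    · rintro ⟨h1, l, hl, rfl⟩
      exact ⟨l, ⟨fun h => h1 (h ▸ rfl), hl⟩, rfl⟩
    · rintro ⟨l, ⟨h1, hl⟩, rfl⟩
      exact ⟨fun h => h1 (hS.inj hl hk h), l, hl, rfl⟩
  -- Handles of current items correspond to items one to one, so counting either gives the same
  -- error.
  have herr : predictionError (S'.image it) pred (it k) = rank S' (fun k => κ (T * k)) k := by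
    rw [predictionError, herase, Finset.filter_image, rank,
      Finset.card_image_of_injOn (hS.inj.mono fun l hl => Finset.mem_of_mem_erase
        (Finset.mem_of_mem_filter _ hl))]
    congr 1
    refine Finset.filter_congr fun l hl => ?_
    rw [hp l (Finset.mem_of_mem_erase hl), hp k hk]
  exact ⟨t, m', he, by rwa [herr], σ', _, _, _, _, hm', hG', herase,
    fun l hl => hp l (Finset.mem_of_mem_erase hl)⟩

theorem Repr.query (hP : P.Solves prim Pr n T Γ Q) (hD : Dims T N J)
    (h : Repr prim P Pr n T Γ N J u S pred m) {q : ℕ} (hq : q ∈ Pr.queries) :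
    ∃ t m', Exec prim (dynAlg P).onQuery (enter [q, n, T] m) t m' ∧ t ≤ 3000 * Q ∧
      Pr.correct S q (m' 0) ∧ Repr prim P Pr n T Γ N J u S pred m' := by
  obtain ⟨σ, M, it, κ, S', hm, hG, rfl, hp⟩ := h
  obtain ⟨t, m', σ', he, ht, hm', hc, hG'⟩ := ((hG.enter [q, n, T]).query hP hD hq
    rfl rfl rfl).exec (hm.enter (by simp))
  exact ⟨t, m', he, ht, by rw [← hm'.io 0] at hc; exact hc, σ', _, _, _, _, hm', hG', rfl, hp⟩

theorem repr_of_reach (hP : P.Solves prim Pr n T Γ Q) (hD : Dims T N J)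
    (h : (dynAlg P).Reach prim Pr n T u S pred m) : Repr prim P Pr n T Γ N J u S pred m := by
  induction h with
  | start => exact ⟨_, _, _, _, _, Rel.init, GRep.init hD, rfl, by simp⟩
  | ins _ hu hx hxS he ih =>
    obtain ⟨t, m', he', -, h⟩ := ih.ins hP hD hu hx hxS _
    -- `Reach` supplies some execution. By determinism it is the one constructed here, so its final
    -- memory is the represented one.
    rwa [(Exec.det he he').2]
  | del _ hu hxS he ih =>
    obtain ⟨t, m', he', -, h⟩ := ih.del hP hD hu hxS
    rwa [(Exec.det he he').2]
  | ask _ hq he ih =>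
    obtain ⟨t, m', he', -, -, h⟩ := ih.query hP hD hq
    rwa [(Exec.det he he').2]

theorem Repr.items (h : Repr prim P Pr n T Γ N J u S pred m) {x : ℕ} (hx : x ∈ S) :
    x ∈ Pr.items := by
  obtain ⟨σ, M, it, κ, S', -, ⟨-, L, hS, -⟩, rfl, -⟩ := h
  obtain ⟨k, hk, rfl⟩ := Finset.mem_image.1 hx
  exact hS.items k hk

/-- Inserting the item into the empty set already takes a step. This allows the final bounds to have
`Γ` in place of `Γ + 1`. -/
theorem one_le_of_solves (hP : P.Solves prim Pr n T Γ Q) (hT : 0 < T) {x : ℕ}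
    (hx : x ∈ Pr.items) : 1 ≤ Γ := by
  obtain ⟨t, m', he, ht⟩ := (hP _ _ .start).1 x hx (by simp) (by simpa using hT)
  exact (Exec.one_le he).trans ht

/-- Write `N = (J - 1) + 2`. Since `2 ^ (J - 1) < T` and `2 ≤ T`, this is at most `3 / log 2` times
`log T`. -/
theorem Dims.le_log (hD : Dims T N J) : (N : ℝ) ≤ 5 * Real.log T := by
  have hT : (2 : ℝ) ≤ T := by exact_mod_cast hD.hT
  have hJ := hD.one_le
  have h1 : 2 ^ (J - 1) < T := Nat.pow_lt_of_lt_clog (by have := hD.hJ; omega)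
  have h2 : ((J - 1 : ℕ) : ℝ) * Real.log 2 ≤ Real.log T := by
    rw [← Real.log_pow]
    exact Real.log_le_log (by positivity) (by exact_mod_cast h1.le)
  have h3 : Real.log 2 ≤ Real.log T := Real.log_le_log (by norm_num) hT
  have h4 := Real.log_two_gt_d9
  have h5 : (N : ℝ) = ((J - 1 : ℕ) : ℝ) + 2 := by
    rw [hD.hN]
    have : J + 1 = (J - 1) + 2 := by omega
    exact_mod_cast this
  have h6 : (0 : ℝ) ≤ ((J - 1 : ℕ) : ℝ) := Nat.cast_nonneg _
  nlinarith

theorem cost_le (hD : Dims T N J) (hΓ : 1 ≤ Γ) :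
    ((N * N * (Γ + 1) : ℕ) : ℝ) ≤ 50 * (Γ * Real.log T ^ 2) := by
  have h1 := hD.le_log
  have h2 : (1 : ℝ) ≤ Γ := by exact_mod_cast hΓ
  have h3 : (N : ℝ) * N ≤ 25 * Real.log T ^ 2 := by
    have h4 : (0 : ℝ) ≤ N := Nat.cast_nonneg _
    calc (N : ℝ) * N ≤ (5 * Real.log T) * (5 * Real.log T) := mul_self_le_mul_self h4 h1
      _ = 25 * Real.log T ^ 2 := by ring
  push_cast
  calc (N : ℝ) * N * (Γ + 1) ≤ 25 * Real.log T ^ 2 * (2 * Γ) := by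
        gcongr
        linarith
    _ = 50 * (Γ * Real.log T ^ 2) := by ring

/-- The constant is `400000 * 50`, the factor of deletions times the one from `cost_le`; insertions
and queries need less. -/
theorem dynAlg_solves (hT : 2 ≤ T) (hP : P.Solves prim Pr n T Γ Q) :
    (dynAlg P).Solves prim Pr n T (20000000 * (Γ * Real.log T ^ 2))
      (fun η => 20000000 * ((1 + η) * Γ * Real.log T ^ 2)) (20000000 * Q) := by
  have hD : Dims T (Nat.clog 2 T + 1) (Nat.clog 2 T) := ⟨hT, rfl, rfl⟩
  intro u S pred m h
  have hR := repr_of_reach hP hD h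
  refine ⟨fun hu x hx hxS d => ?_, fun hu x hx => ?_, fun q hq => ?_⟩
  · obtain ⟨t, m', he, ht, -⟩ := hR.ins hP hD hu hx hxS d
    refine ⟨t, m', he, ?_⟩
    have h1 := cost_le hD (one_le_of_solves hP (by omega) hx)
    have h2 := (Nat.cast_le (α := ℝ)).2 ht
    rw [Nat.cast_mul, Nat.cast_ofNat] at h2
    have h3 : (0 : ℝ) ≤ Γ * Real.log T ^ 2 := by positivity
    exact h2.trans (by linarith)
  · obtain ⟨t, m', he, ht, -⟩ := hR.del hP hD hu hx
    refine ⟨t, m', he, ?_⟩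
    have h1 := cost_le hD (one_le_of_solves hP (by omega) (hR.items hx))
    set η := predictionError S pred x
    rw [← mul_assoc] at ht
    have h2 := (Nat.cast_le (α := ℝ)).2 ht
    rw [Nat.cast_mul, Nat.cast_mul, Nat.cast_add, Nat.cast_one, Nat.cast_ofNat] at h2
    refine h2.trans ?_
    calc _ ≤ 400000 * (50 * (Γ * Real.log T ^ 2)) * (1 + (η : ℝ)) := by gcongr
      _ = _ := by ring
  · obtain ⟨t, m', he, ht, hc, -⟩ := hR.query hP hD hq
    refine ⟨t, m', he, ?_, hc⟩
    have h2 : (t : ℝ) ≤ 3000 * (Q : ℝ) := by exact_mod_cast ht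
    have h3 : (0 : ℝ) ≤ Q := Nat.cast_nonneg _
    linarith

end Main

end RamDyn

theorem theorem1p5 :
    ∃ C : ℝ, ∀ (ι : Type) (prim : ι → ℕ → ℕ → ℕ) (P : IncrementalAlg ι),
      ∃ D : FullyDynamicAlg ι, ∀ (Pr : DynProblem) (n T Γ Q : ℕ), 2 ≤ T →
        P.Solves prim Pr n T Γ Q →
        D.Solves prim Pr n T
          (C * (Γ * Real.log T ^ 2))
          (fun η => C * ((1 + η) * Γ * Real.log T ^ 2))
          (C * Q) :=
  ⟨20000000, fun _ _ P => ⟨RamDyn.dynAlg P, fun _ _ _ _ _ hT hP => RamDyn.dynAlg_solves hT hP⟩⟩
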